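/- Let $\Gamma$ be a (discrete) group and $\Lambda$ a ring. A group over $\Gamma$ is a pair $(G,\xi)$ with $G$ a group and $\xi\colon G\to\Gamma$ a homomorphism; a morphism $(H,\xi)\to(G,\mu)$ is a homomorphism $\alpha\colon H\to G$ with $\mu\circ\alpha=\xi$. For a homomorphism $\alpha\colon H\to G$ write $\alpha^*$ for restriction of $G$-spaces to $H$-spaces along $\alpha$ and $\alpha_*X=G\times_\alpha X$ for induction. A $G$-homology theory $\mathcal H^G_*$ with values in $\Lambda$-modules consists of covariant functors $\mathcal H^G_n$ ($n\in\mathbb Z$) from $G$-CW-pairs (and all $G$-maps of pairs) to $\Lambda$-modules and natural boundary maps $\partial_n\colon\mathcal H^G_n(X,A)\to\mathcal H^G_{n-1}(A)$, satisfying $G$-homotopy invariance, the long exact sequence of a pair, excision (for a cellular $G$-map $f\colon A\to B$, $\mathcal H^G_n(X,A)\cong\mathcal H^G_n(X\cup_fB,B)$) and the disjoint union axiom for arbitrary families. An equivariant homology theory $\mathcal H^?_*$ over $\Gamma$ with values in $\Lambda$-modules assigns to every group $(G,\xi)$ over $\Gamma$ a $G$-homology theory $\mathcal H^G_*$, and to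 every morphism $\alpha\colon(H,\xi)\to(G,\mu)$ of groups over $\Gamma$ natural homomorphisms $\mathrm{ind}_\alpha\colon\mathcal H^H_n(X,A)\to\mathcal H^G_n(\alpha_*(X,A))$ for $H$-CW-pairs $(X,A)$, such that: $\mathrm{ind}_\alpha$ commutes with the boundary maps; $\mathrm{ind}_{\beta\circ\alpha}=\mathcal H_n(f_1)\circ\mathrm{ind}_\beta\circ\mathrm{ind}_\alpha$ for the canonical homeomorphism $f_1\colon\beta_*\alpha_*(X,A)\to(\beta\circ\alpha)_*(X,A)$; for $g\in G$ with $\xi(g)=1$ and conjugation $c(g)\colon k\mapsto gkg^{-1}$, $\mathrm{ind}_{c(g)}=\mathcal H^G_n(f_2)$ where $f_2\colon(X,A)\to c(g)_*(X,A)$, $x\mapsto(1,g^{-1}x)$; and if $\alpha$ is injective, then $\mathrm{ind}_\alpha\colon\mathcal H^H_n(\{\bullet\})\to\mathcal H^G_n(\alpha_*\{\bullet\})$ is bijective for all $n$. Let $\{G_i\mid i\in I\}$ be a directed system of groups (with not necessarily injective transition maps $\phi_{i,j}$, indexed by a non-empty directed set $I$) with $G=\operatorname{colim}_{i\in I}G_i$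 and structure maps $\psi_i\colon G_i\to G$, where $G$ is a group over $\Gamma$ by $\xi$ and $G_i$ by $\xi\circ\psi_i$. For a $G$-CW-pair $(X,A)$ the maps $\mathcal H_n^{G_i}(\psi_i^*(X,A))\xrightarrow{\mathrm{ind}_{\psi_i}}\mathcal H_n^G((\psi_i)_*\psi_i^*(X,A))\to\mathcal H_n^G(X,A)$, the second one being induced by $(g,x)\mapsto gx$, together define a map $t^G_n(X,A)\colon\operatorname{colim}_{i\in I}\mathcal H^{G_i}_n(\psi_i^*(X,A))\to\mathcal H^G_n(X,A)$ (the transition maps of the source are defined in the same way from the $\phi_{i,j}$). The theory $\mathcal H^?_*$ is strongly continuous if $t^G_n(\{\bullet\})$ is an isomorphism for every $(G,\xi)$ over $\Gamma$, every such directed system with colimit $G$ and every $n\in\mathbb Z$. A family $\mathcal F$ of subgroups of $G$ is a set of subgroups closed under conjugation and under passing to subgroups; for $\phi\colon K\to G$ put $\phi^*\mathcal F=\{U\le K\mid\phi(U)\in\mathcal F\}$. Let $E_{\mathcal F}(G)$ be a $G$-CW-complex whose $U$-fixed point set is contractible for $U\in\mathcal F$ and empty for $U\notin\mathcal F$; it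 is unique up to $G$-homotopy equivalence. The Isomorphism Conjecture holds for $(G,\xi)$ and $\mathcal F$ if the projection induces isomorphisms $\mathcal H^G_n(E_{\mathcal F}(G))\to\mathcal H^G_n(\{\bullet\})$ for all $n\in\mathbb Z$. The Fibered Isomorphism Conjecture holds for $(G,\xi)$ and $\mathcal F$ if for every group homomorphism $\phi\colon K\to G$ the Isomorphism Conjecture holds for $(K,\xi\circ\phi)$ and $\phi^*\mathcal F$. **Theorem.** Let $\mathcal H^?_*$ be a strongly continuous equivariant homology theory over $\Gamma$ with values in $\Lambda$-modules. Let $(G,\xi)$ be a group over $\Gamma$, let $\mathcal F$ be a family of subgroups of $G$, and let $\{G_i\mid i\in I\}$ be a directed system of groups with $G=\operatorname{colim}_{i\in I}G_i$ and structure maps $\psi_i\colon G_i\to G$. Suppose that for every $i\in I$ the Fibered Isomorphism Conjecture holds for $(G_i,\xi\circ\psi_i)$ and $\psi_i^*\mathcal F$. Then the Fibered Isomorphism Conjecture holds for $(G,\xi)$ and $\mathcal F$. -/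

import Mathlib

open CategoryTheory

universe u v w x

/-! ### Equivariant CW-complexes (for discrete groups) -/

/-- The closed unit disk `D^n`; its interior is `‖v‖ < 1`, its boundary sphere is `‖v‖ = 1`. -/
abbrev Disk (n : ℕ) : Type := Metric.closedBall (0 : EuclideanSpace ℝ (Fin n)) 1

/-- A `G`-CW-structure on a `G`-space `X`: an exhausting filtration by closed `G`-invariant subsets,
where `skel n` is the `(n-1)`-skeleton (so `skel 0 = ∅`), such that `X` carries the colimit topology
and `skel (n+1)` arises from `skel n` by attaching equivariant `n`-cells, that is, as a pushout of
`skel n ← S × S^{n-1} → S × D^n` for a discrete `G`-set `S = cell n`.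
(A `G`-set is the same as a disjoint union of orbits `G/H`, so that `S × D^n = ∐ G/H × D^n`.) -/
structure GCWStructure (G : Type u) [Group G] (X : Type u) [TopologicalSpace X]
    [MulAction G X] where
  /-- `skel n` is the skeleton of dimension `n - 1` -/
  skel : ℕ → Set X
  skel_zero : skel 0 = ∅
  skel_mono : Monotone skel
  exists_mem_skel : ∀ p : X, ∃ n, p ∈ skel n
  smul_mem_skel : ∀ (n : ℕ) (g : G) (p : X), p ∈ skel n → g • p ∈ skel n
  isClosed_skel : ∀ n, IsClosed (skel n)
  /-- `X` has the colimit topology with respect to the filtration -/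
  isClosed_of_skel : ∀ C : Set X, (∀ n, IsClosed (C ∩ skel n)) → IsClosed C
  /-- the discrete `G`-set of (non-equivariant) `n`-cells -/
  cell : ℕ → Type u
  cellAction : ∀ n, MulAction G (cell n)
  /-- the characteristic maps -/
  charMap : ∀ n, cell n → Disk n → X
  continuous_charMap : ∀ n e, Continuous (charMap n e)
  charMap_smul : ∀ n (g : G) (e : cell n) (p : Disk n), charMap n (g • e) p = g • charMap n e p
  charMap_mem : ∀ n e p, charMap n e p ∈ skel (n + 1)
  charMap_boundary : ∀ n e (p : Disk n), ‖p.1‖ = 1 → charMap n e p ∈ skel n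
  /-- as a set, `skel (n+1)` is the disjoint union of `skel n` and the open `n`-cells, that is,
  the characteristic maps define a bijection from `S × (D^n ∖ S^{n-1})` to `skel (n+1) ∖ skel n` -/
  charMap_interior : ∀ n e (p : Disk n), ‖p.1‖ < 1 → charMap n e p ∉ skel n
  charMap_injective : ∀ n e e' (p p' : Disk n), ‖p.1‖ < 1 → ‖p'.1‖ < 1 →
    charMap n e p = charMap n e' p' → e = e' ∧ p = p'
  exists_charMap : ∀ n, ∀ y ∈ skel (n + 1), y ∉ skel n →
    ∃ e, ∃ p : Disk n, ‖p.1‖ < 1 ∧ charMap n e p = y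
  /-- `skel (n+1)` has the pushout topology -/
  isClosed_of_charMap : ∀ n (C : Set X), C ⊆ skel (n + 1) → IsClosed (C ∩ skel n) →
    (∀ e, IsClosed (charMap n e ⁻¹' C)) → IsClosed C

attribute [instance] GCWStructure.cellAction

/-- A `G`-invariant subset `A` is a subcomplex if it is closed and contains every closed cell
whose interior it meets. -/
structure GCWStructure.IsSubcomplex {G : Type u} [Group G] {X : Type u} [TopologicalSpace X]
    [MulAction G X] (S : GCWStructure G X) (A : SubMulAction G X) : Prop where
  isClosed : IsClosed (A : Set X)
  charMap_mem : ∀ n (e : S.cell n) (p q : Disk n), ‖p.1‖ < 1 → S.charMap n e p ∈ A →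
    S.charMap n e q ∈ A

/-- A `G`-CW-complex. -/
structure GCWComplex (G : Type u) [Group G] : Type (u + 1) where
  carrier : Type u
  [top : TopologicalSpace carrier]
  [act : MulAction G carrier]
  [cont : ContinuousConstSMul G carrier]
  cw : GCWStructure G carrier

attribute [instance] GCWComplex.top GCWComplex.act GCWComplex.cont

/-- A `G`-CW-pair `(X, A)`: a `G`-CW-complex together with a subcomplex. -/
structure GCWPair (G : Type u) [Group G] : Type (u + 1) where
  space : GCWComplex G
  sub : SubMulAction G space.carrier
  isSubcomplex : space.cw.IsSubcomplex sub

/-- A morphism of `G`-CW-pairs is a (not necessarily cellular) continuous `G`-map of pairs. -/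
@[ext]
structure GCWPair.Hom {G : Type u} [Group G] (P Q : GCWPair G) where
  toFun : P.space.carrier → Q.space.carrier
  continuous_toFun : Continuous toFun
  map_smul : ∀ (g : G) (p : P.space.carrier), toFun (g • p) = g • toFun p
  map_sub : ∀ p ∈ P.sub, toFun p ∈ Q.sub

instance (G : Type u) [Group G] : Category.{u} (GCWPair.{u} G) where
  Hom := GCWPair.Hom
  id P := ⟨id, continuous_id, fun _ _ => rfl, fun _ h => h⟩
  comp f g := ⟨g.toFun ∘ f.toFun, g.continuous_toFun.comp f.continuous_toFun,
    fun a p => by simp [f.map_smul, g.map_smul], fun p hp => g.map_sub _ (f.map_sub _ hp)⟩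

namespace GCWPair

variable {G : Type u} [Group G]

@[ext]
theorem hom_ext {P Q : GCWPair G} (f g : P ⟶ Q) (h : ∀ p, f.toFun p = g.toFun p) : f = g :=
  Hom.ext (funext h)

@[simp] theorem id_toFun (P : GCWPair G) (p : P.space.carrier) : Hom.toFun (𝟙 P) p = p := rfl

@[simp] theorem comp_toFun {P Q R : GCWPair G} (f : P ⟶ Q) (g : Q ⟶ R) (p : P.space.carrier) :
    Hom.toFun (f ≫ g) p = g.toFun (f.toFun p) := rfl

/-- Two maps of pairs are `G`-homotopic. -/
def Homotopic {P Q : GCWPair G} (f₀ f₁ : P ⟶ Q) : Prop :=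
  ∃ h : unitInterval × P.space.carrier → Q.space.carrier, Continuous h ∧
    (∀ p, h (0, p) = f₀.toFun p) ∧ (∀ p, h (1, p) = f₁.toFun p) ∧
    (∀ t (g : G) p, h (t, g • p) = g • h (t, p)) ∧
    ∀ t, ∀ p ∈ P.sub, h (t, p) ∈ Q.sub

end GCWPair

/-- The induced `G`-CW-structure on a subcomplex. -/
def GCWStructure.restrictSub {G : Type u} [Group G] {X : Type u} [TopologicalSpace X]
    [MulAction G X] (S : GCWStructure G X) (A : SubMulAction G X) (hA : S.IsSubcomplex A) :
    GCWStructure G A where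
  skel n := Subtype.val ⁻¹' S.skel n
  skel_zero := by simp [S.skel_zero]
  skel_mono m n h := Set.preimage_mono (S.skel_mono h)
  exists_mem_skel p := S.exists_mem_skel p.1
  smul_mem_skel n g p hp := S.smul_mem_skel n g p.1 hp
  isClosed_skel n := (S.isClosed_skel n).preimage continuous_subtype_val
  isClosed_of_skel C hC := by
    have hemb := hA.isClosed.isClosedEmbedding_subtypeVal
    rw [hemb.isClosed_iff_image_isClosed]
    refine S.isClosed_of_skel _ fun n => ?_
    rw [← Set.image_inter_preimage]
    exact hemb.isClosedMap _ (hC n)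
  cell n := {e : S.cell n // ∀ p, S.charMap n e p ∈ A}
  cellAction n :=
    { smul := fun g e => ⟨g • e.1, fun p => by
        rw [S.charMap_smul]; exact A.smul_mem g (e.2 p)⟩
      one_smul := fun e => Subtype.ext (one_smul G e.1)
      mul_smul := fun g h e => Subtype.ext (mul_smul g h e.1) }
  charMap n e p := ⟨S.charMap n e.1 p, e.2 p⟩
  continuous_charMap n e := (S.continuous_charMap n e.1).subtype_mk _
  charMap_smul n g e p := Subtype.ext (S.charMap_smul n g e.1 p)
  charMap_mem n e p := S.charMap_mem n e.1 p
  charMap_boundary n e p hp := S.charMap_boundary n e.1 p hp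
  charMap_interior n e p hp := S.charMap_interior n e.1 p hp
  charMap_injective n e e' p p' hp hp' h := by
    obtain ⟨h₁, h₂⟩ := S.charMap_injective n e.1 e'.1 p p' hp hp' (congrArg Subtype.val h)
    exact ⟨Subtype.ext h₁, h₂⟩
  exists_charMap n y hy hy' := by
    obtain ⟨e, p, hp, h⟩ := S.exists_charMap n y.1 hy hy'
    exact ⟨⟨e, fun q => hA.charMap_mem n e p q hp (h ▸ y.2)⟩, p, hp, Subtype.ext h⟩
  isClosed_of_charMap n C hC h₁ h₂ := by
    have hemb := hA.isClosed.isClosedEmbedding_subtypeVal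
    rw [hemb.isClosed_iff_image_isClosed]
    refine S.isClosed_of_charMap n _ ?_ ?_ fun e => ?_
    · rintro _ ⟨y, hy, rfl⟩; exact hC hy
    · rw [← Set.image_inter_preimage]
      exact hemb.isClosedMap _ h₁
    · by_cases he : ∀ p, S.charMap n e p ∈ A
      · convert h₂ ⟨e, he⟩ using 1
        ext p
        constructor
        · rintro ⟨y, hy, h⟩
          have : y = ⟨S.charMap n e p, he p⟩ := Subtype.ext h
          rw [this] at hy; exact hy
        · intro hp; exact ⟨_, hp, rfl⟩
      · have key : S.charMap n e ⁻¹' (Subtype.val '' C) =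
            S.charMap n e ⁻¹' (Subtype.val '' (C ∩ Subtype.val ⁻¹' S.skel n)) := by
          ext p
          constructor
          · rintro ⟨y, hy, h⟩
            refine ⟨y, ⟨hy, ?_⟩, h⟩
            have hp : ‖p.1‖ ≤ 1 := mem_closedBall_zero_iff.1 p.2
            rcases hp.lt_or_eq with hp | hp
            · exact (he fun q => hA.charMap_mem n e p q hp (h ▸ y.2)).elim
            · change y.1 ∈ S.skel n
              rw [h]; exact S.charMap_boundary n e p hp
          · rintro ⟨y, hy, h⟩; exact ⟨y, hy.1, h⟩
        exact key ▸ (hemb.isClosedMap _ h₁).preimage (S.continuous_charMap n e)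

namespace GCWComplex

variable {G : Type u} [Group G]

/-- A `G`-CW-complex `X`, viewed as the pair `(X, ∅)`. -/
def toPair (X : GCWComplex G) : GCWPair G where
  space := X
  sub := ⊥
  isSubcomplex := ⟨isClosed_empty, fun _ _ _ _ _ h => h.elim⟩

/-- A continuous `G`-map of `G`-CW-complexes as a morphism of the pairs `(X, ∅)`. -/
def homMk {X Y : GCWComplex G} (f : X.carrier → Y.carrier) (hf : Continuous f)
    (hs : ∀ (g : G) p, f (g • p) = g • f p) : X.toPair ⟶ Y.toPair :=
  GCWPair.Hom.mk f hf hs (fun _ h => h.elim)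

/-- The one-point `G`-CW-complex. -/
def point (G : Type u) [Group G] : GCWComplex G :=
  letI : MulAction G PUnit.{u + 1} :=
    { smul := fun _ p => p, one_smul := fun _ => rfl, mul_smul := fun _ _ _ => rfl }
  { carrier := PUnit.{u + 1}
    cont := ⟨fun _ => continuous_id⟩
    cw :=
      { skel := fun n => {_p | 0 < n}
        skel_zero := by simp
        skel_mono := fun m n h p hp => lt_of_lt_of_le hp h
        exists_mem_skel := fun p => ⟨1, Nat.one_pos⟩
        smul_mem_skel := fun _ _ _ h => h
        isClosed_skel := fun _ => isClosed_discrete _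
        isClosed_of_skel := fun _ _ => isClosed_discrete _
        cell := fun n => {_p : PUnit.{u + 1} // n = 0}
        cellAction := fun n =>
          { smul := fun _ p => p, one_smul := fun _ => rfl, mul_smul := fun _ _ _ => rfl }
        charMap := fun _ _ _ => PUnit.unit
        continuous_charMap := fun _ _ => continuous_const
        charMap_smul := fun _ _ _ _ => rfl
        charMap_mem := fun n _ _ => Nat.succ_pos n
        charMap_boundary := by
          rintro n ⟨_, rfl⟩ p hp
          have : p.1 = 0 := Subsingleton.elim _ _
          simp [this] at hp
        charMap_interior := by
          rintro n ⟨_, rfl⟩ p hp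
          exact lt_irrefl 0
        charMap_injective := by
          rintro n ⟨_, rfl⟩ ⟨_, _⟩ p p' _ _ _
          exact ⟨rfl, Subtype.ext (Subsingleton.elim _ _)⟩
        exists_charMap := by
          intro n y _ hn
          have hn : ¬ 0 < n := hn
          obtain rfl : n = 0 := by omega
          exact ⟨⟨PUnit.unit, rfl⟩, ⟨0, by simp⟩, by simp, rfl⟩
        isClosed_of_charMap := fun _ _ _ _ _ => isClosed_discrete _ } }

/-- The projection of a `G`-CW-complex to the one-point space. -/
def toPoint (X : GCWComplex G) : X.toPair ⟶ (point G).toPair :=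
  homMk (fun _ => PUnit.unit) continuous_const (fun _ _ => rfl)

/-- The disjoint union of a family of `G`-CW-complexes. -/
def coprod {J : Type u} (X : J → GCWComplex G) : GCWComplex G where
  carrier := Σ j, (X j).carrier
  cont := ⟨fun g => by
    refine continuous_sigma fun j => ?_
    exact continuous_sigmaMk.comp (continuous_const_smul g)⟩
  cw :=
    { skel := fun n => {p | p.2 ∈ (X p.1).cw.skel n}
      skel_zero := by ext p; simp [(X p.1).cw.skel_zero]
      skel_mono := fun m n h p hp => (X p.1).cw.skel_mono h hp
      exists_mem_skel := fun p => (X p.1).cw.exists_mem_skel p.2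
      smul_mem_skel := fun n g p hp => (X p.1).cw.smul_mem_skel n g p.2 hp
      isClosed_skel := fun n => isClosed_sigma_iff.2 fun j => (X j).cw.isClosed_skel n
      isClosed_of_skel := fun C hC => isClosed_sigma_iff.2 fun j =>
        (X j).cw.isClosed_of_skel _ fun n => isClosed_sigma_iff.1 (hC n) j
      cell := fun n => Σ j, (X j).cw.cell n
      cellAction := fun n => inferInstance
      charMap := fun n e p => ⟨e.1, (X e.1).cw.charMap n e.2 p⟩
      continuous_charMap := fun n e =>
        continuous_sigmaMk.comp ((X e.1).cw.continuous_charMap n e.2)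
      charMap_smul := fun n g e p =>
        congrArg (Sigma.mk e.1) ((X e.1).cw.charMap_smul n g e.2 p)
      charMap_mem := fun n e p => (X e.1).cw.charMap_mem n e.2 p
      charMap_boundary := fun n e p hp => (X e.1).cw.charMap_boundary n e.2 p hp
      charMap_interior := fun n e p hp => (X e.1).cw.charMap_interior n e.2 p hp
      charMap_injective := by
        rintro n ⟨j, e⟩ ⟨k, e'⟩ p p' hp hp' h
        obtain rfl : j = k := congrArg Sigma.fst h
        obtain ⟨rfl, h₂⟩ :=
          (X j).cw.charMap_injective n e e' p p' hp hp' (eq_of_heq (Sigma.mk.inj h).2)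
        exact ⟨rfl, h₂⟩
      exists_charMap := by
        rintro n ⟨j, y⟩ hy hy'
        obtain ⟨e, p, hp, h⟩ := (X j).cw.exists_charMap n y hy hy'
        exact ⟨⟨j, e⟩, p, hp, congrArg (Sigma.mk j) h⟩
      isClosed_of_charMap := fun n C hC h₁ h₂ => isClosed_sigma_iff.2 fun j =>
        (X j).cw.isClosed_of_charMap n _ (fun y hy => hC hy) (isClosed_sigma_iff.1 h₁ j)
          fun e => h₂ ⟨j, e⟩ }

/-- The inclusion of a summand of a disjoint union. -/
def coprodIncl {J : Type u} (X : J → GCWComplex G) (j : J) : (X j).toPair ⟶ (coprod X).toPair :=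
  homMk (Y := coprod X) (fun p => ⟨j, p⟩)
    (continuous_sigmaMk (σ := fun j => (X j).carrier) (i := j)) (fun _ _ => rfl)

end GCWComplex

namespace GCWPair

variable {G : Type u} [Group G]

/-- The subcomplex `A` of a pair `(X, A)` as a `G`-CW-complex. -/
def subComplex (P : GCWPair G) : GCWComplex G where
  carrier := P.sub
  cont := ⟨fun g => ((continuous_const_smul g).comp continuous_subtype_val).subtype_mk _⟩
  cw := P.space.cw.restrictSub P.sub P.isSubcomplex

/-- The functor `(X, A) ↦ (A, ∅)`. -/
def subFunctor (G : Type u) [Group G] : GCWPair.{u} G ⥤ GCWPair.{u} G where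
  obj P := P.subComplex.toPair
  map {P Q} f := GCWComplex.homMk (X := P.subComplex) (Y := Q.subComplex)
    (fun p => ⟨f.toFun p.1, f.map_sub p.1 p.2⟩)
    ((f.continuous_toFun.comp continuous_subtype_val).subtype_mk _)
    (fun g p => Subtype.ext (f.map_smul g p.1))
  map_id _ := rfl
  map_comp _ _ := rfl

/-- The inclusion `i : (A, ∅) → (X, ∅)`. -/
def inclSub (P : GCWPair G) : (subFunctor G).obj P ⟶ P.space.toPair :=
  GCWComplex.homMk (X := P.subComplex) Subtype.val continuous_subtype_val (fun _ _ => rfl)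

/-- The inclusion `j : (X, ∅) → (X, A)`. -/
def inclPair (P : GCWPair G) : P.space.toPair ⟶ P :=
  Hom.mk (P := P.space.toPair) id continuous_id (fun _ _ => rfl) (fun _ h => h.elim)

/-- `F : (X, A) → (Y, B)` exhibits `Y` as `X ∪_f B` for a cellular map `f : A → B`, the restriction
of `F`: the square formed by `A → X`, `f`, `F` and `B → Y` is a pushout of `G`-spaces, i.e. `Y` is
as a set the disjoint union of `B` and `X ∖ A`, with the quotient topology from `X ⊔ B`. -/
structure IsCellularPushout {P Q : GCWPair G} (F : P ⟶ Q) : Prop where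
  cellular : ∀ n, ∀ p ∈ P.sub, p ∈ P.space.cw.skel n → F.toFun p ∈ Q.space.cw.skel n
  bijOn : Set.BijOn F.toFun (P.sub : Set P.space.carrier)ᶜ (Q.sub : Set Q.space.carrier)ᶜ
  isClosed_of_preimage : ∀ C : Set Q.space.carrier, IsClosed (F.toFun ⁻¹' C) →
    IsClosed (C ∩ Q.sub) → IsClosed C

end GCWPair

/-! ### Homology theories for a fixed group -/

open Classical in
/-- A `G`-homology theory with values in `Λ`-modules. The boundary operator `bdry n` is
`∂_{n+1} : H_{n+1}(X, A) → H_n(A)`. -/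
structure GHomologyTheory (G : Type u) [Group G] (Λ : Type w) [Ring Λ] where
  H : ℤ → GCWPair.{u} G ⥤ ModuleCat.{x} Λ
  bdry : ∀ n : ℤ, H (n + 1) ⟶ GCWPair.subFunctor G ⋙ H n
  homotopy_invariance : ∀ (n : ℤ) {P Q : GCWPair G} (f₀ f₁ : P ⟶ Q),
    GCWPair.Homotopic f₀ f₁ → (H n).map f₀ = (H n).map f₁
  exact_space : ∀ (n : ℤ) (P : GCWPair G),
    Function.Exact ((H n).map P.inclSub).hom ((H n).map P.inclPair).hom
  exact_pair : ∀ (n : ℤ) (P : GCWPair G),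
    Function.Exact ((H (n + 1)).map P.inclPair).hom ((bdry n).app P).hom
  exact_sub : ∀ (n : ℤ) (P : GCWPair G),
    Function.Exact ((bdry n).app P).hom ((H n).map P.inclSub).hom
  excision : ∀ (n : ℤ) {P Q : GCWPair G} (F : P ⟶ Q), GCWPair.IsCellularPushout F →
    Function.Bijective ((H n).map F).hom
  disjoint_union : ∀ (n : ℤ) {J : Type u} (X : J → GCWComplex G),
    Function.Bijective (DirectSum.toModule Λ J ((H n).obj (GCWComplex.coprod X).toPair)
      fun j => ((H n).map (GCWComplex.coprodIncl X j)).hom)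

/-! ### Restriction and induction along a group homomorphism -/

section Restriction

variable {H G K : Type u} [Group H] [Group G] [Group K]

/-- The restriction `α^*X` of a `G`-CW-complex along `α : H → G`: same space, same cells. -/
def GCWComplex.res (α : H →* G) (X : GCWComplex G) : GCWComplex H :=
  letI : MulAction H X.carrier := MulAction.compHom X.carrier α
  { carrier := X.carrier
    cont := ⟨fun h => continuous_const_smul (α h)⟩
    cw :=
      { skel := X.cw.skel
        skel_zero := X.cw.skel_zero
        skel_mono := X.cw.skel_mono
        exists_mem_skel := X.cw.exists_mem_skel
        smul_mem_skel := fun n h p hp => X.cw.smul_mem_skel n (α h) p hp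
        isClosed_skel := X.cw.isClosed_skel
        isClosed_of_skel := X.cw.isClosed_of_skel
        cell := X.cw.cell
        cellAction := fun n => MulAction.compHom (X.cw.cell n) α
        charMap := X.cw.charMap
        continuous_charMap := X.cw.continuous_charMap
        charMap_smul := fun n h e p => X.cw.charMap_smul n (α h) e p
        charMap_mem := X.cw.charMap_mem
        charMap_boundary := X.cw.charMap_boundary
        charMap_interior := X.cw.charMap_interior
        charMap_injective := X.cw.charMap_injective
        exists_charMap := X.cw.exists_charMap
        isClosed_of_charMap := X.cw.isClosed_of_charMap } }

/-- The restriction `α^*(X, A)` of a `G`-CW-pair along `α : H → G`. -/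
def GCWPair.res (α : H →* G) (P : GCWPair G) : GCWPair H where
  space := P.space.res α
  sub := { carrier := (P.sub : Set P.space.carrier)
           smul_mem' := fun h _ hp => P.sub.smul_mem (α h) hp }
  isSubcomplex := ⟨P.isSubcomplex.isClosed, P.isSubcomplex.charMap_mem⟩

/-- If `β ∘ α = γ`, the identity map is an isomorphism `γ^*P = α^*(β^*P)`;
this is the map from left to right. -/
def GCWPair.resIdent (α : H →* G) (β : G →* K) (γ : H →* K) (h : β.comp α = γ) (P : GCWPair K) :
    P.res γ ⟶ (P.res β).res α :=
  Hom.mk (P := P.res γ) (Q := (P.res β).res α) id continuous_id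
    (fun _ _ => by subst h; rfl) (fun _ hp => hp)

end Restriction

section Induction

variable {H G : Type u} [Group H] [Group G]

/-- The orbit relation of the right `H`-action `(g, p) · h = (g α(h), h⁻¹ p)` on `G × X`. -/
def inducedSetoid (α : H →* G) (X : Type u) [MulAction H X] : Setoid (G × X) where
  r a b := ∃ h : H, b = (a.1 * α h, h⁻¹ • a.2)
  iseqv :=
    { refl := fun a => ⟨1, by simp⟩
      symm := by
        rintro a b ⟨h, rfl⟩
        exact ⟨h⁻¹, by simp⟩
      trans := by
        rintro a b c ⟨h, rfl⟩ ⟨k, rfl⟩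
        exact ⟨h * k, by simp [mul_assoc, mul_smul]⟩ }

/-- The set `α_*X = G ×_α X`. -/
def Induced (α : H →* G) (X : Type u) [MulAction H X] : Type u := Quotient (inducedSetoid α X)

namespace Induced

variable (α : H →* G) {X : Type u} [MulAction H X]

/-- The class of `(g, p)`. -/
def mk (g : G) (p : X) : Induced α X := Quotient.mk (inducedSetoid α X) (g, p)

variable {α}

theorem mk_eq_iff {g g' : G} {p p' : X} :
    mk α g p = mk α g' p' ↔ ∃ h : H, g' = g * α h ∧ p' = h⁻¹ • p := by
  refine Iff.trans (Quotient.eq (r := inducedSetoid α X)) ?_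
  exact exists_congr fun h => Prod.ext_iff

theorem mk_mul (g : G) (h : H) (p : X) : mk α (g * α h) p = mk α g (h • p) :=
  mk_eq_iff.2 ⟨h⁻¹, by simp, by simp⟩

theorem exists_rep (q : Induced α X) : ∃ g p, mk α g p = q := by
  induction q using Quotient.inductionOn with
  | h a => exact ⟨a.1, a.2, rfl⟩

/-- Descend a function on `G × X` to `α_*X`. -/
def lift {Y : Sort*} (f : G → X → Y) (hf : ∀ g h p, f (g * α h) p = f g (h • p)) :
    Induced α X → Y :=
  Quotient.lift (fun a => f a.1 a.2) (by
    rintro a b ⟨h, rfl⟩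
    simp [hf])

@[simp] theorem lift_mk {Y : Sort*} (f : G → X → Y) (hf) (g : G) (p : X) :
    lift (α := α) f hf (mk α g p) = f g p := rfl

instance : MulAction G (Induced α X) where
  smul k := lift (fun g p => mk α (k * g) p) fun g h p => by rw [← mul_assoc, mk_mul]
  one_smul q := by
    obtain ⟨g, p, rfl⟩ := exists_rep q
    exact congrArg (fun k => mk α k p) (one_mul g)
  mul_smul k l q := by
    obtain ⟨g, p, rfl⟩ := exists_rep q
    exact congrArg (fun k => mk α k p) (mul_assoc k l g)

@[simp] theorem smul_mk (k g : G) (p : X) : k • mk α g p = mk α (k * g) p := rfl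

/-- `α_*X` carries the quotient topology of `G × X` with `G` discrete. -/
instance [TopologicalSpace X] : TopologicalSpace (Induced α X) :=
  letI : TopologicalSpace G := ⊥
  inferInstanceAs (TopologicalSpace (Quotient (inducedSetoid α X)))

theorem continuous_lift [TopologicalSpace X] {Y : Type*} [TopologicalSpace Y] {f : G → X → Y} {hf}
    (hc : ∀ g, Continuous (f g)) : Continuous (lift (α := α) f hf) := by
  let : TopologicalSpace G := ⊥
  have : DiscreteTopology G := ⟨rfl⟩
  exact Continuous.quotient_lift (continuous_prod_of_discrete_left.2 hc) _

theorem continuous_mk [TopologicalSpace X] (g : G) : Continuous (fun p : X => mk α g p) := by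
  let : TopologicalSpace G := ⊥
  exact continuous_quotient_mk'.comp (Continuous.prodMk_right g)

theorem isClosed_iff [TopologicalSpace X] {C : Set (Induced α X)} :
    IsClosed C ↔ ∀ g, IsClosed {p : X | mk α g p ∈ C} := by
  refine ⟨fun h g => h.preimage (continuous_mk g), fun h => ?_⟩
  let : TopologicalSpace G := ⊥
  have : DiscreteTopology G := ⟨rfl⟩
  rw [← isOpen_compl_iff]
  refine isOpen_coinduced.2 ?_
  refine isOpen_prod_iff.2 fun g p hp => ?_
  refine ⟨{g}, {p | mk α g p ∈ C}ᶜ, isOpen_discrete _, (h g).isOpen_compl, rfl, hp, ?_⟩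
  rintro ⟨g', p'⟩ ⟨hg, hp'⟩
  obtain rfl : g' = g := hg
  exact hp'

instance [TopologicalSpace X] : ContinuousConstSMul G (Induced α X) :=
  ⟨fun k => continuous_lift (f := fun g p => mk α (k * g) p) fun g => continuous_mk (k * g)⟩

/-- The subset `α_*A` of `α_*X`. -/
def sub (α : H →* G) {X : Type u} [MulAction H X] (A : Set X) (hA : ∀ (h : H), ∀ p ∈ A, h • p ∈ A) :
    Set (Induced α X) :=
  {q | lift (α := α) (fun _ p => p ∈ A) (fun _ h p => propext
    ⟨hA h p, fun hp => by simpa using hA h⁻¹ _ hp⟩) q}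

@[simp] theorem mk_mem_sub {A : Set X} {hA} {g : G} {p : X} : mk α g p ∈ sub α A hA ↔ p ∈ A :=
  Iff.rfl

/-- The map `α_*f` induced by an equivariant map `f`. -/
def map (α : H →* G) {X Y : Type u} [MulAction H X] [MulAction H Y] (f : X → Y)
    (hf : ∀ (h : H) p, f (h • p) = h • f p) : Induced α X → Induced α Y :=
  lift (fun g p => mk α g (f p)) (fun g h p => by rw [mk_mul, hf])

@[simp] theorem map_mk {X Y : Type u} [MulAction H X] [MulAction H Y] (f : X → Y) (hf)
    (g : G) (p : X) : map α f hf (mk α g p) = mk α g (f p) := rfl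

end Induced

/-- The `G`-CW-structure on `α_*X`: its skeleta are the `α_*(X_n)`, its `G`-sets of cells are induced
from those of `X`. -/
def GCWStructure.ind {X : Type u} [TopologicalSpace X] [MulAction H X] (S : GCWStructure H X)
    (α : H →* G) : GCWStructure G (Induced α X) where
  skel n := Induced.sub α (S.skel n) (S.smul_mem_skel n)
  skel_zero := by
    ext q
    obtain ⟨g, p, rfl⟩ := Induced.exists_rep q
    simp [S.skel_zero]
  skel_mono m n h q hq := by
    obtain ⟨g, p, rfl⟩ := Induced.exists_rep q
    exact S.skel_mono h hq
  exists_mem_skel q := by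
    obtain ⟨g, p, rfl⟩ := Induced.exists_rep q
    exact S.exists_mem_skel p
  smul_mem_skel n k q hq := by
    obtain ⟨g, p, rfl⟩ := Induced.exists_rep q
    exact hq
  isClosed_skel n := Induced.isClosed_iff.2 fun _ => S.isClosed_skel n
  isClosed_of_skel C hC := Induced.isClosed_iff.2 fun g =>
    S.isClosed_of_skel _ fun n => Induced.isClosed_iff.1 (hC n) g
  cell n := Induced α (S.cell n)
  cellAction n := inferInstance
  charMap n e p := Induced.map α (fun e => S.charMap n e p) (fun h e => S.charMap_smul n h e p) e
  continuous_charMap n e := by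
    obtain ⟨g, e, rfl⟩ := Induced.exists_rep e
    exact (Induced.continuous_mk g).comp (S.continuous_charMap n e)
  charMap_smul n k e p := by
    obtain ⟨g, e, rfl⟩ := Induced.exists_rep e
    rfl
  charMap_mem n e p := by
    obtain ⟨g, e, rfl⟩ := Induced.exists_rep e
    exact S.charMap_mem n e p
  charMap_boundary n e p hp := by
    obtain ⟨g, e, rfl⟩ := Induced.exists_rep e
    exact S.charMap_boundary n e p hp
  charMap_interior n e p hp := by
    obtain ⟨g, e, rfl⟩ := Induced.exists_rep e
    exact S.charMap_interior n e p hp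
  charMap_injective n e e' p p' hp hp' h := by
    obtain ⟨g, e, rfl⟩ := Induced.exists_rep e
    obtain ⟨g', e', rfl⟩ := Induced.exists_rep e'
    obtain ⟨k, hk, hk'⟩ := Induced.mk_eq_iff.1 h
    rw [← S.charMap_smul] at hk'
    obtain ⟨h₁, h₂⟩ := S.charMap_injective n _ _ p' p hp' hp hk'
    exact ⟨Induced.mk_eq_iff.2 ⟨k, hk, h₁⟩, h₂.symm⟩
  exists_charMap n q hq hq' := by
    obtain ⟨g, y, rfl⟩ := Induced.exists_rep q
    obtain ⟨e, p, hp, h⟩ := S.exists_charMap n y hq hq'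
    exact ⟨Induced.mk α g e, p, hp, congrArg (Induced.mk α g) h⟩
  isClosed_of_charMap n C hC h₁ h₂ := Induced.isClosed_iff.2 fun g =>
    S.isClosed_of_charMap n _ (fun p hp => hC hp) (Induced.isClosed_iff.1 h₁ g)
      fun e => h₂ (Induced.mk α g e)

/-- The induction `α_*X` of an `H`-CW-complex. -/
def GCWComplex.ind (α : H →* G) (X : GCWComplex H) : GCWComplex G where
  carrier := Induced α X.carrier
  cw := X.cw.ind α

/-- The induction `α_*(X, A)` of an `H`-CW-pair. -/
def GCWPair.ind (α : H →* G) (P : GCWPair H) : GCWPair G where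
  space := P.space.ind α
  sub :=
    { carrier := Induced.sub α (P.sub : Set P.space.carrier) (fun h _ hp => P.sub.smul_mem h hp)
      smul_mem' := fun k q hq => by
        obtain ⟨g, p, rfl⟩ := Induced.exists_rep q
        exact hq }
  isSubcomplex :=
    { isClosed := Induced.isClosed_iff.2 fun _ => P.isSubcomplex.isClosed
      charMap_mem := fun n e p q hp h => by
        obtain ⟨g, e, rfl⟩ := Induced.exists_rep (X := P.space.cw.cell n) e
        exact P.isSubcomplex.charMap_mem n e p q hp h }

namespace GCWPair

/-- Induction along `α` as a functor from `H`-CW-pairs to `G`-CW-pairs. -/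
def indFunctor (α : H →* G) : GCWPair.{u} H ⥤ GCWPair.{u} G where
  obj P := P.ind α
  map {P Q} f := Hom.mk (P := P.ind α) (Q := Q.ind α) (Induced.map α f.toFun f.map_smul)
    (Induced.continuous_lift fun g => (Induced.continuous_mk g).comp f.continuous_toFun)
    (fun k q => by
      obtain ⟨g, p, rfl⟩ := Induced.exists_rep q
      rfl)
    (fun q hq => by
      obtain ⟨g, p, rfl⟩ := Induced.exists_rep q
      exact f.map_sub p hq)
  map_id P := hom_ext _ _ fun q => by
    obtain ⟨g, p, rfl⟩ := Induced.exists_rep q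
    rfl
  map_comp f f' := hom_ext _ _ fun q => by
    obtain ⟨g, p, rfl⟩ := Induced.exists_rep q
    rfl

/-- The canonical map from `α_*A` to the subspace `α_*A` of `α_*X`, for a pair `(X, A)`. -/
def indSub (α : H →* G) (P : GCWPair H) :
    (indFunctor α).obj ((subFunctor H).obj P) ⟶ (subFunctor G).obj ((indFunctor α).obj P) :=
  Hom.mk (P := P.subComplex.toPair.ind α) (Q := (P.ind α).subComplex.toPair)
    (Induced.lift (fun g p => ⟨Induced.mk α g p.1, p.2⟩)
      (fun g h p => Subtype.ext (Induced.mk_mul g h p.1)))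
    (Induced.continuous_lift fun g =>
      ((Induced.continuous_mk g).comp continuous_subtype_val).subtype_mk _)
    (fun k q => by
      obtain ⟨g, p, rfl⟩ := Induced.exists_rep q
      rfl)
    (fun q hq => by
      obtain ⟨g, p, rfl⟩ := Induced.exists_rep q
      exact hq)

/-- The natural homeomorphism `f₁ : β_*α_*(X, A) → (β ∘ α)_*(X, A)`, `(k, g, p) ↦ (k β(g), p)`. -/
def indComp {K : Type u} [Group K] (α : H →* G) (β : G →* K) (P : GCWPair H) :
    (indFunctor β).obj ((indFunctor α).obj P) ⟶ (indFunctor (β.comp α)).obj P :=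
  Hom.mk (P := (P.ind α).ind β) (Q := P.ind (β.comp α))
    (Induced.lift
      (fun k => Induced.lift (fun g p => Induced.mk (β.comp α) (k * β g) p) (fun g h p => by
        rw [map_mul, ← mul_assoc, ← Induced.mk_mul]; rfl))
      (fun k g q => by
        obtain ⟨g', p, rfl⟩ := Induced.exists_rep q
        refine congrArg (fun k => Induced.mk (β.comp α) k p) ?_
        rw [map_mul, mul_assoc]))
    (Induced.continuous_lift fun k => Induced.continuous_lift fun g => Induced.continuous_mk _)
    (fun l q => by
      obtain ⟨k, q, rfl⟩ := Induced.exists_rep q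
      obtain ⟨g, p, rfl⟩ := Induced.exists_rep q
      exact congrArg (fun k => Induced.mk (β.comp α) k p) (mul_assoc l k (β g)))
    (fun q hq => by
      obtain ⟨k, q, rfl⟩ := Induced.exists_rep q
      obtain ⟨g, p, rfl⟩ := Induced.exists_rep q
      exact hq)

/-- The homeomorphism `f₂ : (X, A) → c(g)_*(X, A)`, `p ↦ (1, g⁻¹ p)`, for the conjugation
`c(g) : k ↦ g k g⁻¹`. -/
def indConj (g : G) (P : GCWPair G) : P ⟶ (indFunctor (MulAut.conj g).toMonoidHom).obj P :=
  Hom.mk (Q := P.ind (MulAut.conj g).toMonoidHom)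
    (fun p => Induced.mk (MulAut.conj g).toMonoidHom 1 (g⁻¹ • p))
    ((Induced.continuous_mk 1).comp (continuous_const_smul g⁻¹))
    (fun k p => by
      refine Induced.mk_eq_iff.2 ⟨g⁻¹ * k * g, ?_, ?_⟩
      · simp [mul_assoc]
      · simp [mul_smul])
    (fun p hp => P.sub.smul_mem g⁻¹ hp)

/-- The natural map `f(X, α) : α_*α^*(X, A) → (X, A)`, `(g, p) ↦ g p`. -/
def counit (α : H →* G) (P : GCWPair G) : (indFunctor α).obj (P.res α) ⟶ P :=
  Hom.mk (P := (P.res α).ind α)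
    (Induced.lift (X := (P.res α).space.carrier) (fun g p => (g • (show P.space.carrier from p)))
      (fun g h p => mul_smul g (α h) (show P.space.carrier from p)))
    (Induced.continuous_lift fun g => (continuous_const_smul g : Continuous fun p : P.space.carrier => g • p))
    (fun k q => by
      obtain ⟨g, p, rfl⟩ := Induced.exists_rep q
      exact mul_smul k g (show P.space.carrier from p))
    (fun q hq => by
      obtain ⟨g, p, rfl⟩ := Induced.exists_rep q
      exact P.sub.smul_mem g hq)

end GCWPair

end Induction

/-! ### Equivariant homology theories over a group -/

theorem comp_conj_of_map_eq_one {Γ : Type v} [Group Γ] {G : Type u} [Group G] {ξ : G →* Γ} {g : G}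
    (hg : ξ g = 1) : ξ.comp (MulAut.conj g).toMonoidHom = ξ := by
  ext k
  simp [hg]

/-- An equivariant homology theory over the group `Γ` with values in `Λ`-modules: a `G`-homology
theory for every group `(G, ξ)` over `Γ`, together with an induction structure. A morphism
`(H, ξ) → (G, μ)` of groups over `Γ` is a homomorphism `α : H → G` with `μ ∘ α = ξ`. -/
structure EquivariantHomologyTheory (Γ : Type v) [Group Γ] (Λ : Type w) [Ring Λ] where
  theory : ∀ (G : Type u) [Group G], (G →* Γ) → GHomologyTheory.{u, w, x} G Λ
  /-- the natural induction homomorphisms -/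
  ind : ∀ {H G : Type u} [Group H] [Group G] (ξ : H →* Γ) (μ : G →* Γ) (α : H →* G),
    μ.comp α = ξ → ∀ n : ℤ, (theory H ξ).H n ⟶ GCWPair.indFunctor α ⋙ (theory G μ).H n
  /-- compatibility with the boundary homomorphisms -/
  ind_bdry : ∀ {H G : Type u} [Group H] [Group G] (ξ : H →* Γ) (μ : G →* Γ) (α : H →* G)
    (hα : μ.comp α = ξ) (n : ℤ) (P : GCWPair H),
    (ind ξ μ α hα (n + 1)).app P ≫ ((theory G μ).bdry n).app ((GCWPair.indFunctor α).obj P) =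
      ((theory H ξ).bdry n).app P ≫ (ind ξ μ α hα n).app ((GCWPair.subFunctor H).obj P) ≫
        ((theory G μ).H n).map (P.indSub α)
  /-- functoriality -/
  ind_comp : ∀ {H G K : Type u} [Group H] [Group G] [Group K] (ξ : H →* Γ) (μ : G →* Γ)
    (ν : K →* Γ) (α : H →* G) (β : G →* K) (hα : μ.comp α = ξ) (hβ : ν.comp β = μ)
    (hβα : ν.comp (β.comp α) = ξ) (n : ℤ) (P : GCWPair H),
    (ind ξ ν (β.comp α) hβα n).app P =
      (ind ξ μ α hα n).app P ≫ (ind μ ν β hβ n).app ((GCWPair.indFunctor α).obj P) ≫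
        ((theory K ν).H n).map (GCWPair.indComp α β P)
  /-- compatibility with conjugation -/
  ind_conj : ∀ {G : Type u} [Group G] (ξ : G →* Γ) (g : G) (hg : ξ g = 1) (n : ℤ)
    (P : GCWPair G),
    (ind ξ ξ (MulAut.conj g).toMonoidHom (comp_conj_of_map_eq_one hg) n).app P =
      ((theory G ξ).H n).map (GCWPair.indConj g P)
  /-- bijectivity -/
  ind_bijective : ∀ {H G : Type u} [Group H] [Group G] (ξ : H →* Γ) (μ : G →* Γ) (α : H →* G)
    (hα : μ.comp α = ξ), Function.Injective α → ∀ n : ℤ,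
    Function.Bijective ((ind ξ μ α hα n).app (GCWComplex.point H).toPair).hom

/-! ### Directed colimits of groups and strong continuity -/

/-- A presentation of the group `G` as the colimit of a directed system of groups indexed by the
directed set `I`, with transition maps `φ i j` and structure maps `ψ i`. -/
structure DirectedColimit (I : Type u) [Preorder I] (G : Type u) [Group G] where
  obj : I → Type u
  [group : ∀ i, Group (obj i)]
  φ : ∀ i j, i ≤ j → obj i →* obj j
  φ_self : ∀ i, φ i i le_rfl = MonoidHom.id (obj i)
  φ_comp : ∀ i j k (hij : i ≤ j) (hjk : j ≤ k), (φ j k hjk).comp (φ i j hij) = φ i k (hij.trans hjk)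
  ψ : ∀ i, obj i →* G
  ψ_comp : ∀ i j (hij : i ≤ j), (ψ j).comp (φ i j hij) = ψ i
  /-- the universal property -/
  existsUnique_hom : ∀ (L : Type u) [Group L] (f : ∀ i, obj i →* L),
    (∀ i j (hij : i ≤ j), (f j).comp (φ i j hij) = f i) →
      ∃! F : G →* L, ∀ i, F.comp (ψ i) = f i

attribute [instance] DirectedColimit.group

namespace EquivariantHomologyTheory

variable {Γ : Type v} [Group Γ] {Λ : Type w} [Ring Λ]
  (𝓗 : EquivariantHomologyTheory.{u, v, w, x} Γ Λ)

/-- The map `a_n(X, α) : H_n^H(α^*(X, A)) → H_n^G(X, A)`, for a morphism `α : (H, ξ) → (G, μ)` of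
groups over `Γ`. -/
def a {H G : Type u} [Group H] [Group G] (ξ : H →* Γ) (μ : G →* Γ) (α : H →* G)
    (hα : μ.comp α = ξ) (n : ℤ) (P : GCWPair G) :
    ((𝓗.theory H ξ).H n).obj (P.res α) ⟶ ((𝓗.theory G μ).H n).obj P :=
  (𝓗.ind ξ μ α hα n).app (P.res α) ≫ ((𝓗.theory G μ).H n).map (P.counit α)

theorem a_comp {H G K : Type u} [Group H] [Group G] [Group K] (ξ : H →* Γ) (μ : G →* Γ)
    (ν : K →* Γ) (α : H →* G) (β : G →* K) (γ : H →* K) (h : β.comp α = γ) (hα : μ.comp α = ξ)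
    (hβ : ν.comp β = μ) (hγ : ν.comp γ = ξ) (n : ℤ) (P : GCWPair K) :
    ((𝓗.theory H ξ).H n).map (P.resIdent α β γ h) ≫ 𝓗.a ξ μ α hα n (P.res β) ≫
      𝓗.a μ ν β hβ n P = 𝓗.a ξ ν γ hγ n P := by
  subst h
  let R := P.res (β.comp α)
  let r : R ⟶ (P.res β).res α := P.resIdent α β (β.comp α) rfl
  have e : (GCWPair.indFunctor β).map ((GCWPair.indFunctor α).map r) ≫
      (GCWPair.indFunctor β).map ((P.res β).counit α) ≫ P.counit β =
      GCWPair.indComp α β R ≫ P.counit (β.comp α) := by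
    refine GCWPair.hom_ext _ _ fun q => ?_
    obtain ⟨k, q, rfl⟩ := Induced.exists_rep q
    obtain ⟨g, p, rfl⟩ := Induced.exists_rep q
    exact (mul_smul k (β g) (show P.space.carrier from p)).symm
  have he := congrArg ((𝓗.theory K ν).H n).map e
  simp only [Functor.map_comp] at he
  have nα := fun {Z} (z : _ ⟶ Z) => (𝓗.ind ξ μ α hα n).naturality_assoc r z
  have nβ := fun {P Q : GCWPair G} (f : P ⟶ Q) {Z} (z : _ ⟶ Z) =>
    (𝓗.ind μ ν β hβ n).naturality_assoc f z
  simp only [Functor.comp_map] at nα nβ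
  change ((𝓗.theory H ξ).H n).map r ≫ _ = _
  simp only [a, Category.assoc]
  rw [nα, nβ, nβ, he, 𝓗.ind_comp ξ μ ν α β hα hβ hγ n R]
  simp only [Category.assoc]

/-- The directed system `H_n^{G_i}(ψ_i^*(X, A))` of `Λ`-modules, with structure maps
`a_n(ψ_j^*(X, A), φ_{ij})`: here its transition maps. -/
def systemMap {G : Type u} [Group G] (ξ : G →* Γ) {I : Type u} [Preorder I]
    (D : DirectedColimit I G) (n : ℤ) (P : GCWPair G) (i j : I) (hij : i ≤ j) :
    ((𝓗.theory (D.obj i) (ξ.comp (D.ψ i))).H n).obj (P.res (D.ψ i)) ⟶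
      ((𝓗.theory (D.obj j) (ξ.comp (D.ψ j))).H n).obj (P.res (D.ψ j)) :=
  ((𝓗.theory (D.obj i) (ξ.comp (D.ψ i))).H n).map
      (P.resIdent (D.φ i j hij) (D.ψ j) (D.ψ i) (D.ψ_comp i j hij)) ≫
    𝓗.a (ξ.comp (D.ψ i)) (ξ.comp (D.ψ j)) (D.φ i j hij)
      (by rw [MonoidHom.comp_assoc, D.ψ_comp]) n (P.res (D.ψ j))

/-- The map `t_n^G(X, A) : colim_i H_n^{G_i}(ψ_i^*(X, A)) → H_n^G(X, A)`. -/
noncomputable def t {G : Type u} [Group G] (ξ : G →* Γ) {I : Type u} [Preorder I] [DecidableEq I]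
    (D : DirectedColimit I G) (n : ℤ) (P : GCWPair G) :
    Module.DirectLimit
      (fun i => ((𝓗.theory (D.obj i) (ξ.comp (D.ψ i))).H n).obj (P.res (D.ψ i)))
      (fun i j hij => (𝓗.systemMap ξ D n P i j hij).hom) →ₗ[Λ]
        ((𝓗.theory G ξ).H n).obj P :=
  Module.DirectLimit.lift Λ I _ _
    (fun i => (𝓗.a (ξ.comp (D.ψ i)) ξ (D.ψ i) rfl n P).hom)
    (fun i j hij y => by
      have h := 𝓗.a_comp (ξ.comp (D.ψ i)) (ξ.comp (D.ψ j)) ξ (D.φ i j hij) (D.ψ j) (D.ψ i)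
        (D.ψ_comp i j hij) (by rw [MonoidHom.comp_assoc, D.ψ_comp]) rfl rfl n P
      rw [← Category.assoc] at h
      exact congrArg (fun f => f.hom y) h)

open Classical in
/-- `𝓗` is strongly continuous: `t_n^G({∙})` is an isomorphism for every group `(G, ξ)` over `Γ`
and every directed system of groups with colimit `G`. -/
def StronglyContinuous : Prop :=
  ∀ (G : Type u) [Group G] (ξ : G →* Γ) (I : Type u) [Preorder I] [IsDirectedOrder I] [Nonempty I]
    (D : DirectedColimit I G) (n : ℤ),
    Function.Bijective (𝓗.t ξ D n (GCWComplex.point G).toPair)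

end EquivariantHomologyTheory

/-! ### Families of subgroups and the isomorphism conjectures -/

/-- A family of subgroups of `G`, closed under conjugation and under taking subgroups. -/
structure SubgroupFamily (G : Type u) [Group G] where
  carrier : Set (Subgroup G)
  conj_mem : ∀ U ∈ carrier, ∀ g : G, U.map (MulAut.conj g).toMonoidHom ∈ carrier
  mem_of_le : ∀ U ∈ carrier, ∀ V ≤ U, V ∈ carrier

/-- The family `φ^*F = {U ≤ K | φ(U) ∈ F}`. -/
def SubgroupFamily.comap {K G : Type u} [Group K] [Group G] (φ : K →* G) (F : SubgroupFamily G) :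
    SubgroupFamily K where
  carrier := {U | U.map φ ∈ F.carrier}
  conj_mem U hU k := by
    have h : (U.map (MulAut.conj k).toMonoidHom).map φ =
        (U.map φ).map (MulAut.conj (φ k)).toMonoidHom := by
      rw [Subgroup.map_map, Subgroup.map_map]
      congr 1
      ext y
      simp
    change _ ∈ F.carrier
    rw [h]
    exact F.conj_mem _ hU (φ k)
  mem_of_le U hU V hV := F.mem_of_le _ hU _ (Subgroup.map_mono hV)

/-- The `G`-CW-complex `E` is a model for the classifying space `E_F(G)`: the fixed point set `E^U`
is contractible for `U ∈ F` and empty for `U ∉ F`. -/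
structure IsClassifyingSpace {G : Type u} [Group G] (F : SubgroupFamily G) (E : GCWComplex G) :
    Prop where
  contractible : ∀ U ∈ F.carrier, ContractibleSpace (MulAction.fixedPoints U E.carrier)
  empty : ∀ U : Subgroup G, U ∉ F.carrier → MulAction.fixedPoints U E.carrier = ∅

namespace EquivariantHomologyTheory

variable {Γ : Type v} [Group Γ] {Λ : Type w} [Ring Λ]
  (𝓗 : EquivariantHomologyTheory.{u, v, w, x} Γ Λ)

/-- `(G, ξ)` satisfies the Isomorphism Conjecture for `F`: the projection `E_F(G) → {∙}` induces
isomorphisms in homology. The space `E_F(G)` is only defined up to `G`-homotopy equivalence, so the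
condition is imposed for each of its models. -/
def IsomorphismConjecture {G : Type u} [Group G] (ξ : G →* Γ) (F : SubgroupFamily G) : Prop :=
  ∀ E : GCWComplex G, IsClassifyingSpace F E → ∀ n : ℤ,
    Function.Bijective (((𝓗.theory G ξ).H n).map E.toPoint).hom

/-- `(G, ξ)` satisfies the Fibered Isomorphism Conjecture for `F`. -/
def FiberedIsomorphismConjecture {G : Type u} [Group G] (ξ : G →* Γ) (F : SubgroupFamily G) :
    Prop :=
  ∀ (K : Type u) [Group K] (φ : K →* G), 𝓗.IsomorphismConjecture (ξ.comp φ) (F.comap φ)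

end EquivariantHomologyTheory

/-!
The maps `t_n^K(X, A)` form a transformation of `K`-homology theories from
`colim_i H_n^{K_i}(ψ_i^*(X, A))` to `H_n^K(X, A)`, for every directed system with colimit `K`
(`EquivariantHomologyTheory.colimTheory`, `EquivariantHomologyTheory.tTrans`). The proof shows that
this transformation is an isomorphism on the one-point space and on every classifying space `E` of a
family of subgroups of `K`. For a homomorphism `φ : K → G`, the directed system for `G` is pulled
back to a directed system of groups `K_i = K ×_G G_i` with colimit `K`. The restriction of
`E = E_{φ^*F}(K)` to `K_i` is a classifying space for the pullback of `ψ_i^*F` along `K_i → G_i`, so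
that the hypothesis for `G_i` makes `H^{K_i}(E) → H^{K_i}({∙})` bijective. These maps have as colimit
the source of a naturality square of `t`, whose target is `H^K(E) → H^K({∙})`.

For orbits `K/H`, strong continuity is applied to `H` and the directed system pulled back along
`H → K` (`StronglyContinuous.t_transitive_bijective`); the point to be proved is that classes on
`ψ_i^*(K/H)` are, at a later stage, supported on the orbit of the base point. By the disjoint union
axiom, `t` is then an isomorphism on all discrete `K`-sets.

To reach `E`, no induction over the skeleta of `E` is needed. By the five lemma and excision, the
class of complexes on which a transformation of homology theories is an isomorphism is closed under
homotopy coequalizers of pairs of cellular maps (`Trans.IsIso.hocoeq`), and under complexes dominated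
by one of its members (`Trans.IsIso.of_domination`). Starting with the discrete set `S = ∐ K/U`, for
`U` in the family, the iterated joins `S * ⋯ * S` and their telescope are such homotopy coequalizers.
The isotropy groups of the telescope lie in the family. Its fixed point sets for subgroups in the
family are contractible, since each iterated join is coned off in the next one
(`Telescope.contractibleSpace_fixedPoints`). Extending equivariant maps cell by cell
(`GCWStructure.exists_extension`) yields maps between `E` and the telescope and a homotopy from the
composition `E → E` to the identity, so that `E` is dominated by the telescope.
-/

universe y

/-! ### Directed colimits of groups -/

namespace DirectedColimit

variable {I : Type u} [Preorder I] {G : Type u} [Group G]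

theorem φ_apply_apply (D : DirectedColimit I G) {i j k : I} (hij : i ≤ j) (hjk : j ≤ k)
    (x : D.obj i) : D.φ j k hjk (D.φ i j hij x) = D.φ i k (hij.trans hjk) x :=
  DFunLike.congr_fun (D.φ_comp i j k hij hjk) x

theorem ψ_φ (D : DirectedColimit I G) {i j : I} (hij : i ≤ j) (x : D.obj i) :
    D.ψ j (D.φ i j hij x) = D.ψ i x :=
  DFunLike.congr_fun (D.ψ_comp i j hij) x

theorem directedSystem (D : DirectedColimit I G) :
    DirectedSystem D.obj fun i j hij => D.φ i j hij where
  map_self i x := DFunLike.congr_fun (D.φ_self i) x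
  map_map _ _ _ hij hjk x := D.φ_apply_apply hij hjk x

variable [IsDirectedOrder I] [Nonempty I]

/-- The structure maps of a directed colimit are jointly surjective: the union of their images is
a subgroup through which the identity of `G` factors by the universal property. -/
theorem exists_ψ_eq (D : DirectedColimit I G) (g : G) : ∃ i, ∃ x : D.obj i, D.ψ i x = g := by
  let R : Subgroup G :=
    { carrier := {g | ∃ i, ∃ x : D.obj i, D.ψ i x = g}
      one_mem' := ⟨Classical.arbitrary I, 1, map_one _⟩
      mul_mem' := by
        rintro _ _ ⟨i, x, rfl⟩ ⟨j, y, rfl⟩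
        obtain ⟨k, hik, hjk⟩ := exists_ge_ge i j
        exact ⟨k, D.φ i k hik x * D.φ j k hjk y, by rw [map_mul, D.ψ_φ, D.ψ_φ]⟩
      inv_mem' := by
        rintro _ ⟨i, x, rfl⟩
        exact ⟨i, x⁻¹, map_inv _ _⟩ }
  obtain ⟨F, hF, -⟩ := D.existsUnique_hom R
    (fun i => (D.ψ i).codRestrict R fun x => ⟨i, x, rfl⟩)
    (fun i j hij => MonoidHom.ext fun x => Subtype.ext (D.ψ_φ hij x))
  obtain ⟨F', -, hF'⟩ := D.existsUnique_hom G D.ψ D.ψ_comp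
  have h : R.subtype.comp F = MonoidHom.id G := by
    rw [hF' (R.subtype.comp F) fun i => ?_, hF' (MonoidHom.id G) fun i => rfl]
    rw [MonoidHom.comp_assoc, hF]
    rfl
  have := DFunLike.congr_fun h g
  exact (show (F g : G) = g from this) ▸ (F g).2

/-- An element of a group of the system that dies in the colimit dies at a later stage: compare
with the explicit construction of the colimit. -/
theorem exists_φ_eq_one (D : DirectedColimit I G) {i : I} {x : D.obj i} (hx : D.ψ i x = 1) :
    ∃ j, ∃ hij : i ≤ j, D.φ i j hij x = 1 := by
  have := D.directedSystem
  let L := DirectLimit D.obj (fun i j hij => D.φ i j hij)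
  let f (i : I) : D.obj i →* L :=
    { toFun := fun y => ⟦⟨i, y⟩⟧
      map_one' := (DirectLimit.one_def _).symm
      map_mul' := fun y z => (DirectLimit.mul_def i y z).symm }
  obtain ⟨F, hF, -⟩ := D.existsUnique_hom L f fun i j hij => MonoidHom.ext fun y =>
    (DirectLimit.eq_of_le (f := fun i j hij => D.φ i j hij) ⟨i, y⟩ j hij).symm
  have h : f i x = 1 := by rw [← hF i, MonoidHom.comp_apply, hx, map_one]
  obtain ⟨j, hij, h⟩ :=
    (DirectLimit.exists_eq_one (f := fun i j hij => D.φ i j hij) ⟨i, x⟩).1 h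
  exact ⟨j, hij, h⟩

/-- Joint surjectivity of the structure maps, and the fact that every element dying in the colimit
dies at a finite stage, characterize directed colimits of groups. -/
def ofExists (obj : I → Type u) [∀ i, Group (obj i)] (φ : ∀ i j, i ≤ j → obj i →* obj j)
    (φ_self : ∀ i, φ i i le_rfl = MonoidHom.id (obj i))
    (φ_comp : ∀ i j k (hij : i ≤ j) (hjk : j ≤ k),
      (φ j k hjk).comp (φ i j hij) = φ i k (hij.trans hjk))
    (ψ : ∀ i, obj i →* G) (ψ_comp : ∀ i j (hij : i ≤ j), (ψ j).comp (φ i j hij) = ψ i)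
    (surj : ∀ g, ∃ i, ∃ x : obj i, ψ i x = g)
    (inj : ∀ i (x : obj i), ψ i x = 1 → ∃ j, ∃ hij : i ≤ j, φ i j hij x = 1) :
    DirectedColimit I G where
  obj := obj
  φ := φ
  φ_self := φ_self
  φ_comp := φ_comp
  ψ := ψ
  ψ_comp := ψ_comp
  existsUnique_hom L _ f hf := by
    have hf' (i j) (hij : i ≤ j) (x) : f j (φ i j hij x) = f i x :=
      DFunLike.congr_fun (hf i j hij) x
    have hψ' (i j) (hij : i ≤ j) (x) : ψ j (φ i j hij x) = ψ i x :=
      DFunLike.congr_fun (ψ_comp i j hij) x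
    have key (i j) (x : obj i) (y : obj j) (h : ψ i x = ψ j y) : f i x = f j y := by
      obtain ⟨k, hik, hjk⟩ := exists_ge_ge i j
      obtain ⟨l, hkl, hl⟩ := inj k (φ i k hik x * (φ j k hjk y)⁻¹) (by
        rw [map_mul, map_inv, hψ', hψ', h, mul_inv_cancel])
      rw [← hf' i k hik, ← hf' j k hjk, ← mul_inv_eq_one, ← map_inv, ← map_mul, ← hf' k l hkl, hl,
        map_one]
    choose ix x hx using surj
    have hF (i) (y : obj i) : f (ix (ψ i y)) (x (ψ i y)) = f i y := key _ _ _ _ (hx _)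
    refine ⟨⟨⟨fun g => f (ix g) (x g), ?_⟩, ?_⟩, fun i => MonoidHom.ext fun y => hF i y, ?_⟩
    · rw [← map_one (f (Classical.arbitrary I))]
      exact key _ _ _ _ (by rw [hx, map_one])
    · intro g h
      obtain ⟨k, hgk, hhk⟩ := exists_ge_ge (ix g) (ix h)
      change f _ _ = f _ _ * f _ _
      rw [← hf' _ k hgk (x g), ← hf' _ k hhk (x h), ← map_mul]
      exact key _ _ _ _ (by rw [hx, map_mul, hψ', hψ', hx, hx])
    · intro F hF'
      ext g
      change F g = f (ix g) (x g)
      rw [← hF' (ix g), MonoidHom.comp_apply, hx]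

/-- The pullback of a directed system of groups with colimit `G` along a homomorphism `φ : K → G`:
the groups `K ×_G G_i` form a directed system with colimit `K`. -/
def pullback {K : Type u} [Group K] (D : DirectedColimit I G) (φ : K →* G) : DirectedColimit I K :=
  ofExists
    (fun i => (φ.comp (MonoidHom.fst K (D.obj i))).eqLocus ((D.ψ i).comp (MonoidHom.snd K (D.obj i))))
    (fun i j hij =>
      (((MonoidHom.id K).prodMap (D.φ i j hij)).comp (Subgroup.subtype _)).codRestrict _
        fun x => x.2.trans (D.ψ_φ hij _).symm)
    (fun i => MonoidHom.ext fun x => Subtype.ext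
      (Prod.ext rfl (DFunLike.congr_fun (D.φ_self i) x.1.2)))
    (fun i j k hij hjk => MonoidHom.ext fun x => Subtype.ext
      (Prod.ext rfl (D.φ_apply_apply hij hjk x.1.2)))
    (fun i => (MonoidHom.fst K (D.obj i)).comp (Subgroup.subtype _))
    (fun i j hij => rfl)
    (fun k => by
      obtain ⟨i, x, hx⟩ := D.exists_ψ_eq (φ k)
      exact ⟨i, ⟨(k, x), hx.symm⟩, rfl⟩)
    (fun i x hx => by
      have h₁ : x.1.1 = 1 := hx
      have h₂ : φ x.1.1 = D.ψ i x.1.2 := x.2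
      obtain ⟨j, hij, h⟩ := D.exists_φ_eq_one (x := x.1.2) (by rw [← h₂, h₁, map_one])
      exact ⟨j, hij, Subtype.ext (Prod.ext h₁ h)⟩)

/-- The projection `K ×_G G_i → G_i`. -/
def pullbackSnd {K : Type u} [Group K] (D : DirectedColimit I G) (φ : K →* G) (i : I) :
    (D.pullback φ).obj i →* D.obj i :=
  (MonoidHom.snd K (D.obj i)).comp (Subgroup.subtype _)

section

variable {K : Type u} [Group K] (D : DirectedColimit I G) (φ : K →* G)

theorem ψ_comp_pullbackSnd (i : I) :
    (D.ψ i).comp (D.pullbackSnd φ i) = φ.comp ((D.pullback φ).ψ i) :=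
  MonoidHom.ext fun x => x.2.symm

theorem pullbackSnd_injective (hφ : Function.Injective φ) (i : I) :
    Function.Injective (D.pullbackSnd φ i) := by
  intro a b (h : a.1.2 = b.1.2)
  refine Subtype.ext (Prod.ext (hφ ?_) h)
  have ha : φ a.1.1 = D.ψ i a.1.2 := a.2
  have hb : φ b.1.1 = D.ψ i b.1.2 := b.2
  rw [ha, hb, h]

theorem range_pullbackSnd (i : I) : (D.pullbackSnd φ i).range = φ.range.comap (D.ψ i) := by
  ext g
  constructor
  · rintro ⟨x, rfl⟩
    exact ⟨x.1.1, x.2⟩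
  · rintro ⟨k, hk⟩
    exact ⟨⟨(k, g), hk⟩, rfl⟩

end

end DirectedColimit

/-! ### Naturality of the comparison maps -/

namespace GCWPair

variable {H G K : Type u} [Group H] [Group G] [Group K]

/-- The restriction of a morphism of `G`-CW-pairs along a homomorphism. -/
def resMap (α : H →* G) {P Q : GCWPair G} (f : P ⟶ Q) : P.res α ⟶ Q.res α :=
  Hom.mk (P := P.res α) (Q := Q.res α) f.toFun f.continuous_toFun
    (fun h p => f.map_smul (α h) p) f.map_sub

theorem Homotopic.res (α : H →* G) {P Q : GCWPair G} {f₀ f₁ : P ⟶ Q} (h : Homotopic f₀ f₁) :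
    Homotopic (resMap α f₀) (resMap α f₁) := by
  obtain ⟨h, hc, h₀, h₁, hs, hA⟩ := h
  exact ⟨h, hc, h₀, h₁, fun t g p => hs t (α g) p, hA⟩

theorem IsCellularPushout.res (α : H →* G) {P Q : GCWPair G} {F : P ⟶ Q}
    (hF : IsCellularPushout F) : IsCellularPushout (resMap α F) :=
  ⟨hF.cellular, hF.bijOn, hF.isClosed_of_preimage⟩

end GCWPair

namespace EquivariantHomologyTheory

variable {Γ : Type v} [Group Γ] {Λ : Type w} [Ring Λ]
  (𝓗 : EquivariantHomologyTheory.{u, v, w, x} Γ Λ)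

section

variable {H G : Type u} [Group H] [Group G] (ξ : H →* Γ) (μ : G →* Γ) (α : H →* G)
  (hα : μ.comp α = ξ) (n : ℤ)

theorem a_naturality {P Q : GCWPair G} (f : P ⟶ Q) :
    ((𝓗.theory H ξ).H n).map (GCWPair.resMap α f) ≫ 𝓗.a ξ μ α hα n Q =
      𝓗.a ξ μ α hα n P ≫ ((𝓗.theory G μ).H n).map f := by
  have h := (𝓗.ind ξ μ α hα n).naturality_assoc (GCWPair.resMap α f)
    (((𝓗.theory G μ).H n).map (Q.counit α))
  have e : (GCWPair.indFunctor α).map (GCWPair.resMap α f) ≫ Q.counit α =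
      P.counit α ≫ f := by
    refine GCWPair.hom_ext _ _ fun q => ?_
    obtain ⟨g, p, rfl⟩ := Induced.exists_rep q
    exact (f.map_smul g p).symm
  rw [a, h, Functor.comp_map, ← Functor.map_comp, e, Functor.map_comp, ← Category.assoc]
  rfl

theorem a_bdry (P : GCWPair G) :
    𝓗.a ξ μ α hα (n + 1) P ≫ ((𝓗.theory G μ).bdry n).app P =
      ((𝓗.theory H ξ).bdry n).app (P.res α) ≫
        𝓗.a ξ μ α hα n ((GCWPair.subFunctor G).obj P) := by
  have e : (P.res α).indSub α ≫ (GCWPair.subFunctor G).map (P.counit α) =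
      ((GCWPair.subFunctor G).obj P).counit α := by
    refine GCWPair.hom_ext _ _ fun q => ?_
    obtain ⟨g, p, rfl⟩ := Induced.exists_rep q
    rfl
  have h := ((𝓗.theory G μ).bdry n).naturality (P.counit α)
  have h' := 𝓗.ind_bdry ξ μ α hα n (P.res α)
  simp only [a, Category.assoc]
  rw [h, ← Category.assoc, h']
  simp only [Category.assoc, Functor.comp_map]
  rw [← Functor.map_comp, e]
  rfl

end

variable {G : Type u} [Group G] (ξ : G →* Γ) {I : Type u} [Preorder I]
    (D : DirectedColimit I G) (n : ℤ)

theorem systemMap_naturality {P Q : GCWPair G} (f : P ⟶ Q) (i j : I) (hij : i ≤ j) :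
    ((𝓗.theory (D.obj i) (ξ.comp (D.ψ i))).H n).map (GCWPair.resMap (D.ψ i) f) ≫
        𝓗.systemMap ξ D n Q i j hij =
      𝓗.systemMap ξ D n P i j hij ≫
        ((𝓗.theory (D.obj j) (ξ.comp (D.ψ j))).H n).map (GCWPair.resMap (D.ψ j) f) := by
  simp only [systemMap, Category.assoc]
  rw [← a_naturality, ← Functor.map_comp_assoc, ← Functor.map_comp_assoc]
  rfl

theorem systemMap_bdry (P : GCWPair G) (i j : I) (hij : i ≤ j) :
    𝓗.systemMap ξ D (n + 1) P i j hij ≫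
        ((𝓗.theory (D.obj j) (ξ.comp (D.ψ j))).bdry n).app (P.res (D.ψ j)) =
      ((𝓗.theory (D.obj i) (ξ.comp (D.ψ i))).bdry n).app (P.res (D.ψ i)) ≫
        𝓗.systemMap ξ D n ((GCWPair.subFunctor G).obj P) i j hij := by
  simp only [systemMap, Category.assoc]
  rw [a_bdry]
  have h := ((𝓗.theory (D.obj i) (ξ.comp (D.ψ i))).bdry n).naturality
    (P.resIdent (D.φ i j hij) (D.ψ j) (D.ψ i) (D.ψ_comp i j hij))
  exact congrArg (· ≫ 𝓗.a (ξ.comp (D.ψ i)) (ξ.comp (D.ψ j)) (D.φ i j hij)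
    (by rw [MonoidHom.comp_assoc, D.ψ_comp]) n ((GCWPair.subFunctor G).obj P |>.res (D.ψ j))) h

end EquivariantHomologyTheory

/-! ### Directed colimits of modules -/

namespace Module.DirectLimit

variable {R : Type*} [Ring R] {ι : Type*} [Preorder ι] [DecidableEq ι] [IsDirectedOrder ι]
  [Nonempty ι]
  {A : ι → Type*} [∀ i, AddCommGroup (A i)] [∀ i, Module R (A i)] {f : ∀ i j, i ≤ j → A i →ₗ[R] A j}
  {B : ι → Type*} [∀ i, AddCommGroup (B i)] [∀ i, Module R (B i)] {g : ∀ i j, i ≤ j → B i →ₗ[R] B j}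
  {C : ι → Type*} [∀ i, AddCommGroup (C i)] [∀ i, Module R (C i)] {h : ∀ i j, i ≤ j → C i →ₗ[R] C j}
  (a : ∀ i, A i →ₗ[R] B i) (ha : ∀ i j hij, a j ∘ₗ f i j hij = g i j hij ∘ₗ a i)
  (b : ∀ i, B i →ₗ[R] C i) (hb : ∀ i j hij, b j ∘ₗ g i j hij = h i j hij ∘ₗ b i)

/-- Directed colimits of modules are exact. -/
theorem map_exact [DirectedSystem C (h · · ·)]
    (hab : ∀ i, Function.Exact (a i) (b i)) :
    Function.Exact (map a ha) (map b hb) := by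
  intro y
  constructor
  · intro hy
    obtain ⟨i, y, rfl⟩ := exists_of y
    rw [map_apply_of] at hy
    obtain ⟨j, hij, hj⟩ := of.zero_exact hy
    have hz : b j (g i j hij y) = 0 := (LinearMap.congr_fun (hb i j hij) y).trans hj
    obtain ⟨z, hz⟩ := (hab j _).1 hz
    exact ⟨of R ι A f j z, by rw [map_apply_of, hz, of_f]⟩
  · rintro ⟨z, rfl⟩
    obtain ⟨i, z, rfl⟩ := exists_of z
    rw [map_apply_of, map_apply_of, (hab i).apply_apply_eq_zero, map_zero]

theorem map_bijective [DirectedSystem B (g · · ·)] (h : ∀ i, Function.Bijective (a i)) :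
    Function.Bijective (map a ha) := by
  constructor
  · rw [injective_iff_map_eq_zero]
    intro y hy
    obtain ⟨i, y, rfl⟩ := exists_of y
    rw [map_apply_of] at hy
    obtain ⟨j, hij, hj⟩ := of.zero_exact hy
    have hz : a j (f i j hij y) = 0 := (LinearMap.congr_fun (ha i j hij) y).trans hj
    rw [← of_f (hij := hij), (h j).1 (hz.trans (map_zero _).symm), map_zero]
  · intro y
    obtain ⟨i, y, rfl⟩ := exists_of y
    obtain ⟨y, rfl⟩ := (h i).2 y
    exact ⟨of R ι A f i y, map_apply_of _ _ _⟩

open DirectSum in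
/-- Directed colimits of modules commute with direct sums. -/
theorem toModule_map_bijective {J : Type*} [DecidableEq J] {A : J → ι → Type*}
    [∀ k i, AddCommGroup (A k i)] [∀ k i, Module R (A k i)]
    {f : ∀ k i j, i ≤ j → A k i →ₗ[R] A k j}
    [DirectedSystem B (g · · ·)] (a : ∀ k i, A k i →ₗ[R] B i)
    (ha : ∀ k i j hij, a k j ∘ₗ f k i j hij = g i j hij ∘ₗ a k i)
    (h : ∀ i, Function.Bijective (DirectSum.toModule R J (B i) fun k => a k i)) :
    Function.Bijective (DirectSum.toModule R J (DirectLimit B g) fun k => map (a k) (ha k)) := by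
  let stage (i : ι) : (⨁ k, A k i) →ₗ[R] ⨁ k, DirectLimit (A k) (f k) :=
    DirectSum.lmap fun k => of R ι (A k) (f k) i
  let trans (i j : ι) (hij : i ≤ j) : (⨁ k, A k i) →ₗ[R] ⨁ k, A k j :=
    DirectSum.lmap fun k => f k i j hij
  have h₁ (i j) (hij : i ≤ j) (y) : stage j (trans i j hij y) = stage i y := by
    have : stage j ∘ₗ trans i j hij = stage i := DirectSum.linearMap_ext _ fun k =>
      LinearMap.ext fun y => by simp [stage, trans]
    exact LinearMap.congr_fun this y
  have h₂ (i) (y) : DirectSum.toModule R J (DirectLimit B g) (fun k => map (a k) (ha k))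
      (stage i y) = of R ι B g i (DirectSum.toModule R J (B i) (fun k => a k i) y) := by
    have : DirectSum.toModule R J (DirectLimit B g) (fun k => map (a k) (ha k)) ∘ₗ stage i =
        of R ι B g i ∘ₗ DirectSum.toModule R J (B i) (fun k => a k i) :=
      DirectSum.linearMap_ext _ fun k => LinearMap.ext fun y => by simp [stage]
    exact LinearMap.congr_fun this y
  have h₃ (i j) (hij : i ≤ j) (y) :
      DirectSum.toModule R J (B j) (fun k => a k j) (trans i j hij y) =
        g i j hij (DirectSum.toModule R J (B i) (fun k => a k i) y) := by
    have : DirectSum.toModule R J (B j) (fun k => a k j) ∘ₗ trans i j hij =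
        g i j hij ∘ₗ DirectSum.toModule R J (B i) (fun k => a k i) :=
      DirectSum.linearMap_ext _ fun k => LinearMap.ext fun y => by
        simpa [trans] using LinearMap.congr_fun (ha k i j hij) y
    exact LinearMap.congr_fun this y
  constructor
  · rw [injective_iff_map_eq_zero]
    intro y hy
    -- finitely many components are nonzero, so that `y` comes from a finite stage
    obtain ⟨i, y, rfl⟩ : ∃ i z, stage i z = y := by
      clear hy
      induction y using DirectSum.induction_on with
      | zero => exact ⟨Classical.arbitrary ι, 0, map_zero _⟩
      | of k y =>
        obtain ⟨i, y, rfl⟩ := exists_of y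
        exact ⟨i, DirectSum.lof R J (fun k => A k i) k y, DirectSum.lmap_lof _ _ _⟩
      | add y z hy hz =>
        obtain ⟨i, y, rfl⟩ := hy
        obtain ⟨j, z, rfl⟩ := hz
        obtain ⟨k, hik, hjk⟩ := exists_ge_ge i j
        exact ⟨k, trans i k hik y + trans j k hjk z, by rw [map_add, h₁, h₁]⟩
    rw [h₂] at hy
    obtain ⟨j, hij, hj⟩ := of.zero_exact hy
    rw [← h₃] at hj
    rw [← h₁ i j hij, (h j).1 (hj.trans (map_zero _).symm), map_zero]
  · intro y
    obtain ⟨i, y, rfl⟩ := exists_of y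
    obtain ⟨y, rfl⟩ := (h i).2 y
    exact ⟨stage i y, h₂ i y⟩

end Module.DirectLimit

/-! ### The colimit of the homology theories of a directed system of groups -/

namespace EquivariantHomologyTheory

variable {Γ : Type v} [Group Γ] {Λ : Type w} [Ring Λ]
  (𝓗 : EquivariantHomologyTheory.{u, v, w, x} Γ Λ)

/-- The comparison map `a_n` of the identity is the identity; this is the compatibility of the
induction structure with conjugation by the unit. -/
theorem map_comp_a_id {G : Type u} [Group G] (ξ : G →* Γ) (α : G →* G) (hα : α = MonoidHom.id G)
    (h : ξ.comp α = ξ) (n : ℤ) (P : GCWPair G) (r : P ⟶ P.res α) (hr : r.toFun = id) :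
    ((𝓗.theory G ξ).H n).map r ≫ 𝓗.a ξ ξ α h n P = 𝟙 _ := by
  obtain rfl : α = (MulAut.conj (1 : G)).toMonoidHom := by
    rw [hα]
    ext
    simp
  have h₁ := (𝓗.ind ξ ξ _ h n).naturality_assoc r (((𝓗.theory G ξ).H n).map (P.counit _))
  have h₂ := 𝓗.ind_conj ξ 1 (map_one ξ) n P
  rw [a, h₁, h₂, Functor.comp_map, ← Functor.map_comp, ← Functor.map_comp,
    ← CategoryTheory.Functor.map_id]
  congr 1
  refine GCWPair.hom_ext _ _ fun p => ?_
  have e : r.toFun ((1 : G)⁻¹ • p) = p := by rw [hr, inv_one, one_smul]; rfl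
  exact (one_smul G (show P.space.carrier from r.toFun ((1 : G)⁻¹ • p))).trans e

variable {G : Type u} [Group G] (ξ : G →* Γ) {I : Type u} [Preorder I]
    (D : DirectedColimit I G) (n : ℤ)

theorem systemMap_self (P : GCWPair G) (i : I) : 𝓗.systemMap ξ D n P i i le_rfl = 𝟙 _ :=
  𝓗.map_comp_a_id (ξ.comp (D.ψ i)) (D.φ i i le_rfl) (D.φ_self i) _ n (P.res (D.ψ i)) _ rfl

theorem systemMap_comp (P : GCWPair G) (i j k : I) (hij : i ≤ j) (hjk : j ≤ k) :
    𝓗.systemMap ξ D n P i j hij ≫ 𝓗.systemMap ξ D n P j k hjk =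
      𝓗.systemMap ξ D n P i k (hij.trans hjk) := by
  have h := 𝓗.a_comp (ξ.comp (D.ψ i)) (ξ.comp (D.ψ j)) (ξ.comp (D.ψ k)) (D.φ i j hij)
    (D.φ j k hjk) (D.φ i k (hij.trans hjk)) (D.φ_comp i j k hij hjk)
    (by rw [MonoidHom.comp_assoc, D.ψ_comp]) (by rw [MonoidHom.comp_assoc, D.ψ_comp])
    (by rw [MonoidHom.comp_assoc, D.ψ_comp]) n (P.res (D.ψ k))
  have h' := 𝓗.a_naturality (ξ.comp (D.ψ i)) (ξ.comp (D.ψ j)) (D.φ i j hij)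
    (by rw [MonoidHom.comp_assoc, D.ψ_comp]) n
    (P.resIdent (D.φ j k hjk) (D.ψ k) (D.ψ j) (D.ψ_comp j k hjk))
  simp only [systemMap, Category.assoc]
  rw [← h, ← reassoc_of% h', ← Functor.map_comp_assoc, ← Functor.map_comp_assoc]
  rfl

instance directedSystem_systemMap (P : GCWPair G) :
    DirectedSystem (fun i => ((𝓗.theory (D.obj i) (ξ.comp (D.ψ i))).H n).obj (P.res (D.ψ i)))
      fun i j hij => (𝓗.systemMap ξ D n P i j hij).hom where
  map_self i y := congrArg (fun f => f.hom y) (𝓗.systemMap_self ξ D n P i)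
  map_map i j k hij hjk y := congrArg (fun f => f.hom y) (𝓗.systemMap_comp ξ D n P k j i hij hjk)

open Classical in
/-- The module `colim_i H_n^{G_i}(ψ_i^*(X, A))`. -/
abbrev ColimH (P : GCWPair G) : Type max u x :=
  Module.DirectLimit
    (fun i => ((𝓗.theory (D.obj i) (ξ.comp (D.ψ i))).H n).obj (P.res (D.ψ i)))
    (fun i j hij => (𝓗.systemMap ξ D n P i j hij).hom)

open Classical in
/-- The structure maps of `colim_i H_n^{G_i}(ψ_i^*(X, A))`. -/
noncomputable abbrev colimOf (P : GCWPair G) (i : I) :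
    ((𝓗.theory (D.obj i) (ξ.comp (D.ψ i))).H n).obj (P.res (D.ψ i)) →ₗ[Λ] 𝓗.ColimH ξ D n P :=
  Module.DirectLimit.of Λ I
    (fun i => ((𝓗.theory (D.obj i) (ξ.comp (D.ψ i))).H n).obj (P.res (D.ψ i)))
    (fun i j hij => (𝓗.systemMap ξ D n P i j hij).hom) i

theorem map_comp_systemMap {P Q : GCWPair G} (f : P ⟶ Q) (i j : I) (hij : i ≤ j) :
    (((𝓗.theory (D.obj j) (ξ.comp (D.ψ j))).H n).map (GCWPair.resMap (D.ψ j) f)).hom ∘ₗ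
        (𝓗.systemMap ξ D n P i j hij).hom =
      (𝓗.systemMap ξ D n Q i j hij).hom ∘ₗ
        (((𝓗.theory (D.obj i) (ξ.comp (D.ψ i))).H n).map (GCWPair.resMap (D.ψ i) f)).hom :=
  congrArg ModuleCat.Hom.hom (𝓗.systemMap_naturality ξ D n f i j hij).symm

theorem bdry_comp_systemMap (P : GCWPair G) (i j : I) (hij : i ≤ j) :
    (((𝓗.theory (D.obj j) (ξ.comp (D.ψ j))).bdry n).app (P.res (D.ψ j))).hom ∘ₗ
        (𝓗.systemMap ξ D (n + 1) P i j hij).hom =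
      (𝓗.systemMap ξ D n ((GCWPair.subFunctor G).obj P) i j hij).hom ∘ₗ
        (((𝓗.theory (D.obj i) (ξ.comp (D.ψ i))).bdry n).app (P.res (D.ψ i))).hom :=
  congrArg ModuleCat.Hom.hom (𝓗.systemMap_bdry ξ D n P i j hij)

open Classical in
/-- The map induced by a morphism of pairs on `colim_i H_n^{G_i}(ψ_i^*(X, A))`. -/
noncomputable def colimMap {P Q : GCWPair G} (f : P ⟶ Q) :
    𝓗.ColimH ξ D n P →ₗ[Λ] 𝓗.ColimH ξ D n Q :=
  Module.DirectLimit.map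
    (fun i => (((𝓗.theory (D.obj i) (ξ.comp (D.ψ i))).H n).map (GCWPair.resMap (D.ψ i) f)).hom)
    (𝓗.map_comp_systemMap ξ D n f)

open Classical in
theorem colimMap_of {P Q : GCWPair G} (f : P ⟶ Q) (i : I)
    (y : ((𝓗.theory (D.obj i) (ξ.comp (D.ψ i))).H n).obj (P.res (D.ψ i))) :
    𝓗.colimMap ξ D n f (𝓗.colimOf ξ D n P i y) = 𝓗.colimOf ξ D n Q i
      ((((𝓗.theory (D.obj i) (ξ.comp (D.ψ i))).H n).map (GCWPair.resMap (D.ψ i) f)).hom y) :=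
  Module.DirectLimit.map_apply_of (f' := fun i j hij => (𝓗.systemMap ξ D n Q i j hij).hom) _
    (𝓗.map_comp_systemMap ξ D n f) y

open Classical in
/-- The boundary operator of `colim_i H_n^{G_i}(ψ_i^*(X, A))`. -/
noncomputable def colimBdry (P : GCWPair G) :
    𝓗.ColimH ξ D (n + 1) P →ₗ[Λ] 𝓗.ColimH ξ D n ((GCWPair.subFunctor G).obj P) :=
  Module.DirectLimit.map
    (fun i => (((𝓗.theory (D.obj i) (ξ.comp (D.ψ i))).bdry n).app (P.res (D.ψ i))).hom)
    (𝓗.bdry_comp_systemMap ξ D n P)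

open Classical in
theorem colimBdry_of (P : GCWPair G) (i : I)
    (y : ((𝓗.theory (D.obj i) (ξ.comp (D.ψ i))).H (n + 1)).obj (P.res (D.ψ i))) :
    𝓗.colimBdry ξ D n P (𝓗.colimOf ξ D (n + 1) P i y) =
      𝓗.colimOf ξ D n ((GCWPair.subFunctor G).obj P) i
        ((((𝓗.theory (D.obj i) (ξ.comp (D.ψ i))).bdry n).app (P.res (D.ψ i))).hom y) :=
  Module.DirectLimit.map_apply_of
    (f' := fun i j hij => (𝓗.systemMap ξ D n ((GCWPair.subFunctor G).obj P) i j hij).hom) _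
    (𝓗.bdry_comp_systemMap ξ D n P) y

open Classical in
variable {𝓗 ξ D n} in
theorem colimH_hom_ext {P : GCWPair G} {M : Type*} [AddCommGroup M] [Module Λ M]
    {f g : 𝓗.ColimH ξ D n P →ₗ[Λ] M}
    (h : ∀ i y, f (𝓗.colimOf ξ D n P i y) = g (𝓗.colimOf ξ D n P i y)) : f = g :=
  Module.DirectLimit.hom_ext fun i => LinearMap.ext (h i)

theorem colimMap_id (P : GCWPair G) : 𝓗.colimMap ξ D n (𝟙 P) = LinearMap.id :=
  colimH_hom_ext fun i y => by
    rw [colimMap_of]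
    exact congrArg (fun f => 𝓗.colimOf ξ D n P i (f.hom y))
      (((𝓗.theory (D.obj i) (ξ.comp (D.ψ i))).H n).map_id (P.res (D.ψ i)))

theorem colimMap_comp {P Q R : GCWPair G} (f : P ⟶ Q) (g : Q ⟶ R) :
    𝓗.colimMap ξ D n (f ≫ g) = 𝓗.colimMap ξ D n g ∘ₗ 𝓗.colimMap ξ D n f :=
  colimH_hom_ext fun i y => by
    rw [LinearMap.comp_apply, colimMap_of, colimMap_of, colimMap_of]
    exact congrArg (fun f => 𝓗.colimOf ξ D n R i (f.hom y))
      (((𝓗.theory (D.obj i) (ξ.comp (D.ψ i))).H n).map_comp (GCWPair.resMap (D.ψ i) f)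
        (GCWPair.resMap (D.ψ i) g))

theorem colimBdry_naturality {P Q : GCWPair G} (f : P ⟶ Q) :
    𝓗.colimBdry ξ D n Q ∘ₗ 𝓗.colimMap ξ D (n + 1) f =
      𝓗.colimMap ξ D n ((GCWPair.subFunctor G).map f) ∘ₗ 𝓗.colimBdry ξ D n P :=
  colimH_hom_ext fun i y => by
    rw [LinearMap.comp_apply, LinearMap.comp_apply, colimMap_of, colimBdry_of, colimBdry_of]
    refine Eq.trans ?_ (𝓗.colimMap_of ξ D n ((GCWPair.subFunctor G).map f) i _).symm
    exact congrArg (fun f => 𝓗.colimOf ξ D n ((GCWPair.subFunctor G).obj Q) i (f.hom y))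
      (((𝓗.theory (D.obj i) (ξ.comp (D.ψ i))).bdry n).naturality (GCWPair.resMap (D.ψ i) f))

variable [IsDirectedOrder I] [Nonempty I]

open Classical in
/-- The functors `(X, A) ↦ colim_i H_n^{G_i}(ψ_i^*(X, A))` form a `G`-homology theory. -/
noncomputable def colimTheory : GHomologyTheory.{u, w, max u x} G Λ where
  H n :=
    { obj := fun P => ModuleCat.of Λ (𝓗.ColimH ξ D n P)
      map := fun f => ModuleCat.ofHom (𝓗.colimMap ξ D n f)
      map_id := fun P => ModuleCat.hom_ext (𝓗.colimMap_id ξ D n P)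
      map_comp := fun f g => ModuleCat.hom_ext (𝓗.colimMap_comp ξ D n f g) }
  bdry n :=
    { app := fun P => ModuleCat.ofHom (𝓗.colimBdry ξ D n P)
      naturality := fun P Q f => ModuleCat.hom_ext (𝓗.colimBdry_naturality ξ D n f) }
  homotopy_invariance n P Q f₀ f₁ h := ModuleCat.hom_ext (colimH_hom_ext fun i y =>
    (𝓗.colimMap_of ξ D n f₀ i y).trans ((congrArg
      (fun f => 𝓗.colimOf ξ D n Q i (ModuleCat.Hom.hom f y))
      ((𝓗.theory (D.obj i) (ξ.comp (D.ψ i))).homotopy_invariance n _ _ (h.res (D.ψ i)))).trans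
        (𝓗.colimMap_of ξ D n f₁ i y).symm))
  exact_space n P := Module.DirectLimit.map_exact _ (𝓗.map_comp_systemMap ξ D n P.inclSub)
    _ (𝓗.map_comp_systemMap ξ D n P.inclPair) fun i =>
    (𝓗.theory (D.obj i) (ξ.comp (D.ψ i))).exact_space n (P.res (D.ψ i))
  exact_pair n P := have := 𝓗.directedSystem_systemMap ξ D n ((GCWPair.subFunctor G).obj P)
    Module.DirectLimit.map_exact (h := fun i j hij => (𝓗.systemMap ξ D n
      ((GCWPair.subFunctor G).obj P) i j hij).hom) _
    (𝓗.map_comp_systemMap ξ D (n + 1) P.inclPair) _ (𝓗.bdry_comp_systemMap ξ D n P) fun i =>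
    (𝓗.theory (D.obj i) (ξ.comp (D.ψ i))).exact_pair n (P.res (D.ψ i))
  exact_sub n P := Module.DirectLimit.map_exact _ (𝓗.bdry_comp_systemMap ξ D n P)
    _ (𝓗.map_comp_systemMap ξ D n P.inclSub) fun i =>
    (𝓗.theory (D.obj i) (ξ.comp (D.ψ i))).exact_sub n (P.res (D.ψ i))
  excision n P Q F hF := Module.DirectLimit.map_bijective _ (𝓗.map_comp_systemMap ξ D n F) fun i =>
    (𝓗.theory (D.obj i) (ξ.comp (D.ψ i))).excision n _ (hF.res (D.ψ i))
  disjoint_union n J X := Module.DirectLimit.toModule_map_bijective _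
    (fun j => 𝓗.map_comp_systemMap ξ D n (GCWComplex.coprodIncl X j)) fun i =>
    (𝓗.theory (D.obj i) (ξ.comp (D.ψ i))).disjoint_union n fun j => (X j).res (D.ψ i)

end EquivariantHomologyTheory

/-! ### Transformations of homology theories -/

/-- The five lemma for modules over a not necessarily commutative ring. -/
theorem LinearMap.bijective_of_exact_rows {R : Type*} [Ring R]
    {M₁ M₂ M₃ M₄ M₅ N₁ N₂ N₃ N₄ N₅ : Type*}
    [AddCommGroup M₁] [AddCommGroup M₂] [AddCommGroup M₃] [AddCommGroup M₄] [AddCommGroup M₅]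
    [Module R M₁] [Module R M₂] [Module R M₃] [Module R M₄] [Module R M₅]
    [AddCommGroup N₁] [AddCommGroup N₂] [AddCommGroup N₃] [AddCommGroup N₄] [AddCommGroup N₅]
    [Module R N₁] [Module R N₂] [Module R N₃] [Module R N₄] [Module R N₅]
    {f₁ : M₁ →ₗ[R] M₂} {f₂ : M₂ →ₗ[R] M₃} {f₃ : M₃ →ₗ[R] M₄} {f₄ : M₄ →ₗ[R] M₅}
    {g₁ : N₁ →ₗ[R] N₂} {g₂ : N₂ →ₗ[R] N₃} {g₃ : N₃ →ₗ[R] N₄} {g₄ : N₄ →ₗ[R] N₅}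
    {i₁ : M₁ →ₗ[R] N₁} {i₂ : M₂ →ₗ[R] N₂} {i₃ : M₃ →ₗ[R] N₃} {i₄ : M₄ →ₗ[R] N₄}
    {i₅ : M₅ →ₗ[R] N₅} (hc₁ : ∀ z, i₂ (f₁ z) = g₁ (i₁ z)) (hc₂ : ∀ z, i₃ (f₂ z) = g₂ (i₂ z))
    (hc₃ : ∀ z, i₄ (f₃ z) = g₃ (i₃ z)) (hc₄ : ∀ z, i₅ (f₄ z) = g₄ (i₄ z))
    (hf₁ : Function.Exact f₁ f₂) (hf₂ : Function.Exact f₂ f₃) (hf₃ : Function.Exact f₃ f₄)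
    (hg₁ : Function.Exact g₁ g₂) (hg₂ : Function.Exact g₂ g₃) (hg₃ : Function.Exact g₃ g₄)
    (hi₁ : Function.Surjective i₁) (hi₂ : Function.Bijective i₂) (hi₄ : Function.Bijective i₄)
    (hi₅ : Function.Injective i₅) : Function.Bijective i₃ :=
  AddMonoidHom.bijective_of_surjective_of_bijective_of_bijective_of_injective
    f₁.toAddMonoidHom f₂.toAddMonoidHom f₃.toAddMonoidHom f₄.toAddMonoidHom
    g₁.toAddMonoidHom g₂.toAddMonoidHom g₃.toAddMonoidHom g₄.toAddMonoidHom
    i₁.toAddMonoidHom i₂.toAddMonoidHom i₃.toAddMonoidHom i₄.toAddMonoidHom i₅.toAddMonoidHom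
    (AddMonoidHom.ext fun z => (hc₁ z).symm) (AddMonoidHom.ext fun z => (hc₂ z).symm)
    (AddMonoidHom.ext fun z => (hc₃ z).symm) (AddMonoidHom.ext fun z => (hc₄ z).symm)
    hf₁ hf₂ hf₃ hg₁ hg₂ hg₃ hi₁ hi₂ hi₄ hi₅

/-- A natural transformation of `G`-homology theories that is compatible with the boundary
operators. The two theories may take values in modules of different universes. -/
structure GHomologyTheory.Trans {G : Type u} [Group G] {Λ : Type w} [Ring Λ]
    (h : GHomologyTheory.{u, w, x} G Λ) (k : GHomologyTheory.{u, w, y} G Λ) where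
  app : ∀ (n : ℤ) (P : GCWPair G), (h.H n).obj P →ₗ[Λ] (k.H n).obj P
  naturality : ∀ (n : ℤ) {P Q : GCWPair G} (f : P ⟶ Q) (z : (h.H n).obj P),
    app n Q (((h.H n).map f).hom z) = ((k.H n).map f).hom (app n P z)
  bdry : ∀ (n : ℤ) (P : GCWPair G) (z : (h.H (n + 1)).obj P),
    app n ((GCWPair.subFunctor G).obj P) (((h.bdry n).app P).hom z) =
      ((k.bdry n).app P).hom (app (n + 1) P z)

namespace GHomologyTheory.Trans

variable {G : Type u} [Group G] {Λ : Type w} [Ring Λ]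
  {h : GHomologyTheory.{u, w, x} G Λ} {k : GHomologyTheory.{u, w, y} G Λ} (τ : h.Trans k)

/-- The transformation is bijective on the pair `P` in all degrees. -/
def IsIso (P : GCWPair G) : Prop := ∀ n, Function.Bijective (τ.app n P)

variable {τ}

/-- A homotopy retract of a pair on which `τ` is an isomorphism is again such a pair. -/
theorem IsIso.of_retract {P Q : GCWPair G} (hQ : τ.IsIso Q) (s : P ⟶ Q) (r : Q ⟶ P)
    (hrs : GCWPair.Homotopic (s ≫ r) (𝟙 P)) : τ.IsIso P := by
  intro n
  have hh (z : (h.H n).obj P) : ((h.H n).map r).hom (((h.H n).map s).hom z) = z := by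
    have := h.homotopy_invariance n _ _ hrs
    rw [Functor.map_comp, CategoryTheory.Functor.map_id] at this
    exact congrArg (fun f => f.hom z) this
  have hk (z : (k.H n).obj P) : ((k.H n).map r).hom (((k.H n).map s).hom z) = z := by
    have := k.homotopy_invariance n _ _ hrs
    rw [Functor.map_comp, CategoryTheory.Functor.map_id] at this
    exact congrArg (fun f => f.hom z) this
  constructor
  · intro z z' hz
    rw [← hh z, ← hh z']
    refine congrArg _ ((hQ n).1 ?_)
    rw [τ.naturality, τ.naturality, hz]
  · intro z
    obtain ⟨z', hz'⟩ := (hQ n).2 (((k.H n).map s).hom z)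
    exact ⟨((h.H n).map r).hom z', by rw [τ.naturality, hz', hk]⟩

theorem IsIso.of_excision {P Q : GCWPair G} (hP : τ.IsIso P) (F : P ⟶ Q)
    (hF : GCWPair.IsCellularPushout F) : τ.IsIso Q := by
  intro n
  have e : τ.app n Q ∘ ((h.H n).map F).hom = ((k.H n).map F).hom ∘ τ.app n P :=
    funext (τ.naturality n F)
  refine (Function.Bijective.of_comp_iff (τ.app n Q) (h.excision n F hF)).1 ?_
  rw [e]
  exact (k.excision n F hF).comp (hP n)

theorem IsIso.coprod {J : Type u} (X : J → GCWComplex G) (hX : ∀ j, τ.IsIso (X j).toPair) :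
    τ.IsIso (GCWComplex.coprod X).toPair := by
  classical
  intro n
  refine (Function.Bijective.of_comp_iff _ (h.disjoint_union n X)).1 ?_
  have e : τ.app n (GCWComplex.coprod X).toPair ∘ₗ DirectSum.toModule Λ J
        ((h.H n).obj (GCWComplex.coprod X).toPair)
        (fun j => ((h.H n).map (GCWComplex.coprodIncl X j)).hom) =
      DirectSum.toModule Λ J ((k.H n).obj (GCWComplex.coprod X).toPair)
        (fun j => ((k.H n).map (GCWComplex.coprodIncl X j)).hom) ∘ₗ
      DirectSum.lmap (fun j => τ.app n (X j).toPair) :=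
    DirectSum.linearMap_ext _ fun j => LinearMap.ext fun z => by
      simpa using τ.naturality n (GCWComplex.coprodIncl X j) z
  have hb : Function.Bijective (DirectSum.lmap (fun j => τ.app n (X j).toPair)) :=
    ⟨(DirectSum.lmap_injective _).2 fun j => (hX j n).1,
      (DirectSum.lmap_surjective _).2 fun j => (hX j n).2⟩
  have := (k.disjoint_union n X).comp hb
  rw [← LinearMap.coe_comp] at this
  convert this using 1
  rw [← e]
  rfl

/-- If `τ` is an isomorphism on `A` and on `X`, then it is one on `(X, A)`, by the five lemma. -/
theorem IsIso.pair {P : GCWPair G} (hA : τ.IsIso ((GCWPair.subFunctor G).obj P))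
    (hX : τ.IsIso P.space.toPair) : τ.IsIso P := by
  intro n
  obtain ⟨m, rfl⟩ : ∃ m, n = m + 1 := ⟨n - 1, by omega⟩
  exact LinearMap.bijective_of_exact_rows
    (τ.naturality (m + 1) P.inclSub) (τ.naturality (m + 1) P.inclPair) (τ.bdry m P)
    (τ.naturality m P.inclSub)
    (h.exact_space _ P) (h.exact_pair _ P) (h.exact_sub _ P)
    (k.exact_space _ P) (k.exact_pair _ P) (k.exact_sub _ P)
    (hA _).2 (hX _) (hA _) (hX _).1

/-- If `τ` is an isomorphism on `A` and on `(X, A)`, then it is one on `X`, by the five lemma. -/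
theorem IsIso.space {P : GCWPair G} (hA : τ.IsIso ((GCWPair.subFunctor G).obj P))
    (hP : τ.IsIso P) : τ.IsIso P.space.toPair := by
  intro n
  obtain ⟨m, rfl⟩ : ∃ m, n = m + 1 := ⟨n - 1, by omega⟩
  exact LinearMap.bijective_of_exact_rows
    (τ.bdry (m + 1) P) (τ.naturality (m + 1) P.inclSub) (τ.naturality (m + 1) P.inclPair)
    (τ.bdry m P)
    (h.exact_sub _ P) (h.exact_space _ P) (h.exact_pair _ P)
    (k.exact_sub _ P) (k.exact_space _ P) (k.exact_pair _ P)
    (hP _).2 (hA _) (hP _) (hA _).1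

/-- If `Y = X ∪_f B` for a cellular map `f : A → B` and `τ` is an isomorphism on `A`, `X` and `B`,
then it is an isomorphism on `Y`. -/
theorem IsIso.pushout {P Q : GCWPair G} (F : P ⟶ Q) (hF : GCWPair.IsCellularPushout F)
    (hA : τ.IsIso P.subComplex.toPair) (hX : τ.IsIso P.space.toPair)
    (hB : τ.IsIso Q.subComplex.toPair) : τ.IsIso Q.space.toPair :=
  IsIso.space hB ((IsIso.pair hA hX).of_excision F hF)

/-- A complex `X` is dominated by a complex `Y` if there are equivariant maps `s : X → Y` and
`r : Y → X` with `r ∘ s` equivariantly homotopic to the identity. -/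
theorem IsIso.of_domination {X Y : GCWComplex G} (hY : τ.IsIso Y.toPair)
    (s : X.carrier → Y.carrier) (hs : Continuous s) (hs' : ∀ (g : G) p, s (g • p) = g • s p)
    (r : Y.carrier → X.carrier) (hr : Continuous r) (hr' : ∀ (g : G) p, r (g • p) = g • r p)
    (H : unitInterval × X.carrier → X.carrier) (hH : Continuous H)
    (hH' : ∀ t (g : G) p, H (t, g • p) = g • H (t, p))
    (H0 : ∀ p, H (0, p) = p) (H1 : ∀ p, H (1, p) = r (s p)) : τ.IsIso X.toPair := by
  refine hY.of_retract (GCWComplex.homMk s hs hs') (GCWComplex.homMk r hr hr')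
    ⟨fun q => H (unitInterval.symm q.1, q.2), by fun_prop, fun p => ?_, fun p => ?_,
      fun t g p => hH' _ g p, fun _ _ h => h.elim⟩
  · exact (congrArg (fun t => H (t, p)) unitInterval.symm_zero).trans (H1 p)
  · exact (congrArg (fun t => H (t, p)) unitInterval.symm_one).trans (H0 p)

theorem IsIso.of_leftInverse {X Y : GCWComplex G} (hY : τ.IsIso Y.toPair)
    (s : X.carrier → Y.carrier) (hs : Continuous s) (hs' : ∀ (g : G) p, s (g • p) = g • s p)
    (r : Y.carrier → X.carrier) (hr : Continuous r) (hr' : ∀ (g : G) p, r (g • p) = g • r p)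
    (h : ∀ p, r (s p) = p) : τ.IsIso X.toPair :=
  hY.of_domination s hs hs' r hr hr' Prod.snd continuous_snd (fun _ _ _ => rfl) (fun _ => rfl)
    fun p => (h p).symm

end GHomologyTheory.Trans

namespace EquivariantHomologyTheory

variable {Γ : Type v} [Group Γ] {Λ : Type w} [Ring Λ]
  (𝓗 : EquivariantHomologyTheory.{u, v, w, x} Γ Λ)
  {G : Type u} [Group G] (ξ : G →* Γ) {I : Type u} [Preorder I]
  (D : DirectedColimit I G)

open Classical in
theorem t_of (n : ℤ) (P : GCWPair G) (i : I)
    (y : ((𝓗.theory (D.obj i) (ξ.comp (D.ψ i))).H n).obj (P.res (D.ψ i))) :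
    𝓗.t ξ D n P (𝓗.colimOf ξ D n P i y) = (𝓗.a (ξ.comp (D.ψ i)) ξ (D.ψ i) rfl n P).hom y :=
  Module.DirectLimit.lift_of _ _ _

open Classical in
/-- The maps `t_n^G(X, A)` form a transformation of `G`-homology theories. -/
noncomputable def tTrans [IsDirectedOrder I] [Nonempty I] :
    (𝓗.colimTheory ξ D).Trans (𝓗.theory G ξ) where
  app n P := 𝓗.t ξ D n P
  naturality n P Q f z := by
    obtain ⟨i, y, rfl⟩ := Module.DirectLimit.exists_of z
    refine (congrArg _ (𝓗.colimMap_of ξ D n f i y)).trans ((𝓗.t_of ξ D n Q i _).trans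
      (.trans ?_ (congrArg _ (𝓗.t_of ξ D n P i y).symm)))
    exact congrArg (fun f => f.hom y) (𝓗.a_naturality _ ξ (D.ψ i) rfl n f)
  bdry n P z := by
    obtain ⟨i, y, rfl⟩ := Module.DirectLimit.exists_of z
    refine (congrArg _ (𝓗.colimBdry_of ξ D n P i y)).trans ((𝓗.t_of ξ D n _ i _).trans
      (.trans ?_ (congrArg _ (𝓗.t_of ξ D (n + 1) P i y).symm)))
    exact congrArg (fun f => f.hom y) (𝓗.a_bdry _ ξ (D.ψ i) rfl n P).symm

end EquivariantHomologyTheory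

/-! ### Discrete complexes -/

namespace GCWComplex

/-- A `G`-set, viewed as a `0`-dimensional `G`-CW-complex. -/
def discrete (G : Type u) [Group G] (S : Type u) [MulAction G S] : GCWComplex G :=
  letI : TopologicalSpace S := ⊥
  haveI : DiscreteTopology S := ⟨rfl⟩
  { carrier := S
    cont := ⟨fun _ => continuous_of_discreteTopology⟩
    cw :=
      { skel := fun n => {_p | 0 < n}
        skel_zero := by simp
        skel_mono := fun m n h p hp => lt_of_lt_of_le hp h
        exists_mem_skel := fun p => ⟨1, Nat.one_pos⟩
        smul_mem_skel := fun _ _ _ h => h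
        isClosed_skel := fun _ => isClosed_discrete _
        isClosed_of_skel := fun _ _ => isClosed_discrete _
        cell := fun n => {_p : S // n = 0}
        cellAction := fun n =>
          { smul := fun g p => ⟨g • p.1, p.2⟩
            one_smul := fun p => Subtype.ext (one_smul G p.1)
            mul_smul := fun g h p => Subtype.ext (mul_smul g h p.1) }
        charMap := fun _ e _ => e.1
        continuous_charMap := fun _ _ => continuous_const
        charMap_smul := fun _ _ _ _ => rfl
        charMap_mem := fun n _ _ => Nat.succ_pos n
        charMap_boundary := by
          rintro n ⟨_, rfl⟩ p hp
          have : p.1 = 0 := Subsingleton.elim _ _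
          simp [this] at hp
        charMap_interior := by
          rintro n ⟨_, rfl⟩ p hp
          exact lt_irrefl 0
        charMap_injective := by
          rintro n ⟨_, rfl⟩ ⟨_, _⟩ p p' _ _ h
          exact ⟨Subtype.ext h, Subtype.ext (Subsingleton.elim _ _)⟩
        exists_charMap := by
          intro n y _ hn
          have hn : ¬ 0 < n := hn
          obtain rfl : n = 0 := by omega
          exact ⟨⟨y, rfl⟩, ⟨0, by simp⟩, by simp, rfl⟩
        isClosed_of_charMap := fun _ _ _ _ _ => isClosed_discrete _ } }

variable {G : Type u} [Group G] {S : Type u} [MulAction G S]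

instance : DiscreteTopology (discrete G S).carrier := ⟨rfl⟩

/-- An equivariant map from a `G`-set to a `G`-CW-complex, as a morphism of pairs. -/
def ofDiscrete {X : GCWComplex G} (f : S → X.carrier) (hf : ∀ (g : G) s, f (g • s) = g • f s) :
    (discrete G S).toPair ⟶ X.toPair :=
  homMk (X := discrete G S) f continuous_of_discreteTopology hf

end GCWComplex

open GCWComplex

namespace GHomologyTheory

variable {G : Type u} [Group G] {Λ : Type w} [Ring Λ] (h : GHomologyTheory.{u, w, x} G Λ)
  {S : Type u} [MulAction G S]

/-- The inclusion of an orbit into a `G`-set. -/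
def orbitIncl (G : Type u) [Group G] {S : Type u} [MulAction G S] (s : S) :
    (discrete G (MulAction.orbit G s)).toPair ⟶ (discrete G S).toPair :=
  ofDiscrete (X := discrete G S) Subtype.val fun _ _ => rfl

theorem map_bijective_of_isIso (n : ℤ) {P Q : GCWPair G} (f : P ⟶ Q) (g : Q ⟶ P) (hfg : f ≫ g = 𝟙 P)
    (hgf : g ≫ f = 𝟙 Q) : Function.Bijective ((h.H n).map f).hom := by
  refine Function.bijective_iff_has_inverse.2 ⟨((h.H n).map g).hom, fun z => ?_, fun z => ?_⟩
  · have := congrArg (fun f => ((h.H n).map f).hom z) hfg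
    rwa [Functor.map_comp, CategoryTheory.Functor.map_id] at this
  · have := congrArg (fun f => ((h.H n).map f).hom z) hgf
    rwa [Functor.map_comp, CategoryTheory.Functor.map_id] at this

theorem map_bijective_of_bijective (n : ℤ) {P : GCWPair G} (f : P ⟶ (discrete G S).toPair)
    (hf : Function.Bijective f.toFun) : Function.Bijective ((h.H n).map f).hom := by
  obtain ⟨g, hg, hg'⟩ := Function.bijective_iff_has_inverse.1 hf
  refine h.map_bijective_of_isIso n f (GCWPair.Hom.mk (P := (discrete G S).toPair) g
      (continuous_of_discreteTopology (α := (discrete G S).carrier)) (fun k s => hf.1 ?_)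
      fun _ hp => hp.elim)
    (GCWPair.hom_ext _ _ hg) (GCWPair.hom_ext _ _ hg')
  rw [f.map_smul, hg', hg']

/-- The orbits of a `G`-set, as discrete complexes. -/
noncomputable def orbits (G : Type u) [Group G] (S : Type u) [MulAction G S]
    (ω : MulAction.orbitRel.Quotient G S) : GCWComplex G :=
  discrete G (MulAction.orbit G ω.out)

/-- A `G`-set as the disjoint union of its orbits. -/
noncomputable def sigmaOrbits (G : Type u) [Group G] (S : Type u) [MulAction G S] :
    (coprod (orbits G S)).toPair ⟶ (discrete G S).toPair :=
  homMk (X := coprod (orbits G S)) (Y := discrete G S)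
    (fun q => q.2.1) (continuous_sigma fun _ => continuous_of_discreteTopology
      (α := (discrete G (MulAction.orbit G _)).carrier)) fun _ _ => rfl

theorem sigmaOrbits_bijective (G : Type u) [Group G] (S : Type u) [MulAction G S] :
    Function.Bijective (sigmaOrbits G S).toFun :=
  (MulAction.selfEquivSigmaOrbits G S).symm.bijective

theorem coprodIncl_comp_sigmaOrbits (ω : MulAction.orbitRel.Quotient G S) :
    coprodIncl (orbits G S) ω ≫ sigmaOrbits G S = orbitIncl G ω.out := rfl

/-- The homology of a `G`-set is generated by the images of the homology of its orbits. -/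
theorem discrete_induction (n : ℤ) {C : (h.H n).obj (discrete G S).toPair → Prop} (zero : C 0)
    (add : ∀ y z, C y → C z → C (y + z))
    (orbit : ∀ (s : S) y, C (((h.H n).map (orbitIncl G s)).hom y)) (z) : C z := by
  classical
  obtain ⟨z, rfl⟩ := (h.map_bijective_of_bijective n _ (sigmaOrbits_bijective G S)).2 z
  obtain ⟨z, rfl⟩ := (h.disjoint_union n (orbits G S)).2 z
  induction z using DirectSum.induction_on with
  | zero => rwa [map_zero, map_zero]
  | of ω z =>
    have e₁ := congrArg ((h.H n).map (sigmaOrbits G S)).hom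
      (DirectSum.toModule_lof Λ (M := fun ω => (h.H n).obj (orbits G S ω).toPair)
        (φ := fun ω => ((h.H n).map (coprodIncl (orbits G S) ω)).hom) ω z)
    have e₂ := congrArg (fun f => f.hom z)
      ((h.H n).map_comp (coprodIncl (orbits G S) ω) (sigmaOrbits G S))
    have e₃ := e₁.trans e₂.symm
    rw [coprodIncl_comp_sigmaOrbits] at e₃
    exact (show C _ from e₃ ▸ orbit ω.out z)
  | add y z hy hz =>
    rw [map_add, map_add]
    exact add _ _ hy hz

end GHomologyTheory

theorem GHomologyTheory.Trans.IsIso.discrete {G : Type u} [Group G] {Λ : Type w} [Ring Λ]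
    {h : GHomologyTheory.{u, w, x} G Λ} {k : GHomologyTheory.{u, w, y} G Λ} {τ : h.Trans k}
    {S : Type u} [MulAction G S]
    (hτ : ∀ s : S, τ.IsIso (discrete G (MulAction.orbit G s)).toPair) :
    τ.IsIso (discrete G S).toPair := by
  intro n
  have hb := IsIso.coprod (GHomologyTheory.orbits G S) (fun ω => hτ ω.out) n
  have e := funext (τ.naturality n (sigmaOrbits G S))
  refine (Function.Bijective.of_comp_iff (τ.app n _)
    (h.map_bijective_of_bijective n _ (sigmaOrbits_bijective G S))).1 ?_
  rw [show τ.app n _ ∘ ((h.H n).map (sigmaOrbits G S)).hom = _ from e]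
  exact (k.map_bijective_of_bijective n _ (sigmaOrbits_bijective G S)).comp hb

open GCWComplex

/-! ### Strong continuity and orbits -/

namespace EquivariantHomologyTheory

variable {Γ : Type v} [Group Γ] {Λ : Type w} [Ring Λ]
  (𝓗 : EquivariantHomologyTheory.{u, v, w, x} Γ Λ)

/-- The class of a point of a restricted `H`-space: for a homomorphism `α : H → G` and an `H`-fixed
point of `α^*X`, the induced map from the homology of a point for `H` to the `G`-homology of `X`. -/
def pointMap {H G : Type u} [Group H] [Group G] (ξ : H →* Γ) (μ : G →* Γ) (α : H →* G)
    (hα : μ.comp α = ξ) (n : ℤ) {P : GCWPair G} (e : (point H).toPair ⟶ P.res α) :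
    ((𝓗.theory H ξ).H n).obj (point H).toPair ⟶ ((𝓗.theory G μ).H n).obj P :=
  ((𝓗.theory H ξ).H n).map e ≫ 𝓗.a ξ μ α hα n P

/-- If the stabilizer of a point of a transitive `G`-set is the isomorphic image of `H`, then the
induction isomorphism identifies the homology of a point for `H` with the `G`-homology of the
`G`-set. -/
theorem pointMap_bijective {H G : Type u} [Group H] [Group G] (ξ : H →* Γ) (μ : G →* Γ)
    (α : H →* G) (hα : μ.comp α = ξ) (n : ℤ) (hinj : Function.Injective α)
    {S : Type u} [MulAction G S] (e : (point H).toPair ⟶ (discrete G S).toPair.res α) (s : S)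
    (he : ∀ p, e.toFun p = s) (hs : ∀ g : G, g • s = s → g ∈ α.range)
    (htr : ∀ s' : S, ∃ g : G, g • s = s') :
    Function.Bijective (𝓗.pointMap ξ μ α hα n e).hom := by
  let f : (GCWPair.indFunctor α).obj (point H).toPair ⟶ (discrete G S).toPair :=
    (GCWPair.indFunctor α).map e ≫ (discrete G S).toPair.counit α
  have hf (g : G) (p : (point H).carrier) :
      f.toFun (Induced.mk α g p) = (g • s : S) := congrArg (fun s : S => g • s) (he p)
  have e₁ : 𝓗.pointMap ξ μ α hα n e =
      (𝓗.ind ξ μ α hα n).app (point H).toPair ≫ ((𝓗.theory G μ).H n).map f := by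
    rw [pointMap, a, (𝓗.ind ξ μ α hα n).naturality_assoc, Functor.comp_map, ← Functor.map_comp]
  rw [e₁]
  refine ((𝓗.theory G μ).map_bijective_of_bijective n f ⟨?_, ?_⟩).comp
    (𝓗.ind_bijective ξ μ α hα hinj n)
  · intro q q' h
    obtain ⟨g, p, rfl⟩ := Induced.exists_rep (α := α) (X := (point H).carrier) q
    obtain ⟨g', p', rfl⟩ := Induced.exists_rep (α := α) (X := (point H).carrier) q'
    have h' : g • s = g' • s := (hf g p).symm.trans (h.trans (hf g' p'))
    obtain ⟨k, hk⟩ := hs (g⁻¹ * g') (by rw [mul_smul, ← h', inv_smul_smul])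
    exact Induced.mk_eq_iff.2 ⟨k, by rw [hk, mul_inv_cancel_left], rfl⟩
  · intro s'
    obtain ⟨g, rfl⟩ := htr s'
    exact ⟨Induced.mk α g PUnit.unit, hf g _⟩

/-- Compatibility of the class of a point with the comparison map of a homomorphism. -/
theorem pointMap_comp_a {H G K : Type u} [Group H] [Group G] [Group K] (ξ : H →* Γ)
    (μ : G →* Γ) (ν : K →* Γ) (α : H →* G) (β : G →* K) (γ : H →* K) (h : β.comp α = γ)
    (hα : μ.comp α = ξ) (hβ : ν.comp β = μ) (hγ : ν.comp γ = ξ) (n : ℤ) (P : GCWPair K)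
    (e : (point H).toPair ⟶ (P.res β).res α) (e' : (point H).toPair ⟶ P.res γ)
    (he : ∀ p, e.toFun p = e'.toFun p) :
    𝓗.pointMap ξ μ α hα n e ≫ 𝓗.a μ ν β hβ n P = 𝓗.pointMap ξ ν γ hγ n e' := by
  obtain rfl : e = e' ≫ P.resIdent α β γ h := GCWPair.hom_ext _ _ he
  rw [pointMap, pointMap, Functor.map_comp, Category.assoc, Category.assoc,
    𝓗.a_comp ξ μ ν α β γ h hα hβ hγ n P]

/-- Compatibility of the class of a point with the comparison map of a homomorphism. -/
theorem a_comp_pointMap {H G K : Type u} [Group H] [Group G] [Group K] (ξ : H →* Γ)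
    (μ : G →* Γ) (ν : K →* Γ) (α : H →* G) (β : G →* K) (γ : H →* K) (h : β.comp α = γ)
    (hα : μ.comp α = ξ) (hβ : ν.comp β = μ) (hγ : ν.comp γ = ξ) (n : ℤ) (P : GCWPair K)
    (e : (point G).toPair ⟶ P.res β) (e' : (point H).toPair ⟶ P.res γ)
    (he : ∀ p, e.toFun p = e'.toFun p) :
    𝓗.a ξ μ α hα n (point G).toPair ≫ 𝓗.pointMap μ ν β hβ n e = 𝓗.pointMap ξ ν γ hγ n e' := by
  have h₁ : GCWPair.resMap α e = e' ≫ P.resIdent α β γ h := GCWPair.hom_ext _ _ he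
  have h₂ : 𝓗.a ξ μ α hα n (point G).toPair ≫ ((𝓗.theory G μ).H n).map e =
      ((𝓗.theory H ξ).H n).map e' ≫ ((𝓗.theory H ξ).H n).map (P.resIdent α β γ h) ≫
        𝓗.a ξ μ α hα n (P.res β) := by
    rw [← Functor.map_comp_assoc, ← h₁]
    exact (𝓗.a_naturality ξ μ α hα n e).symm
  exact (Category.assoc _ _ _).symm.trans ((congrArg (· ≫ 𝓗.a μ ν β hβ n P) h₂).trans
    ((Category.assoc _ _ _).trans (congrArg (((𝓗.theory H ξ).H n).map e' ≫ ·)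
      ((Category.assoc _ _ _).trans (𝓗.a_comp ξ μ ν α β γ h hα hβ hγ n P)))))

theorem pointMap_map {H G : Type u} [Group H] [Group G] (ξ : H →* Γ) (μ : G →* Γ) (α : H →* G)
    (hα : μ.comp α = ξ) (n : ℤ) {P Q : GCWPair G} (e : (point H).toPair ⟶ P.res α) (f : P ⟶ Q) :
    𝓗.pointMap ξ μ α hα n e ≫ ((𝓗.theory G μ).H n).map f =
      𝓗.pointMap ξ μ α hα n (e ≫ GCWPair.resMap α f) := by
  rw [pointMap, pointMap, Category.assoc, ← a_naturality, Functor.map_comp, Category.assoc]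

section

variable {G : Type u} [Group G] (ξ : G →* Γ) {I : Type u} [Preorder I]
  (D : DirectedColimit I G) (n : ℤ) [IsDirectedOrder I] [Nonempty I]

/-- The morphism from a point to `α^*X` given by a point of `X` that is fixed by `α`. -/
def fixedPoint {H G : Type u} [Group H] [Group G] (α : H →* G) {X : GCWComplex G} (p : X.carrier)
    (hp : ∀ g : H, α g • p = p) : (point H).toPair ⟶ X.toPair.res α :=
  homMk (X := point H) (Y := X.res α) (fun _ => p) continuous_const fun g _ => (hp g).symm

variable {S : Type u} [MulAction G S] (s : S)

theorem smul_eq_of_mem_pullback {H : Type u} [Group H] (ι : H →* G) (hι : ∀ h, ι h • s = s) (i : I)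
    (g : (D.pullback ι).obj i) : D.ψ i (D.pullbackSnd ι i g) • s = s := by
  rw [← MonoidHom.comp_apply, D.ψ_comp_pullbackSnd]
  exact hι _

/-- The class of the point `s` in `H_n^{G_i}(ψ_i^*S)`, for the subgroup of `G_i` fixing `s`. -/
def stagePointMap {H : Type u} [Group H] (ι : H →* G) (hι : ∀ h, ι h • s = s) (i : I) :
    ((𝓗.theory _ ((ξ.comp ι).comp ((D.pullback ι).ψ i))).H n).obj (point _).toPair ⟶
      ((𝓗.theory (D.obj i) (ξ.comp (D.ψ i))).H n).obj ((discrete G S).toPair.res (D.ψ i)) :=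
  𝓗.pointMap _ _ (D.pullbackSnd ι i)
    (by rw [MonoidHom.comp_assoc, D.ψ_comp_pullbackSnd, MonoidHom.comp_assoc]) n
    (fixedPoint (D.pullbackSnd ι i) (X := (discrete G S).res (D.ψ i)) s
      (smul_eq_of_mem_pullback D s ι hι i))

theorem stagePointMap_systemMap {H : Type u} [Group H] (ι : H →* G) (hι : ∀ h, ι h • s = s)
    (i j : I) (hij : i ≤ j) :
    𝓗.stagePointMap ξ D n s ι hι i ≫ 𝓗.systemMap ξ D n (discrete G S).toPair i j hij =
      𝓗.systemMap (ξ.comp ι) (D.pullback ι) n (point H).toPair i j hij ≫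
        𝓗.stagePointMap ξ D n s ι hι j := by
  have hs (g : (D.pullback ι).obj i) : D.ψ j (D.φ i j hij (D.pullbackSnd ι i g)) • s = s := by
    rw [D.ψ_φ]
    exact smul_eq_of_mem_pullback D s ι hι i g
  have h₀ : (ξ.comp (D.ψ i)).comp (D.pullbackSnd ι i) = (ξ.comp ι).comp ((D.pullback ι).ψ i) := by
    rw [MonoidHom.comp_assoc, D.ψ_comp_pullbackSnd, MonoidHom.comp_assoc]
  have h₁ : (ξ.comp (D.ψ j)).comp (D.φ i j hij) = ξ.comp (D.ψ i) := by
    rw [MonoidHom.comp_assoc, D.ψ_comp]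
  have h₂ : (ξ.comp (D.ψ j)).comp ((D.φ i j hij).comp (D.pullbackSnd ι i)) =
      (ξ.comp ι).comp ((D.pullback ι).ψ i) := by
    rw [← MonoidHom.comp_assoc, h₁, h₀]
  have e₁ := 𝓗.pointMap_comp_a ((ξ.comp ι).comp ((D.pullback ι).ψ i)) (ξ.comp (D.ψ i))
    (ξ.comp (D.ψ j)) (D.pullbackSnd ι i) (D.φ i j hij)
    ((D.φ i j hij).comp (D.pullbackSnd ι i)) rfl h₀ h₁ h₂ n ((discrete G S).toPair.res (D.ψ j))
    (fixedPoint (D.pullbackSnd ι i) (X := (discrete G S).res (D.ψ i)) s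
      (smul_eq_of_mem_pullback D s ι hι i) ≫ GCWPair.resMap (D.pullbackSnd ι i)
        ((discrete G S).toPair.resIdent (D.φ i j hij) (D.ψ j) (D.ψ i) (D.ψ_comp i j hij)))
    (fixedPoint _ (X := (discrete G S).res (D.ψ j)) s hs) fun _ => rfl
  have e₂ := 𝓗.a_comp_pointMap ((ξ.comp ι).comp ((D.pullback ι).ψ i))
    ((ξ.comp ι).comp ((D.pullback ι).ψ j)) (ξ.comp (D.ψ j)) ((D.pullback ι).φ i j hij)
    (D.pullbackSnd ι j) ((D.φ i j hij).comp (D.pullbackSnd ι i)) rfl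
    (by rw [MonoidHom.comp_assoc, (D.pullback ι).ψ_comp])
    (by rw [MonoidHom.comp_assoc, D.ψ_comp_pullbackSnd, MonoidHom.comp_assoc]) h₂ n
    ((discrete G S).toPair.res (D.ψ j))
    (fixedPoint (D.pullbackSnd ι j) (X := (discrete G S).res (D.ψ j)) s
      (smul_eq_of_mem_pullback D s ι hι j))
    (fixedPoint _ (X := (discrete G S).res (D.ψ j)) s hs) fun _ => rfl
  have e₃ := 𝓗.pointMap_map ((ξ.comp ι).comp ((D.pullback ι).ψ i)) (ξ.comp (D.ψ i))
    (D.pullbackSnd ι i) h₀ n (fixedPoint (D.pullbackSnd ι i) (X := (discrete G S).res (D.ψ i)) s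
      (smul_eq_of_mem_pullback D s ι hι i))
    ((discrete G S).toPair.resIdent (D.φ i j hij) (D.ψ j) (D.ψ i) (D.ψ_comp i j hij))
  refine (Category.assoc _ _ _).symm.trans ((congrArg (· ≫ 𝓗.a (ξ.comp (D.ψ i)) (ξ.comp (D.ψ j))
    (D.φ i j hij) h₁ n ((discrete G S).toPair.res (D.ψ j))) e₃).trans ?_)
  refine e₁.trans (e₂.symm.trans (congrArg (· ≫ 𝓗.stagePointMap ξ D n s ι hι j) ?_))
  refine ((Category.id_comp _).symm.trans (congrArg (· ≫ 𝓗.a ((ξ.comp ι).comp ((D.pullback ι).ψ i))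
    ((ξ.comp ι).comp ((D.pullback ι).ψ j)) ((D.pullback ι).φ i j hij)
    (by rw [MonoidHom.comp_assoc, (D.pullback ι).ψ_comp]) n (point _).toPair) ?_))
  exact (((𝓗.theory _ ((ξ.comp ι).comp ((D.pullback ι).ψ i))).H n).map_id _).symm

theorem stagePointMap_a {H : Type u} [Group H] (ι : H →* G) (hι : ∀ h, ι h • s = s) (i : I) :
    𝓗.stagePointMap ξ D n s ι hι i ≫ 𝓗.a _ ξ (D.ψ i) rfl n (discrete G S).toPair =
      𝓗.a _ (ξ.comp ι) ((D.pullback ι).ψ i) rfl n (point H).toPair ≫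
        𝓗.pointMap (ξ.comp ι) ξ ι rfl n (fixedPoint ι (X := discrete G S) s hι) := by
  refine (𝓗.pointMap_comp_a _ _ ξ (D.pullbackSnd ι i) (D.ψ i) (ι.comp ((D.pullback ι).ψ i))
    (D.ψ_comp_pullbackSnd ι i) _ rfl rfl n _ _ (fixedPoint _ (X := discrete G S) s
      fun g => hι ((D.pullback ι).ψ i g)) fun _ => rfl).trans
    (𝓗.a_comp_pointMap _ _ ξ ((D.pullback ι).ψ i) ι _ rfl rfl rfl rfl n _ _ _ fun _ => rfl).symm

end

end EquivariantHomologyTheory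

namespace EquivariantHomologyTheory

variable {Γ : Type v} [Group Γ] {Λ : Type w} [Ring Λ]
  (𝓗 : EquivariantHomologyTheory.{u, v, w, x} Γ Λ)
  {G : Type u} [Group G] (ξ : G →* Γ) {I : Type u} [Preorder I]
  (D : DirectedColimit I G) (n : ℤ) {S : Type u} [MulAction G S] (s : S)

/-- The orbit of a point of a `G`-set under a group `L` acting through `α : L → G`. -/
def resOrbit {L : Type u} [Group L] (α : L →* G) {S : Type u} [MulAction G S] (s : S) :
    GCWComplex L :=
  letI : MulAction L S := MulAction.compHom S α
  discrete L (MulAction.orbit L s)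

/-- The inclusion of the orbit of a point of a `G`-set under a group acting through `α`. -/
def resOrbitIncl {L : Type u} [Group L] (α : L →* G) {S : Type u} [MulAction G S] (s : S) :
    (resOrbit α s).toPair ⟶ (discrete G S).toPair.res α :=
  letI : MulAction L S := MulAction.compHom S α
  GHomologyTheory.orbitIncl L s

theorem exists_stagePointMap_eq [IsDirectedOrder I] [Nonempty I] {H : Type u} [Group H] (ι : H →* G) (hι : ∀ h, ι h • s = s)
    (hinj : Function.Injective ι) (hs : ∀ g : G, g • s = s → g ∈ ι.range) (i : I)
    (y : ((𝓗.theory (D.obj i) (ξ.comp (D.ψ i))).H n).obj (resOrbit (D.ψ i) s).toPair) :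
    ∃ z, (𝓗.stagePointMap ξ D n s ι hι i).hom z =
      (((𝓗.theory (D.obj i) (ξ.comp (D.ψ i))).H n).map (resOrbitIncl (D.ψ i) s)).hom y := by
  let : MulAction (D.obj i) S := MulAction.compHom S (D.ψ i)
  have hfix (g : (D.pullback ι).obj i) : D.pullbackSnd ι i g •
      (⟨s, MulAction.mem_orbit_self s⟩ : MulAction.orbit (D.obj i) s) =
        ⟨s, MulAction.mem_orbit_self s⟩ :=
    Subtype.ext (smul_eq_of_mem_pullback D s ι hι i g)
  have h₀ : (ξ.comp (D.ψ i)).comp (D.pullbackSnd ι i) = (ξ.comp ι).comp ((D.pullback ι).ψ i) := by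
    rw [MonoidHom.comp_assoc, D.ψ_comp_pullbackSnd, MonoidHom.comp_assoc]
  obtain ⟨z, hz⟩ := (𝓗.pointMap_bijective _ (ξ.comp (D.ψ i)) (D.pullbackSnd ι i) h₀ n
    (D.pullbackSnd_injective ι hinj i)
    (fixedPoint (D.pullbackSnd ι i) (X := discrete (D.obj i) (MulAction.orbit (D.obj i) s))
      ⟨s, MulAction.mem_orbit_self s⟩ hfix) ⟨s, MulAction.mem_orbit_self s⟩ (fun _ => rfl)
    (fun g hg => by
      rw [D.range_pullbackSnd]
      exact hs _ (congrArg Subtype.val hg))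
    (fun s' => by
      obtain ⟨_, g, rfl⟩ := s'
      exact ⟨g, rfl⟩)).2 y
  refine ⟨z, ?_⟩
  rw [← hz]
  exact congrArg (fun f => f.hom z) (𝓗.pointMap_map _ (ξ.comp (D.ψ i)) (D.pullbackSnd ι i) h₀ n
    (fixedPoint (D.pullbackSnd ι i) (X := discrete (D.obj i) (MulAction.orbit (D.obj i) s))
      ⟨s, MulAction.mem_orbit_self s⟩ hfix) (resOrbitIncl (D.ψ i) s)).symm

/-- A class supported on the `G_i`-orbit of a point that lies, over a later stage `j`, in the orbit
of `s`, is represented at stage `j` by a class supported on the `G_j`-orbit of `s`. -/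
theorem exists_systemMap_eq (i j : I) (hij : i ≤ j) (s' : S) (g : D.obj j) (hg : D.ψ j g • s = s')
    (y : ((𝓗.theory (D.obj i) (ξ.comp (D.ψ i))).H n).obj (resOrbit (D.ψ i) s').toPair) :
    ∃ z, (𝓗.systemMap ξ D n (discrete G S).toPair i j hij).hom
        ((((𝓗.theory (D.obj i) (ξ.comp (D.ψ i))).H n).map (resOrbitIncl (D.ψ i) s')).hom y) =
      (((𝓗.theory (D.obj j) (ξ.comp (D.ψ j))).H n).map (resOrbitIncl (D.ψ j) s)).hom z := by
  let q : (resOrbit (D.ψ i) s').toPair ⟶ (resOrbit (D.ψ j) s).toPair.res (D.φ i j hij) :=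
    homMk (X := resOrbit (D.ψ i) s') (Y := (resOrbit (D.ψ j) s).res (D.φ i j hij))
      (fun p => ⟨p.1, by
        obtain ⟨_, k, rfl⟩ := p
        exact ⟨D.φ i j hij k * g, by
          change D.ψ j (D.φ i j hij k * g) • s = D.ψ i k • s'
          rw [map_mul, D.ψ_φ, mul_smul, hg]⟩⟩)
      (by
        unfold resOrbit
        exact continuous_of_discreteTopology)
      (fun k p => Subtype.ext (by
        change D.ψ i k • p.1 = D.ψ j (D.φ i j hij k) • p.1
        rw [D.ψ_φ]))
  have h₁ : (ξ.comp (D.ψ j)).comp (D.φ i j hij) = ξ.comp (D.ψ i) := by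
    rw [MonoidHom.comp_assoc, D.ψ_comp]
  refine ⟨(𝓗.a _ _ _ h₁ n (resOrbit (D.ψ j) s).toPair).hom
    ((((𝓗.theory (D.obj i) (ξ.comp (D.ψ i))).H n).map q).hom y), ?_⟩
  have e₁ := 𝓗.a_naturality _ _ _ h₁ n (resOrbitIncl (D.ψ j) s)
  have e₂ : resOrbitIncl (D.ψ i) s' ≫ (discrete G S).toPair.resIdent (D.φ i j hij) (D.ψ j) (D.ψ i)
      (D.ψ_comp i j hij) = q ≫ GCWPair.resMap (D.φ i j hij) (resOrbitIncl (D.ψ j) s) :=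
    GCWPair.hom_ext _ _ fun _ => rfl
  have e₃ : ((𝓗.theory (D.obj i) (ξ.comp (D.ψ i))).H n).map (resOrbitIncl (D.ψ i) s') ≫
      𝓗.systemMap ξ D n (discrete G S).toPair i j hij =
      ((𝓗.theory (D.obj i) (ξ.comp (D.ψ i))).H n).map q ≫ 𝓗.a _ _ _ h₁ n
        (resOrbit (D.ψ j) s).toPair ≫
        ((𝓗.theory (D.obj j) (ξ.comp (D.ψ j))).H n).map (resOrbitIncl (D.ψ j) s) := by
    rw [← e₁, systemMap, ← Functor.map_comp_assoc, ← Functor.map_comp_assoc, e₂]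
  exact congrArg (fun f => f.hom y) e₃

open Classical in
/-- For a strongly continuous theory, `t_n^G` is an isomorphism on transitive `G`-sets `G/H`. Both
sides are compared with the directed system of the preimages of `H` in the groups `G_i`: a class
in the `G_i`-homology of `ψ_i^*(G/H)` is supported on finitely many `G_i`-orbits, which over a later
stage all become the orbit of the base point. -/
theorem StronglyContinuous.t_transitive_bijective (h𝓗 : 𝓗.StronglyContinuous)
    [IsDirectedOrder I] [Nonempty I] [MulAction.IsPretransitive G S] (s : S) :
    Function.Bijective (𝓗.t ξ D n (discrete G S).toPair) := by
  let ι := (MulAction.stabilizer G s).subtype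
  have hι (h) : ι h • s = s := h.2
  have hs (g : G) (hg : g • s = s) : g ∈ ι.range := ⟨⟨g, hg⟩, rfl⟩
  have hinj : Function.Injective ι := Subtype.val_injective
  have hb := 𝓗.pointMap_bijective (ξ.comp ι) ξ ι rfl n hinj
    (fixedPoint ι (X := discrete G S) s hι) s (fun _ => rfl) hs
    (fun s' => MulAction.exists_smul_eq G s s')
  have ht := h𝓗 _ (ξ.comp ι) I (D.pullback ι) n
  -- the class of a point at stage `i`, seen in the colimit
  have hA (i) (z) : 𝓗.t ξ D n (discrete G S).toPair
      (𝓗.colimOf ξ D n _ i ((𝓗.stagePointMap ξ D n s ι hι i).hom z)) =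
        (𝓗.pointMap (ξ.comp ι) ξ ι rfl n (fixedPoint ι (X := discrete G S) s hι)).hom
          (𝓗.t (ξ.comp ι) (D.pullback ι) n (point _).toPair
            (𝓗.colimOf (ξ.comp ι) (D.pullback ι) n _ i z)) := by
    refine (𝓗.t_of ξ D n _ i _).trans (.trans ?_
      (congrArg _ (𝓗.t_of (ξ.comp ι) (D.pullback ι) n (point _).toPair i z).symm))
    exact congrArg (fun f => f.hom z) (𝓗.stagePointMap_a ξ D n s ι hι i)
  -- transition maps applied to classes of points
  have hS (i j) (hij : i ≤ j) (z) : (𝓗.systemMap ξ D n (discrete G S).toPair i j hij).hom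
      ((𝓗.stagePointMap ξ D n s ι hι i).hom z) = (𝓗.stagePointMap ξ D n s ι hι j).hom
        ((𝓗.systemMap (ξ.comp ι) (D.pullback ι) n (point _).toPair i j hij).hom z) :=
    congrArg (fun f => f.hom z) (𝓗.stagePointMap_systemMap ξ D n s ι hι i j hij)
  have key (i) (y : ((𝓗.theory (D.obj i) (ξ.comp (D.ψ i))).H n).obj
      ((discrete G S).toPair.res (D.ψ i))) : ∃ j, ∃ hij : i ≤ j, ∃ z,
        (𝓗.systemMap ξ D n (discrete G S).toPair i j hij).hom y =
          (𝓗.stagePointMap ξ D n s ι hι j).hom z := by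
    let : MulAction (D.obj i) S := MulAction.compHom S (D.ψ i)
    refine (𝓗.theory (D.obj i) (ξ.comp (D.ψ i))).discrete_induction (S := S) n
      (C := fun y => ∃ j, ∃ hij : i ≤ j, ∃ z,
        (𝓗.systemMap ξ D n (discrete G S).toPair i j hij).hom y =
          (𝓗.stagePointMap ξ D n s ι hι j).hom z) ?_ ?_ ?_ y
    · exact ⟨i, le_rfl, 0, (map_zero _).trans (map_zero _).symm⟩
    · rintro y y' ⟨j, hij, z, hz⟩ ⟨j', hij', z', hz'⟩
      obtain ⟨k, hjk, hjk'⟩ := exists_ge_ge j j'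
      have hc (y) (j) (hij : i ≤ j) (hjk : j ≤ k) :
          (𝓗.systemMap ξ D n (discrete G S).toPair i k (hij.trans hjk)).hom y =
            (𝓗.systemMap ξ D n (discrete G S).toPair j k hjk).hom
              ((𝓗.systemMap ξ D n (discrete G S).toPair i j hij).hom y) :=
        congrArg (fun f => f.hom y) (𝓗.systemMap_comp ξ D n _ i j k hij hjk).symm
      let w := (𝓗.systemMap (ξ.comp ι) (D.pullback ι) n (point _).toPair j k hjk).hom z
      let w' := (𝓗.systemMap (ξ.comp ι) (D.pullback ι) n (point _).toPair j' k hjk').hom z'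
      refine ⟨k, hij.trans hjk, w + w', (map_add _ _ _).trans
        ((congrArg₂ (· + ·) ?_ ?_).trans (map_add (𝓗.stagePointMap ξ D n s ι hι k).hom w w').symm)⟩
      · exact (hc y j hij hjk).trans ((congrArg _ hz).trans (hS j k hjk z))
      · exact (hc y' j' hij' hjk').trans ((congrArg _ hz').trans (hS j' k hjk' z'))
    · intro s' y
      obtain ⟨g, hg⟩ := MulAction.exists_smul_eq G s s'
      obtain ⟨j₀, g₀, rfl⟩ := D.exists_ψ_eq g
      obtain ⟨j, hij, hj⟩ := exists_ge_ge i j₀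
      obtain ⟨z, hz⟩ := 𝓗.exists_systemMap_eq ξ D n s i j hij s' (D.φ j₀ j hj g₀)
        ((congrArg (fun g : G => g • s) (D.ψ_φ hj g₀)).trans hg) y
      obtain ⟨z', hz'⟩ := 𝓗.exists_stagePointMap_eq ξ D n s ι hι hinj hs j z
      exact ⟨j, hij, z', hz.trans hz'.symm⟩
  constructor
  · rw [injective_iff_map_eq_zero]
    intro y hy
    obtain ⟨i, y, rfl⟩ := Module.DirectLimit.exists_of y
    obtain ⟨j, hij, z, hz⟩ := key i y
    rw [← Module.DirectLimit.of_f (hij := hij), hz] at hy ⊢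
    have h₁ := ht.1 ((hb.1 ((hA j z).symm.trans (hy.trans (map_zero _).symm))).trans
      (map_zero _).symm)
    obtain ⟨k, hjk, hk⟩ := Module.DirectLimit.of.zero_exact h₁
    rw [← Module.DirectLimit.of_f (hij := hjk), hS, hk]
    exact (congrArg _ (map_zero _)).trans (map_zero _)
  · intro y
    obtain ⟨y, rfl⟩ := hb.2 y
    obtain ⟨z, rfl⟩ := ht.2 y
    obtain ⟨i, z, rfl⟩ := Module.DirectLimit.exists_of z
    exact ⟨_, hA i z⟩

end EquivariantHomologyTheory

/-! ### The topology of equivariant CW-complexes -/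

namespace GCWStructure

variable {G : Type u} [Group G] {X : Type u} [TopologicalSpace X] [MulAction G X]
  (S : GCWStructure G X)

theorem norm_le_one {n : ℕ} (p : Disk n) : ‖p.1‖ ≤ 1 := mem_closedBall_zero_iff.1 p.2

/-- Every point lies in a unique open cell; this is existence. -/
theorem exists_charMap_eq (y : X) : ∃ n, ∃ e : S.cell n, ∃ p : Disk n, ‖p.1‖ < 1 ∧
    S.charMap n e p = y := by
  classical
  have h := S.exists_mem_skel y
  have h₀ : Nat.find h ≠ 0 := fun h₀ => by
    have := Nat.find_spec h
    rw [h₀, S.skel_zero] at this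
    exact this
  obtain ⟨n, hn⟩ := Nat.exists_eq_succ_of_ne_zero h₀
  have h₁ := Nat.find_spec h
  rw [hn] at h₁
  obtain ⟨e, p, hp, he⟩ := S.exists_charMap n y h₁ (Nat.find_min h (by omega))
  exact ⟨n, e, p, hp, he⟩

theorem isClosed_of_subset_skel {k : ℕ} {C : Set X} (hC : C ⊆ S.skel k)
    (h : ∀ n < k, ∀ e, IsClosed (S.charMap n e ⁻¹' C)) : IsClosed C := by
  induction k generalizing C with
  | zero =>
    rw [S.skel_zero] at hC
    rw [Set.subset_empty_iff.1 hC]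
    exact isClosed_empty
  | succ k ih =>
    refine S.isClosed_of_charMap k C hC (ih Set.inter_subset_right fun n hn e => ?_)
      (h k (Nat.lt_succ_self k))
    rw [Set.preimage_inter]
    exact (h n (by omega) e).inter ((S.isClosed_skel k).preimage (S.continuous_charMap n e))

/-- A `G`-CW-complex carries the weak topology with respect to its closed cells. -/
theorem isClosed_of_cells {C : Set X} (h : ∀ n e, IsClosed (S.charMap n e ⁻¹' C)) :
    IsClosed C := by
  refine S.isClosed_of_skel C fun k => S.isClosed_of_subset_skel Set.inter_subset_right
    fun n _ e => ?_
  rw [Set.preimage_inter]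
  exact (h n e).inter ((S.isClosed_skel k).preimage (S.continuous_charMap n e))

theorem continuous_of_cells {Z : Type*} [TopologicalSpace Z] {f : X → Z}
    (h : ∀ n e, Continuous fun p => f (S.charMap n e p)) : Continuous f :=
  continuous_iff_isClosed.2 fun _ hC => S.isClosed_of_cells fun n e => hC.preimage (h n e)

theorem isQuotientMap_cells : Topology.IsQuotientMap
    (fun q : Σ n, Σ _ : S.cell n, Disk n => S.charMap q.1 q.2.1 q.2.2) := by
  let _ (n : ℕ) : TopologicalSpace (S.cell n) := ⊥
  refine Topology.isQuotientMap_iff_isClosed.2 ⟨fun y => ?_, fun C => ⟨fun hC => ?_, fun hC => ?_⟩⟩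
  · obtain ⟨n, e, p, _, rfl⟩ := S.exists_charMap_eq y
    exact ⟨⟨n, e, p⟩, rfl⟩
  · refine isClosed_sigma_iff.2 fun n => isClosed_sigma_iff.2 fun e => ?_
    exact hC.preimage (S.continuous_charMap n e)
  · exact S.isClosed_of_cells fun n e => isClosed_sigma_iff.1 (isClosed_sigma_iff.1 hC n) e

/-- For a locally compact space `J`, also `X × J` carries the weak topology with respect to the
products of the closed cells with `J`. -/
theorem continuous_prod_of_cells {J Z : Type*} [TopologicalSpace J] [LocallyCompactSpace J]
    [TopologicalSpace Z] {f : X × J → Z}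
    (h : ∀ n e, Continuous fun q : Disk n × J => f (S.charMap n e q.1, q.2)) : Continuous f := by
  refine S.isQuotientMap_cells.continuous_lift_prod_left ?_
  rw [← Homeomorph.sigmaProdDistrib.symm.comp_continuous_iff']
  refine continuous_sigma fun n => ?_
  rw [← Homeomorph.sigmaProdDistrib.symm.comp_continuous_iff']
  exact continuous_sigma fun e => h n e

theorem isClosed_prod_of_cells {J : Type*} [TopologicalSpace J] [LocallyCompactSpace J]
    {C : Set (X × J)}
    (h : ∀ n e, IsClosed ((fun q : Disk n × J => (S.charMap n e q.1, q.2)) ⁻¹' C)) :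
    IsClosed C := by
  rw [← isOpen_compl_iff, isOpen_iff_continuous_mem]
  exact S.continuous_prod_of_cells fun n e =>
    continuous_Prop.2 (h n e).isOpen_compl

theorem lt_of_charMap_mem_skel {k n : ℕ} {e : S.cell n} {p : Disk n} (hp : ‖p.1‖ < 1)
    (h : S.charMap n e p ∈ S.skel k) : n < k := by
  by_contra hn
  exact S.charMap_interior n e p hp (S.skel_mono (not_lt.1 hn) h)

theorem isSubcomplex_skel (k : ℕ) :
    S.IsSubcomplex { carrier := S.skel k, smul_mem' := fun g p hp => S.smul_mem_skel k g p hp } :=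
  ⟨S.isClosed_skel k, fun _ _ _ q hp h =>
    S.skel_mono (S.lt_of_charMap_mem_skel hp h) (S.charMap_mem _ _ q)⟩

theorem isClosed_prod_of_subset_skel {J : Type*} [TopologicalSpace J] [LocallyCompactSpace J]
    {k : ℕ} {C : Set (X × J)} (hC : ∀ q ∈ C, q.1 ∈ S.skel k)
    (h : ∀ n < k, ∀ e, IsClosed ((fun q : Disk n × J => (S.charMap n e q.1, q.2)) ⁻¹' C)) :
    IsClosed C := by
  have hcl := ((S.isSubcomplex_skel k).isClosed.isClosedEmbedding_subtypeVal.prodMap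
    (Topology.IsClosedEmbedding.id (X := J))).isClosedMap _
    ((S.restrictSub _ (S.isSubcomplex_skel k)).isClosed_prod_of_cells
      (C := (fun q => (q.1.1, q.2)) ⁻¹' C) fun n e => ?_)
  · convert hcl using 1
    ext q
    exact ⟨fun hq => ⟨(⟨q.1, hC q hq⟩, q.2), hq, rfl⟩, by rintro ⟨q, hq, rfl⟩; exact hq⟩
  · exact h n (S.lt_of_charMap_mem_skel (p := ⟨0, by simp⟩) (by simp) (e.2 _)) e.1

end GCWStructure

/-- The ball `D^{n+1}` is homeomorphic to the cylinder `D^n × [0, 1]`. -/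
theorem exists_disk_homeomorph (n : ℕ) : ∃ κ : Disk (n + 1) ≃ₜ Disk n × unitInterval,
    ∀ p, ‖p.1‖ = 1 ↔ ‖(κ p).1.1‖ = 1 ∨ (κ p).2 = 0 ∨ (κ p).2 = 1 := by
  let V := EuclideanSpace ℝ (Fin n) × ℝ
  have hdim : Module.finrank ℝ (EuclideanSpace ℝ (Fin (n + 1))) = Module.finrank ℝ V := by
    simp [V]
  let L : EuclideanSpace ℝ (Fin (n + 1)) ≃L[ℝ] V := ContinuousLinearEquiv.ofFinrankEq hdim
  have hi : interior (L ⁻¹' Metric.closedBall (0 : V) 1) = L ⁻¹' Metric.ball (0 : V) 1 := by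
    rw [← interior_closedBall (0 : V) one_ne_zero]
    exact (L.toHomeomorph.preimage_interior _).symm
  have hcl : IsClosed (L ⁻¹' Metric.closedBall (0 : V) 1) :=
    Metric.isClosed_closedBall.preimage L.continuous
  obtain ⟨h, h₁, h₂, h₃⟩ := exists_homeomorph_image_interior_closure_frontier_eq_unitBall
    (s := L ⁻¹' Metric.closedBall (0 : V) 1)
    ((convex_closedBall (0 : V) 1).linear_preimage L.toLinearEquiv.toLinearMap)
    ⟨0, by rw [hi]; simp⟩
    (by
      have := (L.symm.lipschitz).isBounded_image (Metric.isBounded_closedBall (x := (0 : V)) (r := 1))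
      rwa [L.image_symm_eq_preimage] at this)
  rw [hcl.closure_eq] at h₂
  rw [hi] at h₁
  have hmem (p : EuclideanSpace ℝ (Fin (n + 1))) : ‖L (h.symm p)‖ ≤ 1 ↔ ‖p‖ ≤ 1 := by
    have : p ∈ h '' (L ⁻¹' Metric.closedBall (0 : V) 1) ↔ p ∈ Metric.closedBall 0 1 := by rw [h₂]
    rw [← h.coe_toEquiv, Equiv.image_eq_preimage_symm] at this
    exact (mem_closedBall_zero_iff (E := V)).symm.trans (this.trans mem_closedBall_zero_iff)
  have hmem' (p : EuclideanSpace ℝ (Fin (n + 1))) : ‖L (h.symm p)‖ < 1 ↔ ‖p‖ < 1 := by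
    have : p ∈ h '' (L ⁻¹' Metric.ball (0 : V) 1) ↔ p ∈ Metric.ball 0 1 := by rw [h₁]
    rw [← h.coe_toEquiv, Equiv.image_eq_preimage_symm] at this
    exact (mem_ball_zero_iff (E := V)).symm.trans (this.trans mem_ball_zero_iff)
  have hV (q : V) : ‖q‖ ≤ 1 ↔ ‖q.1‖ ≤ 1 ∧ |q.2| ≤ 1 := by
    rw [Prod.norm_def, max_le_iff, Real.norm_eq_abs]
  have hV' (q : V) : ‖q‖ < 1 ↔ ‖q.1‖ < 1 ∧ |q.2| < 1 := by
    rw [Prod.norm_def, max_lt_iff, Real.norm_eq_abs]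
  let κ : Disk (n + 1) ≃ₜ Disk n × unitInterval :=
    { toFun := fun p =>
        have hp := (hV _).1 ((hmem p.1).2 (mem_closedBall_zero_iff.1 p.2))
        (⟨(L (h.symm p.1)).1, mem_closedBall_zero_iff.2 hp.1⟩,
          ⟨((L (h.symm p.1)).2 + 1) / 2, by
            have := abs_le.1 hp.2
            constructor <;> linarith⟩)
      invFun := fun q => ⟨h (L.symm (q.1.1, 2 * q.2.1 - 1)), by
        rw [mem_closedBall_zero_iff, ← hmem, h.symm_apply_apply, L.apply_symm_apply, hV]
        refine ⟨mem_closedBall_zero_iff.1 q.1.2, abs_le.2 ⟨?_, ?_⟩⟩ <;>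
          have := q.2.2.1 <;> have := q.2.2.2 <;> dsimp only <;> linarith⟩
      left_inv := fun p => by
        refine Subtype.ext ?_
        have : (((L (h.symm p.1)).1, 2 * (((L (h.symm p.1)).2 + 1) / 2) - 1) : V) =
          L (h.symm p.1) := Prod.ext rfl (by dsimp only; ring)
        dsimp only
        rw [this, L.symm_apply_apply, h.apply_symm_apply]
      right_inv := fun q => by
        refine Prod.ext (Subtype.ext ?_) (Subtype.ext ?_)
        · simp
        · simp
      continuous_toFun := by
        have hc : Continuous fun p : Disk (n + 1) => L (h.symm p.1) := by fun_prop
        exact ((continuous_fst.comp hc).subtype_mk _).prodMk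
          ((((continuous_snd.comp hc).add continuous_const).div_const 2).subtype_mk _)
      continuous_invFun := by fun_prop }
  refine ⟨κ, fun p => ?_⟩
  have hp : ‖p.1‖ ≤ 1 := mem_closedBall_zero_iff.1 p.2
  have hq := (hV _).1 ((hmem p.1).2 hp)
  have e1 : ((κ p).2 = 0 ∨ (κ p).2 = 1) ↔ |(L (h.symm p.1)).2| = 1 := by
    rw [abs_eq zero_le_one, Subtype.ext_iff, Subtype.ext_iff, or_comm]
    change ((L (h.symm p.1)).2 + 1) / 2 = 1 ∨ ((L (h.symm p.1)).2 + 1) / 2 = 0 ↔ _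
    constructor <;> rintro (h | h)
    · left; linarith
    · right; linarith
    · left; linarith
    · right; linarith
  rw [e1]
  have e2 : ‖(κ p).1.1‖ = ‖(L (h.symm p.1)).1‖ := rfl
  rw [e2]
  have := (hmem' p.1).symm.trans (hV' _)
  have hpn : ‖p.1‖ = 1 ↔ ¬ ‖p.1‖ < 1 := ⟨fun h => by linarith, fun h => le_antisymm hp (not_lt.1 h)⟩
  rw [hpn, this, not_and_or, not_lt, not_lt]
  exact or_congr ⟨fun h => le_antisymm hq.1 h, fun h => h.ge⟩
    ⟨fun h => le_antisymm hq.2 h, fun h => h.ge⟩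

/-! ### Homotopy coequalizers of cellular maps -/

/-- A cellular `G`-map of `G`-CW-complexes. -/
structure GCWComplex.CellularMap {G : Type u} [Group G] (A B : GCWComplex G) where
  toFun : A.carrier → B.carrier
  continuous_toFun : Continuous toFun
  map_smul : ∀ (k : G) a, toFun (k • a) = k • toFun a
  cellular : ∀ n, ∀ a ∈ A.cw.skel n, toFun a ∈ B.cw.skel n

/-- The points of the homotopy coequalizer of `f, g : A → B`, that is, of the space obtained from
`B ⊔ A × [0, 1]` by gluing `(a, 0)` to `f a` and `(a, 1)` to `g a`. -/
def Hocoeq {G : Type u} [Group G] {A B : GCWComplex G} (_f _g : CellularMap A B) : Type u :=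
  B.carrier ⊕ A.carrier × Set.Ioo (0 : ℝ) 1

namespace Hocoeq

variable {G : Type u} [Group G] {A B : GCWComplex G} (f g : CellularMap A B)

/-- The inclusion of `B`. -/
def base (b : B.carrier) : Hocoeq f g := Sum.inl b

open Classical in
/-- The canonical map from the cylinder `A × [0, 1]`. -/
noncomputable def cyl (a : A.carrier) (t : unitInterval) : Hocoeq f g :=
  if h₀ : t = 0 then base f g (f.toFun a) else
    if h₁ : t = 1 then base f g (g.toFun a) else
      Sum.inr (a, ⟨t, unitInterval.pos_iff_ne_zero.2 h₀, unitInterval.lt_one_iff_ne_one.2 h₁⟩)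

theorem cyl_zero (a : A.carrier) : cyl f g a 0 = base f g (f.toFun a) := dif_pos rfl

theorem cyl_one (a : A.carrier) : cyl f g a 1 = base f g (g.toFun a) := by
  simp [cyl]

theorem cyl_of_ne {t : unitInterval} (h₀ : t ≠ 0) (h₁ : t ≠ 1) (a : A.carrier) :
    cyl f g a t = Sum.inr (a, ⟨t, unitInterval.pos_iff_ne_zero.2 h₀,
      unitInterval.lt_one_iff_ne_one.2 h₁⟩) := by
  exact (dif_neg h₀).trans (dif_neg h₁)

variable {f g}

theorem cases (q : Hocoeq f g) :
    (∃ b, q = base f g b) ∨ ∃ a, ∃ t : unitInterval, t ≠ 0 ∧ t ≠ 1 ∧ q = cyl f g a t := by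
  rcases q with b | ⟨a, t⟩
  · exact .inl ⟨b, rfl⟩
  · have h₀ : (⟨t.1, t.2.1.le, t.2.2.le⟩ : unitInterval) ≠ 0 :=
      unitInterval.pos_iff_ne_zero.1 t.2.1
    have h₁ : (⟨t.1, t.2.1.le, t.2.2.le⟩ : unitInterval) ≠ 1 :=
      unitInterval.lt_one_iff_ne_one.1 t.2.2
    exact .inr ⟨a, ⟨t.1, t.2.1.le, t.2.2.le⟩, h₀, h₁, (cyl_of_ne f g h₀ h₁ a).symm⟩

theorem base_injective : Function.Injective (base f g) := Sum.inl_injective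

theorem cyl_ne_base {t : unitInterval} (h₀ : t ≠ 0) (h₁ : t ≠ 1) (a : A.carrier) (b : B.carrier) :
    cyl f g a t ≠ base f g b := by
  rw [cyl_of_ne f g h₀ h₁]
  exact Sum.inr_ne_inl

theorem cyl_inj {t t' : unitInterval} (h₀ : t ≠ 0) (h₁ : t ≠ 1) (h₀' : t' ≠ 0) (h₁' : t' ≠ 1)
    {a a' : A.carrier} (h : cyl f g a t = cyl f g a' t') : a = a' ∧ t = t' := by
  rw [cyl_of_ne f g h₀ h₁, cyl_of_ne f g h₀' h₁'] at h
  have h := Sum.inr_injective h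
  exact ⟨congrArg Prod.fst h, Subtype.ext (congrArg (fun q => q.2.1) h)⟩

noncomputable instance : TopologicalSpace (Hocoeq f g) :=
  .coinduced (Sum.elim (base f g) fun q : A.carrier × unitInterval => cyl f g q.1 q.2) inferInstance

variable (f g)

theorem isQuotientMap : Topology.IsQuotientMap
    (Sum.elim (base f g) fun q : A.carrier × unitInterval => cyl f g q.1 q.2) where
  eq_coinduced := rfl
  surjective q := by
    rcases q.cases with ⟨b, rfl⟩ | ⟨a, t, -, -, rfl⟩
    · exact ⟨.inl b, rfl⟩
    · exact ⟨.inr (a, t), rfl⟩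

theorem continuous_base : Continuous (base f g) :=
  (isQuotientMap f g).continuous.comp continuous_inl

theorem continuous_cyl : Continuous fun q : A.carrier × unitInterval => cyl f g q.1 q.2 :=
  (isQuotientMap f g).continuous.comp continuous_inr

variable {f g}

theorem isClosed_iff {C : Set (Hocoeq f g)} : IsClosed C ↔ IsClosed (base f g ⁻¹' C) ∧
    IsClosed ((fun q : A.carrier × unitInterval => cyl f g q.1 q.2) ⁻¹' C) := by
  rw [← (isQuotientMap f g).isClosed_preimage, isClosed_sum_iff]
  rfl

theorem continuous_iff {Z : Type*} [TopologicalSpace Z] {F : Hocoeq f g → Z} :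
    Continuous F ↔ Continuous (fun b => F (base f g b)) ∧
      Continuous fun q : A.carrier × unitInterval => F (cyl f g q.1 q.2) := by
  rw [(isQuotientMap f g).continuous_iff, continuous_sum_dom]
  rfl

theorem continuous_prod_iff {J Z : Type*} [TopologicalSpace J] [LocallyCompactSpace J]
    [TopologicalSpace Z] {F : J × Hocoeq f g → Z} :
    Continuous F ↔ Continuous (fun q : J × B.carrier => F (q.1, base f g q.2)) ∧
      Continuous fun q : J × A.carrier × unitInterval => F (q.1, cyl f g q.2.1 q.2.2) := by
  refine ⟨fun h => ⟨h.comp (continuous_fst.prodMk ((continuous_base f g).comp continuous_snd)),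
    h.comp (continuous_fst.prodMk ((continuous_cyl f g).comp continuous_snd))⟩, fun h => ?_⟩
  refine (isQuotientMap f g).continuous_lift_prod_right ?_
  rw [← Homeomorph.prodSumDistrib.symm.comp_continuous_iff', continuous_sum_dom]
  exact h

/-- The map out of a homotopy coequalizer given by `u : B → Z` and a homotopy `v` from `u ∘ f`
to `u ∘ g`. -/
def lift {Z : Type*} (u : B.carrier → Z) (v : A.carrier → unitInterval → Z) : Hocoeq f g → Z :=
  Sum.elim u fun q => v q.1 ⟨q.2.1, q.2.2.1.le, q.2.2.2.le⟩

theorem lift_cyl {Z : Type*} {u : B.carrier → Z} {v : A.carrier → unitInterval → Z}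
    (h₀ : ∀ a, v a 0 = u (f.toFun a)) (h₁ : ∀ a, v a 1 = u (g.toFun a)) (a : A.carrier)
    (t : unitInterval) : lift u v (cyl f g a t) = v a t := by
  by_cases ht₀ : t = 0
  · rw [ht₀, cyl_zero, h₀]; rfl
  by_cases ht₁ : t = 1
  · rw [ht₁, cyl_one, h₁]; rfl
  rw [cyl_of_ne f g ht₀ ht₁]
  rfl

theorem continuous_lift {Z : Type*} [TopologicalSpace Z] {u : B.carrier → Z}
    {v : A.carrier → unitInterval → Z} (h₀ : ∀ a, v a 0 = u (f.toFun a))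
    (h₁ : ∀ a, v a 1 = u (g.toFun a)) (hu : Continuous u)
    (hv : Continuous fun q : A.carrier × unitInterval => v q.1 q.2) :
    Continuous (lift u v : Hocoeq f g → Z) := by
  rw [continuous_iff]
  refine ⟨hu, ?_⟩
  simp_rw [lift_cyl h₀ h₁]
  exact hv

instance : MulAction G (Hocoeq f g) where
  smul k := Sum.map (fun b => k • b) (fun q => (k • q.1, q.2))
  one_smul q := by
    rcases q with b | ⟨a, t⟩
    · exact congrArg Sum.inl (one_smul G b)
    · exact congrArg (fun a => Sum.inr (a, t)) (one_smul G a)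
  mul_smul k l q := by
    rcases q with b | ⟨a, t⟩
    · exact congrArg Sum.inl (mul_smul k l b)
    · exact congrArg (fun a => Sum.inr (a, t)) (mul_smul k l a)

theorem smul_base (k : G) (b : B.carrier) : k • base f g b = base f g (k • b) := rfl

theorem smul_cyl (k : G) (a : A.carrier) (t : unitInterval) :
    k • cyl f g a t = cyl f g (k • a) t := by
  by_cases h₀ : t = 0
  · rw [h₀, cyl_zero, cyl_zero, smul_base]
    exact congrArg _ (f.map_smul k a).symm
  by_cases h₁ : t = 1
  · rw [h₁, cyl_one, cyl_one, smul_base]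
    exact congrArg _ (g.map_smul k a).symm
  rw [cyl_of_ne f g h₀ h₁, cyl_of_ne f g h₀ h₁]
  rfl

instance : ContinuousConstSMul G (Hocoeq f g) := ⟨fun k => by
  rw [continuous_iff]
  simp_rw [smul_base, smul_cyl]
  exact ⟨(continuous_base f g).comp (continuous_const_smul k), (continuous_cyl f g).comp
    (((continuous_const_smul k).comp continuous_fst).prodMk continuous_snd)⟩⟩

theorem lift_smul {Z : Type*} [SMul G Z] {u : B.carrier → Z} {v : A.carrier → unitInterval → Z}
    (hu : ∀ (k : G) b, u (k • b) = k • u b) (hv : ∀ (k : G) a t, v (k • a) t = k • v a t)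
    (k : G) (q : Hocoeq f g) : lift u v (k • q) = k • lift u v q := by
  rcases q with b | ⟨a, t⟩
  · exact hu k b
  · exact hv k a _

/-- The cells of the homotopy coequalizer which come from `A × [0, 1]`. -/
def shiftCell (A : GCWComplex G) : ℕ → Type u
  | 0 => PEmpty
  | n + 1 => A.cw.cell n

instance (A : GCWComplex G) : ∀ n, MulAction G (shiftCell A n)
  | 0 => { smul := fun _ e => e.elim, one_smul := fun e => e.elim, mul_smul := fun _ _ e => e.elim }
  | n + 1 => A.cw.cellAction n

/-- A homeomorphism `D^{n+1} → D^n × [0, 1]`. -/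
noncomputable def diskHomeomorph (n : ℕ) : Disk (n + 1) ≃ₜ Disk n × unitInterval :=
  (exists_disk_homeomorph n).choose

theorem diskHomeomorph_boundary {n : ℕ} (p : Disk (n + 1)) : ‖p.1‖ = 1 ↔
    ‖(diskHomeomorph n p).1.1‖ = 1 ∨ (diskHomeomorph n p).2 = 0 ∨ (diskHomeomorph n p).2 = 1 :=
  (exists_disk_homeomorph n).choose_spec p

theorem diskHomeomorph_interior {n : ℕ} (p : Disk (n + 1)) : ‖p.1‖ < 1 ↔
    ‖(diskHomeomorph n p).1.1‖ < 1 ∧ (diskHomeomorph n p).2 ≠ 0 ∧ (diskHomeomorph n p).2 ≠ 1 := by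
  have h (m : ℕ) (p : Disk m) : ‖p.1‖ < 1 ↔ ¬ ‖p.1‖ = 1 :=
    ⟨fun h => h.ne, fun h => lt_of_le_of_ne (GCWStructure.norm_le_one p) h⟩
  rw [h, h, diskHomeomorph_boundary, not_or, not_or]

variable (f g) in
/-- The characteristic maps of the cells which come from `A × [0, 1]`. -/
noncomputable def shiftCharMap : ∀ n, shiftCell A n → Disk n → Hocoeq f g
  | 0, e, _ => e.elim
  | n + 1, e, p =>
    cyl f g (A.cw.charMap n e (diskHomeomorph n p).1) (diskHomeomorph n p).2

end Hocoeq

namespace Hocoeq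

variable {G : Type u} [Group G] {A B : GCWComplex G} (f g : CellularMap A B)

/-- The skeleta of the homotopy coequalizer. -/
def skel (n : ℕ) : Set (Hocoeq f g) :=
  {q | Sum.elim (· ∈ B.cw.skel n) (fun q => q.1 ∈ A.cw.skel (n - 1)) q}

theorem skel_mono : Monotone (skel f g) := fun m n h q hq => by
  rcases q with b | ⟨a, t⟩
  · exact B.cw.skel_mono h hq
  · exact A.cw.skel_mono (Nat.sub_le_sub_right h 1) hq

variable {f g}

theorem cyl_mem_skel (n : ℕ) {a : A.carrier} (ha : a ∈ A.cw.skel n) (t : unitInterval) :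
    cyl f g a t ∈ skel f g (n + 1) := by
  by_cases h₀ : t = 0
  · rw [h₀, cyl_zero]
    exact B.cw.skel_mono n.le_succ (f.cellular n a ha)
  by_cases h₁ : t = 1
  · rw [h₁, cyl_one]
    exact B.cw.skel_mono n.le_succ (g.cellular n a ha)
  rw [cyl_of_ne f g h₀ h₁]
  exact ha

theorem continuous_shiftCharMap : ∀ n (e : shiftCell A n), Continuous (shiftCharMap f g n e)
  | 0, e => e.elim
  | n + 1, e => (continuous_cyl f g).comp
      (((A.cw.continuous_charMap n e).prodMap continuous_id).comp (diskHomeomorph n).continuous)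

theorem shiftCharMap_smul : ∀ n (k : G) (e : shiftCell A n) (p : Disk n),
    shiftCharMap f g n (k • e) p = k • shiftCharMap f g n e p
  | 0, _, e, _ => e.elim
  | n + 1, k, e, _ => (congrArg (fun a => cyl f g a _) (A.cw.charMap_smul n k e _)).trans
      (smul_cyl k _ _).symm

end Hocoeq

open Hocoeq in
/-- The homotopy coequalizer of two cellular maps `f, g : A → B` as a `G`-CW-complex. Its cells are
those of `B`, and an `(n + 1)`-cell for each `n`-cell of `A`. -/
noncomputable def GCWComplex.hocoeq {G : Type u} [Group G] {A B : GCWComplex G}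
    (f g : CellularMap A B) : GCWComplex G where
  carrier := Hocoeq f g
  cw :=
    { skel := skel f g
      skel_zero := by
        ext q
        rcases q with b | ⟨a, t⟩
        · exact iff_of_eq (congrArg (b ∈ ·) B.cw.skel_zero)
        · exact iff_of_eq (congrArg (a ∈ ·) A.cw.skel_zero)
      skel_mono := skel_mono f g
      exists_mem_skel := fun q => by
        rcases q with b | ⟨a, t⟩
        · exact B.cw.exists_mem_skel b
        · obtain ⟨n, hn⟩ := A.cw.exists_mem_skel a
          exact ⟨n + 1, hn⟩
      smul_mem_skel := fun n k q hq => by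
        rcases q with b | ⟨a, t⟩
        · exact B.cw.smul_mem_skel n k b hq
        · exact A.cw.smul_mem_skel _ k a hq
      isClosed_skel := fun n => isClosed_iff.2 ⟨B.cw.isClosed_skel n, by
        have : (fun q : A.carrier × unitInterval => cyl f g q.1 q.2) ⁻¹'
            skel f g n =
            Prod.fst ⁻¹' A.cw.skel (n - 1) ∪ (Prod.snd ⁻¹' {0} ∩
              (fun q => f.toFun q.1) ⁻¹' B.cw.skel n) ∪ (Prod.snd ⁻¹' {1} ∩
              (fun q => g.toFun q.1) ⁻¹' B.cw.skel n) := by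
          ext ⟨a, t⟩
          have hf := fun h => B.cw.skel_mono (n.sub_le 1) (f.cellular (n - 1) a h)
          have hg := fun h => B.cw.skel_mono (n.sub_le 1) (g.cellular (n - 1) a h)
          by_cases h₀ : t = 0
          · subst h₀
            have e := cyl_zero f g a
            simp [e, base, skel]
            tauto
          by_cases h₁ : t = 1
          · subst h₁
            have e := cyl_one f g a
            simp [e, base, skel]
            tauto
          · simp only [cyl_of_ne f g h₀ h₁, h₀, h₁, Set.mem_preimage, Set.mem_union, Set.mem_inter_iff,
              Set.mem_singleton_iff, false_and, or_false]
            rfl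
        rw [this]
        exact (((A.cw.isClosed_skel _).preimage continuous_fst).union
          ((isClosed_singleton.preimage continuous_snd).inter ((B.cw.isClosed_skel n).preimage
            (f.continuous_toFun.comp continuous_fst)))).union
          ((isClosed_singleton.preimage continuous_snd).inter ((B.cw.isClosed_skel n).preimage
            (g.continuous_toFun.comp continuous_fst)))⟩
      isClosed_of_skel := fun C hC => by
        refine isClosed_iff.2 ⟨B.cw.isClosed_of_skel _ fun n => (isClosed_iff.1 (hC n)).1,
          A.cw.isClosed_prod_of_cells fun n e => ?_⟩
        convert (isClosed_iff.1 (hC (n + 2))).2.preimage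
          (((A.cw.continuous_charMap n e).comp continuous_fst).prodMk continuous_snd) using 1
        ext ⟨p, t⟩
        exact (and_iff_left (cyl_mem_skel (n + 1) (A.cw.charMap_mem n e p) t)).symm
      cell := fun n => B.cw.cell n ⊕ shiftCell A n
      cellAction := fun n => inferInstance
      charMap := fun n => Sum.elim (fun e p => base f g (B.cw.charMap n e p)) (shiftCharMap f g n)
      continuous_charMap := by
        rintro n (e | e)
        · exact (continuous_base f g).comp (B.cw.continuous_charMap n e)
        · exact continuous_shiftCharMap n e
      charMap_smul := by
        rintro n k (e | e) p
        · exact congrArg _ (B.cw.charMap_smul n k e p)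
        · exact shiftCharMap_smul n k e p
      charMap_mem := by
        rintro n (e | e) p
        · exact B.cw.charMap_mem n e p
        · cases n with
          | zero => exact e.elim
          | succ n => exact cyl_mem_skel _ (A.cw.charMap_mem n e _) _
      charMap_boundary := by
        rintro n (e | e) p hp
        · exact B.cw.charMap_boundary n e p hp
        · cases n with
          | zero => exact e.elim
          | succ n =>
            change cyl f g _ _ ∈ skel f g (n + 1)
            rcases (diskHomeomorph_boundary p).1 hp with h | h | h
            · exact cyl_mem_skel n (A.cw.charMap_boundary n e _ h) _
            · rw [h, cyl_zero]
              exact f.cellular _ _ (A.cw.charMap_mem n e _)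
            · rw [h, cyl_one]
              exact g.cellular _ _ (A.cw.charMap_mem n e _)
      charMap_interior := by
        rintro n (e | e) p hp
        · exact B.cw.charMap_interior n e p hp
        · cases n with
          | zero => exact e.elim
          | succ n =>
            obtain ⟨h, h₀, h₁⟩ := (diskHomeomorph_interior p).1 hp
            change cyl f g _ _ ∉ skel f g (n + 1)
            rw [cyl_of_ne f g h₀ h₁]
            exact A.cw.charMap_interior n e _ h
      charMap_injective := by
        rintro n (e | e) (e' | e') p p' hp hp' h
        · obtain ⟨rfl, h'⟩ := B.cw.charMap_injective n e e' p p' hp hp' (base_injective h)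
          exact ⟨rfl, h'⟩
        · cases n with
          | zero => exact e'.elim
          | succ n =>
            obtain ⟨-, h₀, h₁⟩ := (diskHomeomorph_interior p').1 hp'
            exact (cyl_ne_base h₀ h₁ _ _ h.symm).elim
        · cases n with
          | zero => exact e.elim
          | succ n =>
            obtain ⟨-, h₀, h₁⟩ := (diskHomeomorph_interior p).1 hp
            exact (cyl_ne_base h₀ h₁ _ _ h).elim
        · cases n with
          | zero => exact e.elim
          | succ n =>
            obtain ⟨hp, h₀, h₁⟩ := (diskHomeomorph_interior p).1 hp
            obtain ⟨hp', h₀', h₁'⟩ := (diskHomeomorph_interior p').1 hp'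
            obtain ⟨h, h'⟩ := cyl_inj h₀ h₁ h₀' h₁' h
            obtain ⟨rfl, h''⟩ := A.cw.charMap_injective n e e' _ _ hp hp' h
            exact ⟨rfl, (diskHomeomorph n).injective (Prod.ext h'' h')⟩
      exists_charMap := fun n y hy hy' => by
        rcases y.cases with ⟨b, rfl⟩ | ⟨a, t, h₀, h₁, rfl⟩
        · obtain ⟨e, p, hp, h⟩ := B.cw.exists_charMap n b hy hy'
          exact ⟨.inl e, p, hp, congrArg _ h⟩
        · change cyl f g a t ∈ skel f g _ at hy
          change cyl f g a t ∉ skel f g _ at hy'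
          rw [cyl_of_ne f g h₀ h₁] at hy hy'
          cases n with
          | zero =>
            have hy : a ∈ A.cw.skel 0 := hy
            rw [A.cw.skel_zero] at hy
            exact hy.elim
          | succ n =>
            obtain ⟨e, p, hp, h⟩ := A.cw.exists_charMap n a hy hy'
            refine ⟨.inr e, (diskHomeomorph n).symm (p, t), ?_, ?_⟩
            · rw [diskHomeomorph_interior, Homeomorph.apply_symm_apply]
              exact ⟨hp, h₀, h₁⟩
            · change cyl f g _ _ = _
              rw [Homeomorph.apply_symm_apply]
              exact congrArg (fun a => cyl f g a t) h
      isClosed_of_charMap := fun n C hC h h' => by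
        obtain ⟨hb, hc⟩ := isClosed_iff.1 h
        have hb' : IsClosed (base f g ⁻¹' C) :=
          B.cw.isClosed_of_charMap n _ (fun b hb => hC hb) hb fun e => h' (.inl e)
        -- off the ends of the cylinder, `C` only meets the part over the `n`-th skeleton of `A`
        have : (fun q : A.carrier × unitInterval => cyl f g q.1 q.2) ⁻¹' C =
            ((fun q => cyl f g q.1 q.2) ⁻¹' C ∩ Prod.fst ⁻¹' A.cw.skel n) ∪
            (Prod.snd ⁻¹' {0} ∩ (fun q => f.toFun q.1) ⁻¹' (base f g ⁻¹' C)) ∪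
            (Prod.snd ⁻¹' {1} ∩ (fun q => g.toFun q.1) ⁻¹' (base f g ⁻¹' C)) := by
          ext ⟨a, t⟩
          by_cases h₀ : t = 0
          · subst h₀
            have e := cyl_zero f g a
            simp [e]
            tauto
          by_cases h₁ : t = 1
          · subst h₁
            have e := cyl_one f g a
            simp [e]
            tauto
          · simp only [h₀, h₁, Set.mem_preimage, Set.mem_union, Set.mem_inter_iff,
              Set.mem_singleton_iff, false_and, or_false]
            refine ⟨fun h => ⟨h, ?_⟩, And.left⟩
            have h' := hC h
            rw [cyl_of_ne f g h₀ h₁] at h'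
            exact h'
        refine isClosed_iff.2 ⟨hb', this ▸ ((A.cw.isClosed_prod_of_subset_skel (fun q hq => hq.2)
          fun m hm e => ?_).union ((isClosed_singleton.preimage continuous_snd).inter (hb'.preimage
            (f.continuous_toFun.comp continuous_fst)))).union
          ((isClosed_singleton.preimage continuous_snd).inter (hb'.preimage
            (g.continuous_toFun.comp continuous_fst)))⟩
        rw [Set.preimage_inter]
        refine IsClosed.inter ?_ ((A.cw.isClosed_skel n).preimage
          ((A.cw.continuous_charMap m e).comp continuous_fst))
        rcases (Nat.succ_le_of_lt hm).lt_or_eq with hm | rfl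
        · convert hc.preimage (((A.cw.continuous_charMap m e).comp continuous_fst).prodMk
            (continuous_snd (Y := unitInterval))) using 1
          ext ⟨p, t⟩
          exact (and_iff_left (skel_mono f g hm
            (cyl_mem_skel m.succ (A.cw.charMap_mem m e p) t))).symm
        · convert (h' (.inr e)).preimage (diskHomeomorph m).symm.continuous using 1
          ext q
          change cyl f g _ _ ∈ C ↔ cyl f g _ _ ∈ C
          rw [Homeomorph.apply_symm_apply] }

/-! ### Disjoint unions, cylinders and products with sets -/

namespace GCWComplex

variable {G : Type u} [Group G]

/-- A family consisting of two complexes. -/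
def twoFamily (X Y : GCWComplex G) : ULift.{u} Bool → GCWComplex G
  | ⟨false⟩ => X
  | ⟨true⟩ => Y

/-- The disjoint union of two complexes. -/
def sum (X Y : GCWComplex G) : GCWComplex G := coprod (twoFamily X Y)

/-- The inclusion of the first summand. -/
def sumInl (X Y : GCWComplex G) : CellularMap X (sum X Y) where
  toFun p := ⟨⟨false⟩, p⟩
  continuous_toFun := continuous_sigmaMk (σ := fun j => (twoFamily X Y j).carrier) (i := ⟨false⟩)
  map_smul _ _ := rfl
  cellular _ _ h := h

/-- The inclusion of the second summand. -/
def sumInr (X Y : GCWComplex G) : CellularMap Y (sum X Y) where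
  toFun p := ⟨⟨true⟩, p⟩
  continuous_toFun := continuous_sigmaMk (σ := fun j => (twoFamily X Y j).carrier) (i := ⟨true⟩)
  map_smul _ _ := rfl
  cellular _ _ h := h

/-- A map out of a disjoint union of two complexes. -/
def sumElim {X Y : GCWComplex G} {Z : Type*} (φ : X.carrier → Z) (ψ : Y.carrier → Z) :
    (sum X Y).carrier → Z
  | ⟨⟨false⟩, p⟩ => φ p
  | ⟨⟨true⟩, p⟩ => ψ p

variable {X Y : GCWComplex G}

theorem sum_cases {P : (sum X Y).carrier → Prop} (h : ∀ p, P ((sumInl X Y).toFun p))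
    (h' : ∀ p, P ((sumInr X Y).toFun p)) : ∀ p, P p
  | ⟨⟨false⟩, p⟩ => h p
  | ⟨⟨true⟩, p⟩ => h' p

theorem sumElim_smul {Z : Type*} [SMul G Z] {φ : X.carrier → Z} {ψ : Y.carrier → Z}
    (hφ : ∀ (k : G) p, φ (k • p) = k • φ p) (hψ : ∀ (k : G) p, ψ (k • p) = k • ψ p) (k : G) :
    ∀ p, sumElim φ ψ (k • p) = k • sumElim φ ψ p
  | ⟨⟨false⟩, p⟩ => hφ k p
  | ⟨⟨true⟩, p⟩ => hψ k p

theorem continuous_sum_iff {Z : Type*} [TopologicalSpace Z] {φ : (sum X Y).carrier → Z} :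
    Continuous φ ↔ Continuous (fun p => φ ((sumInl X Y).toFun p)) ∧
      Continuous fun p => φ ((sumInr X Y).toFun p) := by
  refine ⟨fun h => ⟨h.comp (sumInl X Y).continuous_toFun, h.comp (sumInr X Y).continuous_toFun⟩,
    fun h => ?_⟩
  refine continuous_sigma (σ := fun j => (twoFamily X Y j).carrier) fun j => ?_
  rcases j with ⟨_ | _⟩
  · exact h.1
  · exact h.2

theorem continuous_prod_sum_iff {J Z : Type*} [TopologicalSpace J] [TopologicalSpace Z]
    {φ : J × (sum X Y).carrier → Z} :
    Continuous φ ↔ Continuous (fun q : J × X.carrier => φ (q.1, (sumInl X Y).toFun q.2)) ∧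
      Continuous fun q : J × Y.carrier => φ (q.1, (sumInr X Y).toFun q.2) := by
  refine ⟨fun h => ⟨h.comp (continuous_id.prodMap (sumInl X Y).continuous_toFun),
    h.comp (continuous_id.prodMap (sumInr X Y).continuous_toFun)⟩, fun h => ?_⟩
  let e := (Homeomorph.prodComm _ _).trans
    (Homeomorph.sigmaProdDistrib (X := fun j => (twoFamily X Y j).carrier) (Y := J))
  refine e.symm.comp_continuous_iff'.1 (continuous_sigma fun j => ?_)
  rcases j with ⟨_ | _⟩
  · exact h.1.comp continuous_swap
  · exact h.2.comp continuous_swap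

theorem continuous_discrete_prod_iff {S : Type u} [MulAction G S] {Y Z : Type*}
    [TopologicalSpace Y] [TopologicalSpace Z] {φ : (discrete G S).carrier × Y → Z} :
    Continuous φ ↔ ∀ s, Continuous fun p => φ (s, p) := continuous_prod_of_discrete_left

theorem isClosed_discrete_prod_iff {S : Type u} [MulAction G S] {Y : Type*}
    [TopologicalSpace Y] {C : Set ((discrete G S).carrier × Y)} :
    IsClosed C ↔ ∀ s, IsClosed (Prod.mk s ⁻¹' C) := by
  simp_rw [← isOpen_compl_iff, isOpen_iff_continuous_mem]
  exact continuous_discrete_prod_iff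

/-- The product `S × X` of a discrete `G`-set and a complex, with the diagonal action. -/
def prodSet (S : Type u) [MulAction G S] (X : GCWComplex G) : GCWComplex G where
  carrier := (discrete G S).carrier × X.carrier
  cw :=
    { skel := fun n => {p | p.2 ∈ X.cw.skel n}
      skel_zero := by ext p; simp [X.cw.skel_zero]
      skel_mono := fun m n h p hp => X.cw.skel_mono h hp
      exists_mem_skel := fun p => X.cw.exists_mem_skel p.2
      smul_mem_skel := fun n g p hp => X.cw.smul_mem_skel n g p.2 hp
      isClosed_skel := fun n => (X.cw.isClosed_skel n).preimage continuous_snd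
      isClosed_of_skel := fun C hC => isClosed_discrete_prod_iff.2 fun s =>
        X.cw.isClosed_of_skel _ fun n => isClosed_discrete_prod_iff.1 (hC n) s
      cell := fun n => S × X.cw.cell n
      cellAction := fun n => inferInstance
      charMap := fun n e p => (e.1, X.cw.charMap n e.2 p)
      continuous_charMap := fun n e => continuous_const.prodMk (X.cw.continuous_charMap n e.2)
      charMap_smul := fun n g e p => Prod.ext rfl (X.cw.charMap_smul n g e.2 p)
      charMap_mem := fun n e p => X.cw.charMap_mem n e.2 p
      charMap_boundary := fun n e p hp => X.cw.charMap_boundary n e.2 p hp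
      charMap_interior := fun n e p hp => X.cw.charMap_interior n e.2 p hp
      charMap_injective := fun n e e' p p' hp hp' h => by
        obtain ⟨h₁, h₂⟩ := X.cw.charMap_injective n e.2 e'.2 p p' hp hp' (congrArg Prod.snd h)
        exact ⟨Prod.ext (Prod.mk.inj h).1 h₁, h₂⟩
      exists_charMap := fun n y hy hy' => by
        obtain ⟨e, p, hp, h⟩ := X.cw.exists_charMap n y.2 hy hy'
        exact ⟨(y.1, e), p, hp, Prod.ext rfl h⟩
      isClosed_of_charMap := fun n C hC h₁ h₂ => isClosed_discrete_prod_iff.2 fun s =>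
        X.cw.isClosed_of_charMap n _ (fun y hy => hC hy) (isClosed_discrete_prod_iff.1 h₁ s)
          fun e => h₂ (s, e) }

/-- The map `S × f`. -/
def CellularMap.prodSet (S : Type u) [MulAction G S] (f : CellularMap X Y) :
    CellularMap (prodSet S X) (prodSet S Y) where
  toFun p := (p.1, f.toFun p.2)
  continuous_toFun := continuous_fst.prodMk (f.continuous_toFun.comp continuous_snd)
  map_smul k p := Prod.ext rfl (f.map_smul k p.2)
  cellular n p hp := f.cellular n p.2 hp

/-- The identity as a cellular map. -/
def CellularMap.id (X : GCWComplex G) : CellularMap X X :=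
  ⟨fun p => p, continuous_id, fun _ _ => rfl, fun _ _ h => h⟩

/-- The cylinder `X × [0, 1]` as a complex. -/
noncomputable def cylinder (X : GCWComplex G) : GCWComplex G := hocoeq (sumInl X X) (sumInr X X)

end GCWComplex

namespace Hocoeq

variable {G : Type u} [Group G] {A B : GCWComplex G} (f g : CellularMap A B)

theorem isClosedEmbedding_base : Topology.IsClosedEmbedding (base f g) := by
  refine .of_continuous_injective_isClosedMap (continuous_base f g) base_injective fun C hC => ?_
  refine isClosed_iff.2 ⟨by rwa [Set.preimage_image_eq _ base_injective], ?_⟩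
  have : (fun q : A.carrier × unitInterval => cyl f g q.1 q.2) ⁻¹' (base f g '' C) =
      (Prod.snd ⁻¹' {0} ∩ (fun q => f.toFun q.1) ⁻¹' C) ∪
      (Prod.snd ⁻¹' {1} ∩ (fun q => g.toFun q.1) ⁻¹' C) := by
    ext ⟨a, t⟩
    by_cases h₀ : t = 0
    · subst h₀
      simp [cyl_zero, base_injective.eq_iff]
    by_cases h₁ : t = 1
    · subst h₁
      simp [cyl_one, base_injective.eq_iff]
    · simp [h₀, h₁, (cyl_ne_base h₀ h₁ a _).symm]
  rw [this]
  exact ((isClosed_singleton.preimage continuous_snd).inter (hC.preimage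
    (f.continuous_toFun.comp continuous_fst))).union
    ((isClosed_singleton.preimage continuous_snd).inter (hC.preimage
    (g.continuous_toFun.comp continuous_fst)))

/-- The pair consisting of the homotopy coequalizer of `f, g : A → B` and `B`. -/
noncomputable def basePair : GCWPair G where
  space := hocoeq f g
  sub :=
    { carrier := Set.range (base f g)
      smul_mem' := by
        rintro k _ ⟨b, rfl⟩
        exact ⟨k • b, rfl⟩ }
  isSubcomplex :=
    { isClosed := (isClosedEmbedding_base f g).isClosed_range
      charMap_mem := by
        rintro n (e | e) p q hp h
        · exact ⟨_, rfl⟩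
        · cases n with
          | zero => exact e.elim
          | succ n =>
            obtain ⟨-, h₀, h₁⟩ := (diskHomeomorph_interior p).1 hp
            obtain ⟨b, hb⟩ := h
            exact (cyl_ne_base h₀ h₁ _ _ hb.symm).elim }

/-- The canonical map from the cylinder `(A × [0, 1], A × {0, 1})` to the pair `(Q, B)`, where `Q`
is the homotopy coequalizer of `f, g : A → B`. -/
noncomputable def fromCylinder : basePair (sumInl A A) (sumInr A A) ⟶ basePair f g :=
  GCWPair.Hom.mk (P := basePair (sumInl A A) (sumInr A A)) (Q := basePair f g)
    (lift (sumElim (fun a => base f g (f.toFun a)) fun a => base f g (g.toFun a)) (cyl f g))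
    (continuous_lift (cyl_zero f g) (cyl_one f g) (continuous_sum_iff.2
      ⟨(continuous_base f g).comp f.continuous_toFun,
        (continuous_base f g).comp g.continuous_toFun⟩) (continuous_cyl f g))
    (lift_smul (sumElim_smul (fun k a => congrArg _ (f.map_smul k a))
      fun k a => congrArg _ (g.map_smul k a)) fun k a t => (smul_cyl k a t).symm)
    (by
      rintro _ ⟨b, rfl⟩
      exact sum_cases (P := fun b => sumElim (fun a => base f g (f.toFun a))
        (fun a => base f g (g.toFun a)) b ∈ Set.range (base f g))
        (fun a => ⟨_, rfl⟩) (fun a => ⟨_, rfl⟩) b)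

theorem fromCylinder_cyl (a : A.carrier) (t : unitInterval) :
    (fromCylinder f g).toFun (cyl (sumInl A A) (sumInr A A) a t) = cyl f g a t :=
  lift_cyl (f := sumInl A A) (g := sumInr A A) (cyl_zero f g) (cyl_one f g) a t

theorem isCellularPushout_fromCylinder : GCWPair.IsCellularPushout (fromCylinder f g) where
  cellular := by
    rintro n _ ⟨b, rfl⟩ h
    revert h
    exact sum_cases (P := fun b => b ∈ (sum A A).cw.skel n → sumElim (fun a => base f g (f.toFun a))
        (fun a => base f g (g.toFun a)) b ∈ skel f g n)
        (fun a => f.cellular n a) (fun a => g.cellular n a) b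
  bijOn := by
    refine ⟨fun q hq => ?_, fun q hq q' hq' h => ?_, fun q hq => ?_⟩
    · rcases Hocoeq.cases (f := sumInl A A) (g := sumInr A A) q with ⟨b, rfl⟩ | ⟨a, t, h₀, h₁, rfl⟩
      · exact (hq ⟨b, rfl⟩).elim
      · rw [fromCylinder_cyl]
        rintro ⟨b, hb⟩
        exact cyl_ne_base h₀ h₁ _ _ hb.symm
    · rcases Hocoeq.cases (f := sumInl A A) (g := sumInr A A) q with ⟨b, rfl⟩ | ⟨a, t, h₀, h₁, rfl⟩
      · exact (hq ⟨b, rfl⟩).elim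
      rcases Hocoeq.cases (f := sumInl A A) (g := sumInr A A) q' with ⟨b, rfl⟩ | ⟨a', t', h₀', h₁', rfl⟩
      · exact (hq' ⟨b, rfl⟩).elim
      rw [fromCylinder_cyl, fromCylinder_cyl] at h
      obtain ⟨rfl, rfl⟩ := cyl_inj h₀ h₁ h₀' h₁' h
      rfl
    · rcases Hocoeq.cases (f := f) (g := g) q with ⟨b, rfl⟩ | ⟨a, t, h₀, h₁, rfl⟩
      · exact (hq ⟨b, rfl⟩).elim
      · refine ⟨cyl _ _ a t, ?_, fromCylinder_cyl f g a t⟩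
        rintro ⟨b, hb⟩
        exact cyl_ne_base h₀ h₁ _ _ hb.symm
  isClosed_of_preimage C hC hB := by
    refine isClosed_iff.2 ⟨?_, ?_⟩
    · have := IsClosed.preimage (continuous_base f g) hB
      convert this using 1
      ext b
      exact (and_iff_left ⟨b, rfl⟩).symm
    · have := (isClosed_iff.1 hC).2
      convert this using 1
      ext ⟨a, t⟩
      change cyl f g a t ∈ C ↔ (fromCylinder f g).toFun (cyl _ _ a t) ∈ C
      rw [fromCylinder_cyl]
      exact Iff.rfl

end Hocoeq

namespace GHomologyTheory.Trans

variable {G : Type u} [Group G] {Λ : Type w} [Ring Λ] {h : GHomologyTheory.{u, w, x} G Λ}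
  {k : GHomologyTheory.{u, w, y} G Λ} {τ : h.Trans k}

theorem IsIso.sum {X Y : GCWComplex G} (hX : τ.IsIso X.toPair) (hY : τ.IsIso Y.toPair) :
    τ.IsIso (sum X Y).toPair :=
  IsIso.coprod _ fun
    | ⟨false⟩ => hX
    | ⟨true⟩ => hY

open Hocoeq in
theorem IsIso.cylinder {X : GCWComplex G} (hX : τ.IsIso X.toPair) :
    τ.IsIso (cylinder X).toPair := by
  have h₀ := cyl_zero (sumInl X X) (sumInr X X)
  have h₁ := cyl_one (sumInl X X) (sumInr X X)
  -- the homotopy moves `(p, s)` to `(p, s (1 - t))`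
  let H : unitInterval → Hocoeq (sumInl X X) (sumInr X X) → Hocoeq (sumInl X X) (sumInr X X) :=
    fun t => lift (sumElim (fun p => cyl _ _ p 0) fun p => cyl _ _ p (unitInterval.symm t))
      fun p s => cyl _ _ p (s * unitInterval.symm t)
  have hH (t p s) : H t (cyl _ _ p s) = cyl _ _ p (s * unitInterval.symm t) :=
    lift_cyl (fun p => by rw [zero_mul]; rfl) (fun p => by rw [one_mul]; rfl) p s
  have hcyl := continuous_cyl (sumInl X X) (sumInr X X)
  have eta {F F' : Hocoeq (sumInl X X) (sumInr X X) → Hocoeq (sumInl X X) (sumInr X X)}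
      (h : ∀ p t, F (cyl _ _ p t) = F' (cyl _ _ p t)) (q) : F q = F' q := by
    rcases q.cases with ⟨b, rfl⟩ | ⟨p, t, -, -, rfl⟩
    · refine sum_cases (P := fun b => F (base _ _ b) = F' (base _ _ b)) (fun p => ?_)
        (fun p => ?_) b
      · rw [← h₀, h]
      · rw [← h₁, h]
    · exact h p t
  have hs := lift_cyl (f := sumInl X X) (g := sumInr X X) (u := sumElim (fun p => p) fun p => p)
    (v := fun p _ => p) (fun _ => rfl) (fun _ => rfl)
  refine hX.of_domination (X := GCWComplex.cylinder X)
    (lift (sumElim (fun p => p) fun p => p) fun p _ => p)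
    (continuous_lift (fun _ => rfl) (fun _ => rfl)
      (continuous_sum_iff.2 ⟨continuous_id, continuous_id⟩) continuous_fst)
    (lift_smul (sumElim_smul (fun _ _ => rfl) fun _ _ => rfl) fun _ _ _ => rfl)
    (fun p => cyl _ _ p 0) (hcyl.comp (continuous_id.prodMk continuous_const))
    (fun k p => (smul_cyl k p 0).symm) (fun q => H q.1 q.2) ?_ ?_ (eta ?_) (eta ?_)
  · refine continuous_prod_iff.2 ⟨continuous_prod_sum_iff.2 ⟨?_, ?_⟩, ?_⟩
    · exact hcyl.comp (continuous_snd.prodMk continuous_const)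
    · exact hcyl.comp (continuous_snd.prodMk (unitInterval.continuous_symm.comp continuous_fst))
    · simp_rw [hH]
      exact hcyl.comp ((continuous_fst.comp continuous_snd).prodMk
        ((continuous_snd.comp continuous_snd).mul (unitInterval.continuous_symm.comp
          continuous_fst)))
  · intro t k q
    exact lift_smul (sumElim_smul (φ := fun p => cyl _ _ p 0)
      (ψ := fun p => cyl _ _ p (unitInterval.symm t)) (fun k p => (smul_cyl k p _).symm)
      fun k p => (smul_cyl k p _).symm)
      (v := fun p s => cyl _ _ p (s * unitInterval.symm t))
      (fun k p s => (smul_cyl k p _).symm) k q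
  · intro p t
    refine (hH 0 p t).trans ?_
    rw [unitInterval.symm_zero, mul_one]
  · intro p t
    refine (hH 1 p t).trans ?_
    rw [unitInterval.symm_one, mul_zero, hs]

open Hocoeq in
/-- If `τ` is an isomorphism on `A` and on `B`, then it is one on the homotopy coequalizer of two
cellular maps `A → B`, since the latter arises from `B` by attaching `A × [0, 1]` along
`A × {0, 1}`. -/
theorem IsIso.hocoeq {A B : GCWComplex G} (f g : CellularMap A B) (hA : τ.IsIso A.toPair)
    (hB : τ.IsIso B.toPair) : τ.IsIso (hocoeq f g).toPair := by
  have hbase {A B : GCWComplex G} (f g : CellularMap A B) (hB : τ.IsIso B.toPair) :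
      τ.IsIso (basePair f g).subComplex.toPair := by
    let e := (isClosedEmbedding_base f g).isEmbedding.toHomeomorph
    refine hB.of_leftInverse (X := (basePair f g).subComplex) e.symm e.symm.continuous (fun k p => ?_)
      e e.continuous (fun k b => rfl) e.apply_symm_apply
    obtain ⟨b, rfl⟩ := e.surjective p
    have : k • (show (basePair f g).subComplex.carrier from e b) = e (k • b) := rfl
    exact (congrArg _ this).trans ((e.symm_apply_apply _).trans
      (congrArg (k • ·) (e.symm_apply_apply b).symm))
  exact (IsIso.pushout (fromCylinder f g) (isCellularPushout_fromCylinder f g)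
    (hbase _ _ (hA.sum hA)) hA.cylinder (hbase f g hB) :)

end GHomologyTheory.Trans

namespace GHomologyTheory.Trans

variable {G : Type u} [Group G] {Λ : Type w} [Ring Λ] {h : GHomologyTheory.{u, w, x} G Λ}
  {k : GHomologyTheory.{u, w, y} G Λ} (τ : h.Trans k)

/-- `τ` is an isomorphism on `S × X` for every `G`-set `S`. -/
def IsStableIso (X : GCWComplex G) : Prop :=
  ∀ (S : Type u) [MulAction G S], τ.IsIso (prodSet S X).toPair

variable {τ}

theorem IsStableIso.isIso {X : GCWComplex G} (hX : τ.IsStableIso X) : τ.IsIso X.toPair := by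
  let _ : MulAction G PUnit.{u + 1} :=
    { smul := fun _ p => p, one_smul := fun _ => rfl, mul_smul := fun _ _ _ => rfl }
  exact (hX PUnit).of_leftInverse (X := X) (Y := prodSet PUnit X)
    (fun p => (PUnit.unit, p)) (continuous_const.prodMk continuous_id) (fun _ _ => rfl) Prod.snd
    continuous_snd (fun _ _ => rfl) fun _ => rfl

theorem IsStableIso.discrete (hτ : ∀ (S : Type u) [MulAction G S], τ.IsIso (discrete G S).toPair)
    (S : Type u) [MulAction G S] : τ.IsStableIso (GCWComplex.discrete G S) := fun R _ =>
  haveI : DiscreteTopology (prodSet R (GCWComplex.discrete G S)).carrier :=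
    inferInstanceAs (DiscreteTopology ((GCWComplex.discrete G R).carrier ×
      (GCWComplex.discrete G S).carrier))
  (hτ (R × S)).of_leftInverse (X := prodSet R (GCWComplex.discrete G S))
    (Y := GCWComplex.discrete G (R × S)) (fun p => p) continuous_of_discreteTopology
    (fun _ _ => rfl) (fun p => p) continuous_of_discreteTopology (fun _ _ => rfl) fun _ => rfl

theorem IsStableIso.sum {X Y : GCWComplex G} (hX : τ.IsStableIso X) (hY : τ.IsStableIso Y) :
    τ.IsStableIso (sum X Y) := fun S _ => by
  refine ((hX S).sum (hY S)).of_leftInverse (X := prodSet S (X.sum Y))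
    (fun p => sumElim (fun q => (sumInl (prodSet S X) (prodSet S Y)).toFun (p.1, q))
      (fun q => (sumInr (prodSet S X) (prodSet S Y)).toFun (p.1, q)) p.2)
    (continuous_discrete_prod_iff.2 fun s => continuous_sum_iff.2 ⟨?_, ?_⟩) ?_
    (sumElim (fun p => (p.1, (sumInl X Y).toFun p.2)) fun p => (p.1, (sumInr X Y).toFun p.2))
    (continuous_sum_iff.2 ⟨?_, ?_⟩)
    (sumElim_smul (fun k p => rfl) fun k p => rfl) ?_
  · exact (sumInl (prodSet S X) (prodSet S Y)).continuous_toFun.comp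
      (continuous_const.prodMk continuous_id)
  · exact (sumInr (prodSet S X) (prodSet S Y)).continuous_toFun.comp
      (continuous_const.prodMk continuous_id)
  · rintro k ⟨s, ⟨_ | _⟩, p⟩
    · rfl
    · rfl
  · exact continuous_fst.prodMk ((sumInl X Y).continuous_toFun.comp continuous_snd)
  · exact continuous_fst.prodMk ((sumInr X Y).continuous_toFun.comp continuous_snd)
  · rintro ⟨s, ⟨_ | _⟩, p⟩
    · rfl
    · rfl

theorem IsStableIso.prodSet {X : GCWComplex G} (hX : τ.IsStableIso X) (S : Type u)
    [MulAction G S] : τ.IsStableIso (prodSet S X) := fun R _ => by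
  refine (hX (R × S)).of_leftInverse (X := GCWComplex.prodSet R (GCWComplex.prodSet S X))
    (Y := GCWComplex.prodSet (R × S) X) (fun p => ((p.1, p.2.1), p.2.2)) ?_ (fun _ _ => rfl)
    (fun p => (p.1.1, p.1.2, p.2)) ?_ (fun _ _ => rfl) fun _ => rfl
  · refine continuous_discrete_prod_iff.2 fun r => continuous_discrete_prod_iff.2 fun s => ?_
    exact (@continuous_const X.carrier (GCWComplex.discrete G (R × S)).carrier _ _ (r, s)).prodMk
      continuous_id
  · refine continuous_discrete_prod_iff.2 fun r => ?_
    exact (@continuous_const X.carrier (GCWComplex.discrete G R).carrier _ _ r.1).prodMk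
      ((@continuous_const X.carrier (GCWComplex.discrete G S).carrier _ _ r.2).prodMk
        continuous_id)

open Hocoeq in
theorem IsStableIso.hocoeq {A B : GCWComplex G} (f g : CellularMap A B) (hA : τ.IsStableIso A)
    (hB : τ.IsStableIso B) : τ.IsStableIso (hocoeq f g) := fun S _ => by
  have hs (s : S) := lift_cyl (f := f) (g := g)
    (u := fun b => base (f.prodSet S) (g.prodSet S) (s, b))
    (v := fun a t => cyl (f.prodSet S) (g.prodSet S) (s, a) t) (fun a => cyl_zero (f.prodSet S) (g.prodSet S) (s, a))
    (fun a => cyl_one (f.prodSet S) (g.prodSet S) (s, a))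
  have hsc (s : S) := continuous_lift (f := f) (g := g)
    (u := fun b => base (f.prodSet S) (g.prodSet S) (s, b))
    (v := fun a t => cyl (f.prodSet S) (g.prodSet S) (s, a) t)
    (fun a => cyl_zero (f.prodSet S) (g.prodSet S) (s, a))
    (fun a => cyl_one (f.prodSet S) (g.prodSet S) (s, a))
    ((continuous_base _ _).comp (continuous_const.prodMk continuous_id))
    ((continuous_cyl (f.prodSet S) (g.prodSet S)).comp
      ((continuous_const.prodMk continuous_fst).prodMk continuous_snd))
  have hr := lift_cyl (f := f.prodSet S) (g := g.prodSet S)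
    (u := fun b : (GCWComplex.prodSet S B).carrier => (b.1, base f g b.2))
    (v := fun (a : (GCWComplex.prodSet S A).carrier) t => (a.1, cyl f g a.2 t))
    (fun a => Prod.ext rfl (cyl_zero f g a.2)) (fun a => Prod.ext rfl (cyl_one f g a.2))
  refine (IsIso.hocoeq (f.prodSet S) (g.prodSet S) (hA S) (hB S)).of_leftInverse
    (X := GCWComplex.prodSet S (GCWComplex.hocoeq f g))
    (fun q => lift (fun b => base (f.prodSet S) (g.prodSet S) (q.1, b))
      (fun a t => cyl (f.prodSet S) (g.prodSet S) (q.1, a) t) q.2)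
    (continuous_discrete_prod_iff.2 hsc) ?_
    (lift (fun b => (b.1, base f g b.2)) (fun a t => (a.1, cyl f g a.2 t)))
    (continuous_lift (fun a => Prod.ext rfl (cyl_zero f g a.2))
      (fun a => Prod.ext rfl (cyl_one f g a.2)) ?_ ?_)
    (lift_smul (fun k b => rfl) fun k a t => Prod.ext rfl (smul_cyl k a.2 t).symm) ?_
  · rintro k ⟨s, b | ⟨a, t⟩⟩
    · rfl
    · exact (smul_cyl (f := f.prodSet S) (g := g.prodSet S) k (s, a) _).symm
  · exact continuous_fst.prodMk ((continuous_base f g).comp continuous_snd)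
  · exact (continuous_fst.comp continuous_fst).prodMk ((continuous_cyl f g).comp
      ((continuous_snd.comp continuous_fst).prodMk continuous_snd))
  · rintro ⟨s, q⟩
    rcases Hocoeq.cases (f := f) (g := g) q with ⟨b, rfl⟩ | ⟨a, t, -, -, rfl⟩
    · rfl
    · exact (congrArg _ (hs s a t)).trans (hr (s, a) t)

end GHomologyTheory.Trans

/-! ### Iterated joins and their telescope -/

namespace GCWComplex

variable {G : Type u} [Group G] (S : Type u) [MulAction G S] (X : GCWComplex G)

/-- The projection `S × X → X`, as a map to the disjoint union of `X` and `S`. -/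
def joinLeft : CellularMap (prodSet S X) (sum X (discrete G S)) where
  toFun p := (sumInl X (discrete G S)).toFun p.2
  continuous_toFun := (sumInl X (discrete G S)).continuous_toFun.comp continuous_snd
  map_smul _ _ := rfl
  cellular _ _ h := h

/-- The projection `S × X → S`, as a map to the disjoint union of `X` and `S`. -/
def joinRight : CellularMap (prodSet S X) (sum X (discrete G S)) where
  toFun p := (sumInr X (discrete G S)).toFun p.1
  continuous_toFun := (sumInr X (discrete G S)).continuous_toFun.comp continuous_fst
  map_smul _ _ := rfl
  cellular n p h := Nat.pos_of_ne_zero fun hn => by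
    subst hn
    have h : p.2 ∈ X.cw.skel 0 := h
    rw [X.cw.skel_zero] at h
    exact h

/-- The join `S * X` of a discrete `G`-set and a complex, as the homotopy coequalizer of the two
projections of `S × X`. -/
noncomputable def join : GCWComplex G := hocoeq (joinLeft S X) (joinRight S X)

variable {S X}

/-- The segment in the join from a point of `X` to a point of `S`. -/
noncomputable def joinSegment (s : S) (p : X.carrier) (t : unitInterval) : (join S X).carrier :=
  Hocoeq.cyl (joinLeft S X) (joinRight S X) ((s, p) : (prodSet S X).carrier) t

variable (X) in
/-- The points of `S`, as points of the join `S * X`. -/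
def joinVertex (s : S) : (join S X).carrier := Hocoeq.base (joinLeft S X) (joinRight S X) ((sumInr X (discrete G S)).toFun s)

variable (S X) in
/-- The inclusion of `X` into the join `S * X`. -/
def joinIncl : CellularMap X (join S X) where
  toFun p := Hocoeq.base (joinLeft S X) (joinRight S X) ((sumInl X (discrete G S)).toFun p)
  continuous_toFun := (Hocoeq.continuous_base (joinLeft S X) (joinRight S X)).comp (sumInl X (discrete G S)).continuous_toFun
  map_smul _ _ := rfl
  cellular _ _ h := h

theorem joinSegment_zero (s : S) (p : X.carrier) : joinSegment s p 0 = (joinIncl S X).toFun p :=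
  Hocoeq.cyl_zero (joinLeft S X) (joinRight S X) _

theorem joinSegment_one (s : S) (p : X.carrier) : joinSegment s p 1 = joinVertex X s :=
  Hocoeq.cyl_one (joinLeft S X) (joinRight S X) _

theorem smul_joinSegment (k : G) (s : S) (p : X.carrier) (t : unitInterval) :
    k • joinSegment s p t = joinSegment (k • s) (k • p) t :=
  Hocoeq.smul_cyl (f := joinLeft S X) (g := joinRight S X) k _ t

theorem continuous_joinSegment (s : S) :
    Continuous fun q : X.carrier × unitInterval => joinSegment s q.1 q.2 :=
  (Hocoeq.continuous_cyl (joinLeft S X) (joinRight S X)).comp (((@continuous_const _ (discrete G S).carrier _ _ s).prodMk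
    continuous_fst).prodMk continuous_snd)

variable (G S) in
/-- The iterated joins `S * ⋯ * S`. -/
noncomputable def iterJoin : ℕ → GCWComplex G
  | 0 => discrete G S
  | k + 1 => join S (iterJoin k)

variable (G S) in
/-- The disjoint union of all iterated joins. -/
noncomputable def allJoins : GCWComplex G :=
  coprod fun k : ULift.{u} ℕ => iterJoin G S k.down

theorem continuous_allJoins_prod {Y Z : Type*} [TopologicalSpace Y] [TopologicalSpace Z]
    {φ : (allJoins G S).carrier × Y → Z}
    (h : ∀ k : ℕ, Continuous fun q : (iterJoin G S k).carrier × Y => φ (⟨⟨k⟩, q.1⟩, q.2)) :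
    Continuous φ := by
  let e := Homeomorph.sigmaProdDistrib (X := fun k : ULift.{u} ℕ => (iterJoin G S k.down).carrier)
    (Y := Y)
  refine e.symm.comp_continuous_iff'.1 (continuous_sigma fun k => ?_)
  exact h k.down

theorem continuous_allJoins_mk (k : ℕ) : Continuous
    fun p : (iterJoin G S k).carrier => (⟨⟨k⟩, p⟩ : (allJoins G S).carrier) :=
  continuous_sigmaMk (σ := fun k : ULift.{u} ℕ => (iterJoin G S k.down).carrier) (i := ⟨k⟩)

variable (G S) in
/-- The map given by the inclusions of each iterated join into the next one. -/
noncomputable def shift : CellularMap (allJoins G S) (allJoins G S) where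
  toFun a := ⟨⟨a.1.down + 1⟩, (joinIncl S (iterJoin G S a.1.down)).toFun a.2⟩
  continuous_toFun := continuous_sigma fun k =>
    (continuous_allJoins_mk (k.down + 1)).comp (joinIncl S (iterJoin G S k.down)).continuous_toFun
  map_smul _ _ := rfl
  cellular _ _ h := h

variable (G S) in
/-- The telescope of the iterated joins of `S`. -/
noncomputable def telescope : GCWComplex G := hocoeq (CellularMap.id (allJoins G S)) (shift G S)

end GCWComplex

namespace Telescope

variable {G : Type u} [Group G] {S : Type u} [MulAction G S]

/-- The homotopy from `shift` to a map to the vertices given by `s`; here `t` is restricted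
to `[0, 1]`. -/
noncomputable def cone (s : S) (a : (allJoins G S).carrier) (t : ℝ) : (allJoins G S).carrier :=
  ⟨⟨a.1.down + 1⟩, joinSegment s a.2 (Set.projIcc 0 1 zero_le_one t)⟩

theorem cone_of_le_zero (s : S) (a : (allJoins G S).carrier) {t : ℝ} (ht : t ≤ 0) :
    cone s a t = (shift G S).toFun a := by
  rw [cone, Set.projIcc_of_le_left _ ht]
  exact congrArg (Sigma.mk _) (joinSegment_zero s a.2)

theorem smul_cone (k : G) (s : S) (a : (allJoins G S).carrier) (t : ℝ) :
    k • cone s a t = cone (k • s) (k • a) t :=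
  congrArg (Sigma.mk _) (smul_joinSegment k s a.2 _)

theorem continuous_cone (s : S) :
    Continuous fun q : (allJoins G S).carrier × ℝ => cone s q.1 q.2 :=
  continuous_allJoins_prod fun k => (continuous_allJoins_mk (k + 1)).comp
    ((continuous_joinSegment s).comp (continuous_id.prodMap (continuous_projIcc (h := zero_le_one))))

variable (G) in
/-- The vertices given by `s` in the iterated joins. -/
noncomputable def vertex (s : S) : ℕ → (allJoins G S).carrier
  | 0 => ⟨⟨0⟩, s⟩
  | k + 1 => ⟨⟨k + 1⟩, joinVertex (iterJoin G S k) s⟩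

theorem cone_of_one_le (s : S) (a : (allJoins G S).carrier) {t : ℝ} (ht : 1 ≤ t) :
    cone s a t = vertex G s (a.1.down + 1) := by
  rw [cone, Set.projIcc_of_right_le _ ht]
  exact congrArg (Sigma.mk _) (joinSegment_one s a.2)

theorem smul_vertex (k : G) (s : S) : ∀ n : ℕ, k • vertex G s n = vertex G (k • s) n
  | 0 => rfl
  | _ + 1 => rfl

theorem vertex_fst (s : S) : ∀ n, (vertex G s n).1.down = n
  | 0 => rfl
  | _ + 1 => rfl

/-- The segment in the telescope from `a` to `shift a`; here `t` is restricted to `[0, 1]`. -/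
noncomputable def seg (a : (allJoins G S).carrier) (t : ℝ) : (telescope G S).carrier :=
  Hocoeq.cyl (CellularMap.id (allJoins G S)) (shift G S) a (Set.projIcc 0 1 zero_le_one t)

/-- The inclusion of the iterated joins into the telescope. -/
noncomputable def base (a : (allJoins G S).carrier) : (telescope G S).carrier :=
  Hocoeq.base (CellularMap.id (allJoins G S)) (shift G S) a

theorem seg_of_le_zero (a : (allJoins G S).carrier) {t : ℝ} (ht : t ≤ 0) :
    seg a t = base a := by
  rw [seg, Set.projIcc_of_le_left _ ht]
  exact Hocoeq.cyl_zero (CellularMap.id (allJoins G S)) (shift G S) a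

theorem seg_of_one_le (a : (allJoins G S).carrier) {t : ℝ} (ht : 1 ≤ t) :
    seg a t = base ((shift G S).toFun a) := by
  rw [seg, Set.projIcc_of_right_le _ ht]
  exact Hocoeq.cyl_one (CellularMap.id (allJoins G S)) (shift G S) a

theorem continuous_base : Continuous (base : (allJoins G S).carrier → _) :=
  Hocoeq.continuous_base (CellularMap.id (allJoins G S)) (shift G S)

theorem continuous_seg : Continuous fun q : (allJoins G S).carrier × ℝ => seg q.1 q.2 :=
  (Hocoeq.continuous_cyl (CellularMap.id (allJoins G S)) (shift G S)).comp (continuous_id.prodMap (continuous_projIcc (h := zero_le_one)))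

theorem smul_base (k : G) (a : (allJoins G S).carrier) : k • base a = base (k • a) := rfl

theorem smul_seg (k : G) (a : (allJoins G S).carrier) (t : ℝ) : k • seg a t = seg (k • a) t :=
  Hocoeq.smul_cyl (f := CellularMap.id (allJoins G S)) (g := shift G S) k a _

theorem eq_seg (q : (telescope G S).carrier) : ∃ a, ∃ t : unitInterval, q = seg a t := by
  rcases Hocoeq.cases (f := CellularMap.id (allJoins G S)) (g := shift G S) q with
    ⟨a, rfl⟩ | ⟨a, t, -, -, rfl⟩
  · exact ⟨a, 0, (seg_of_le_zero a le_rfl).symm⟩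
  · refine ⟨a, t, ?_⟩
    rw [seg, Set.projIcc_val]

/-- The path in the telescope from `a` to `shift (shift a)`, of length two. -/
noncomputable def walk (a : (allJoins G S).carrier) (t : ℝ) : (telescope G S).carrier :=
  if t ≤ 1 then seg a t else seg ((shift G S).toFun a) (t - 1)

theorem continuous_walk : Continuous fun q : (allJoins G S).carrier × ℝ => walk q.1 q.2 := by
  refine Continuous.if_le continuous_seg (continuous_seg.comp
    (((shift G S).continuous_toFun.comp continuous_fst).prodMk (continuous_snd.sub continuous_const)))
    continuous_snd continuous_const fun q hq => ?_
  rw [hq, seg_of_one_le _ le_rfl]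
  exact (seg_of_le_zero _ (by norm_num)).symm

theorem smul_walk (k : G) (a : (allJoins G S).carrier) (t : ℝ) : k • walk a t = walk (k • a) t := by
  unfold walk
  split_ifs
  · exact smul_seg k a t
  · exact (smul_seg k _ _).trans (congrArg (seg · _) ((shift G S).map_smul k a).symm)

/-- Maps out of the telescope. -/
noncomputable def lift {Z : Type*} (φ : (allJoins G S).carrier → ℝ → Z) :
    (telescope G S).carrier → Z :=
  Hocoeq.lift (f := CellularMap.id (allJoins G S)) (g := shift G S) (fun a => φ a 0) fun a t => φ a t

theorem lift_seg {Z : Type*} {φ : (allJoins G S).carrier → ℝ → Z}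
    (h : ∀ a, φ a 1 = φ ((shift G S).toFun a) 0) (a : (allJoins G S).carrier) (t : unitInterval) :
    lift φ (seg a t) = φ a t := by
  rw [lift, seg, Set.projIcc_val]
  exact Hocoeq.lift_cyl (fun a => rfl) h a t

theorem continuous_lift_prod {J Z : Type*} [TopologicalSpace J] [LocallyCompactSpace J]
    [TopologicalSpace Z] {φ : J → (allJoins G S).carrier → ℝ → Z}
    (h : ∀ j a, φ j a 1 = φ j ((shift G S).toFun a) 0)
    (hφ : Continuous fun q : J × (allJoins G S).carrier × ℝ => φ q.1 q.2.1 q.2.2) :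
    Continuous fun q : J × (telescope G S).carrier => lift (φ q.1) q.2 := by
  refine Hocoeq.continuous_prod_iff.2 ⟨hφ.comp (continuous_fst.prodMk
    (continuous_snd.prodMk continuous_const)), ?_⟩
  have : Continuous fun q : J × (allJoins G S).carrier × unitInterval => φ q.1 q.2.1 q.2.2 :=
    hφ.comp (by fun_prop : Continuous fun q : J × (allJoins G S).carrier × unitInterval =>
      (q.1, q.2.1, (q.2.2 : ℝ)))
  refine this.congr fun q => ?_
  exact (Hocoeq.lift_cyl (f := CellularMap.id (allJoins G S)) (g := shift G S)
    (u := fun a => φ q.1 a 0) (v := fun a t => φ q.1 a t) (fun a => rfl) (h q.1) q.2.1 q.2.2).symm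

end Telescope

namespace Telescope

variable {G : Type u} [Group G] {S : Type u} [MulAction G S]

theorem lift_smul {φ : (allJoins G S).carrier → ℝ → (telescope G S).carrier} {k : G}
    (h : ∀ a, φ a 1 = φ ((shift G S).toFun a) 0)
    (hφ : ∀ a t, φ (k • a) t = k • φ a t) (q : (telescope G S).carrier) :
    lift φ (k • q) = k • lift φ q := by
  obtain ⟨a, t, rfl⟩ := eq_seg q
  rw [smul_seg, lift_seg h, lift_seg h, hφ]

/-! The identity of the telescope is deformed, in three steps, to a constant map. -/

/-- The first homotopy moves each point by one step towards the end of the telescope. -/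
noncomputable def push (u : unitInterval) (a : (allJoins G S).carrier) (t : ℝ) :
    (telescope G S).carrier :=
  walk a ((1 - u) * t + u * (1 + min 1 (2 * t)))

theorem push_glue (u : unitInterval) (a : (allJoins G S).carrier) :
    push u a 1 = push u ((shift G S).toFun a) 0 := by
  have hu := u.2.1
  have hu' := u.2.2
  have e₁ : (1 - u.1) * 1 + u * (1 + min 1 (2 * 1)) = 1 + u := by norm_num; ring
  have e₂ : (1 - u.1) * 0 + u * (1 + min 1 (2 * 0)) = u := by norm_num
  rw [push, push, e₁, e₂, walk, walk, if_pos hu']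
  split_ifs with h
  · have : u.1 = 0 := by linarith
    rw [this, seg_of_one_le _ (by norm_num), seg_of_le_zero _ le_rfl]
  · rw [add_sub_cancel_left]

theorem push_zero (a : (allJoins G S).carrier) (t : unitInterval) : push 0 a t = seg a t := by
  have e : (1 - ((0 : unitInterval) : ℝ)) * t + ((0 : unitInterval) : ℝ) *
      (1 + min 1 (2 * (t : ℝ))) = t := by
    simp
  rw [push, e, walk, if_pos t.2.2]

theorem push_one (a : (allJoins G S).carrier) (t : unitInterval) :
    push 1 a t = seg ((shift G S).toFun a) (2 * t) := by
  have e : (1 - ((1 : unitInterval) : ℝ)) * t + ((1 : unitInterval) : ℝ) *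
      (1 + min 1 (2 * (t : ℝ))) = 1 + min 1 (2 * (t : ℝ)) := by simp
  have ht := t.2.1
  rw [push, e, walk]
  split_ifs with h
  · have h : min 1 (2 * t.1) ≤ 0 := by linarith
    have h : 2 * t.1 ≤ 0 := by
      rcases min_le_iff.1 h with h | h
      · linarith
      · exact h
    rw [seg_of_le_zero _ h, seg_of_one_le _ (by simp; linarith)]
  · rw [add_sub_cancel_left]
    rcases le_total (2 * t.1) 1 with h | h
    · rw [min_eq_right h]
    · rw [min_eq_left h, seg_of_one_le _ le_rfl, seg_of_one_le _ h]

theorem continuous_push : Continuous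
    fun q : unitInterval × (allJoins G S).carrier × ℝ => push q.1 q.2.1 q.2.2 :=
  continuous_walk.comp (by fun_prop : Continuous
    fun q : unitInterval × (allJoins G S).carrier × ℝ =>
      (q.2.1, (1 - (q.1 : ℝ)) * q.2.2 + q.1 * (1 + min 1 (2 * q.2.2))))

theorem smul_push (k : G) (u : unitInterval) (a : (allJoins G S).carrier) (t : ℝ) :
    push u (k • a) t = k • push u a t := (smul_walk k a _).symm

/-- The second homotopy contracts each iterated join to the vertex given by `s`. In the second
half of each segment, it connects the contraction of an iterated join with the one of the next
iterated join, inside the cone with apex `s` over that cone. -/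
noncomputable def shrink (s : S) (u : unitInterval) (a : (allJoins G S).carrier) (t : ℝ) :
    (telescope G S).carrier :=
  if t ≤ 1 / 2 then seg (cone s a u) (2 * t) else
    base (cone s (cone s a (min 1 (4 - 4 * t) * u)) (min 1 (4 * t - 2) * u))

theorem shrink_zero' (s : S) (u : unitInterval) (a : (allJoins G S).carrier) :
    shrink s u a 0 = base (cone s a u) := by
  rw [shrink, if_pos (by norm_num), seg_of_le_zero _ (by norm_num)]

theorem shrink_glue (s : S) (u : unitInterval) (a : (allJoins G S).carrier) :
    shrink s u a 1 = shrink s u ((shift G S).toFun a) 0 := by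
  rw [shrink_zero', shrink, if_neg (by norm_num)]
  norm_num
  rw [cone_of_le_zero _ _ le_rfl]

theorem shrink_zero (s : S) (a : (allJoins G S).carrier) (t : unitInterval) :
    shrink s 0 a t = seg ((shift G S).toFun a) (2 * t) := by
  rw [shrink]
  split_ifs with h
  · rw [cone_of_le_zero _ _ (by simp)]
  · rw [cone_of_le_zero _ _ (by simp), cone_of_le_zero _ _ (by simp),
      seg_of_one_le _ (by linarith)]

theorem continuous_shrink (s : S) : Continuous
    fun q : unitInterval × (allJoins G S).carrier × ℝ => shrink s q.1 q.2.1 q.2.2 := by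
  have h (r : unitInterval × (allJoins G S).carrier × ℝ → ℝ) (hr : Continuous r) :
      Continuous fun q : unitInterval × (allJoins G S).carrier × ℝ => cone s q.2.1 (r q) :=
    (continuous_cone s).comp ((continuous_fst.comp continuous_snd).prodMk hr)
  refine Continuous.if_le (continuous_seg.comp ((h (fun q => q.1) (by fun_prop)).prodMk
    (by fun_prop : Continuous fun q : unitInterval × (allJoins G S).carrier × ℝ => 2 * q.2.2)))
    (continuous_base.comp ((continuous_cone s).comp ((h
      (fun q => min 1 (4 - 4 * q.2.2) * q.1) (by fun_prop)).prodMk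
      (by fun_prop : Continuous fun q : unitInterval × (allJoins G S).carrier × ℝ =>
        min 1 (4 * q.2.2 - 2) * (q.1 : ℝ)))))
    (by fun_prop) continuous_const fun q hq => ?_
  simp only [hq]
  norm_num
  rw [cone_of_le_zero _ _ le_rfl, seg_of_one_le _ le_rfl]

theorem smul_shrink {k : G} {s : S} (hk : k • s = s) (u : unitInterval)
    (a : (allJoins G S).carrier) (t : ℝ) : shrink s u (k • a) t = k • shrink s u a t := by
  have h (a : (allJoins G S).carrier) (t : ℝ) : cone s (k • a) t = k • cone s a t := by
    rw [smul_cone, hk]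
  unfold shrink
  split_ifs
  · rw [h, smul_seg]
  · rw [h, h, smul_base]

/-- At the end of the second homotopy, the image of a point only depends on its level. -/
theorem shrink_one (s : S) (a : (allJoins G S).carrier) (t : ℝ) :
    shrink s 1 a t = shrink s 1 (vertex G s a.1.down) t := by
  have h₁ : cone s a ((1 : unitInterval) : ℝ) = cone s (vertex G s a.1.down)
      ((1 : unitInterval) : ℝ) := by
    rw [cone_of_one_le _ _ (by simp), cone_of_one_le _ _ (by simp), vertex_fst]
  unfold shrink
  split_ifs with ht
  · rw [h₁]
  · rcases le_total (3 / 4) t with ht' | ht'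
    · have e : min 1 (4 * t - 2) * ((1 : unitInterval) : ℝ) = 1 := by
        rw [min_eq_left (by linarith)]; simp
      rw [e, cone_of_one_le _ _ le_rfl, cone_of_one_le _ _ le_rfl]
      change base (vertex G s (a.1.down + 1 + 1)) = base (vertex G s ((vertex G s _).1.down + 1 + 1))
      rw [vertex_fst]
    · have e : min 1 (4 - 4 * t) * ((1 : unitInterval) : ℝ) = ((1 : unitInterval) : ℝ) := by
        rw [min_eq_left (by linarith)]; simp
      rw [e, h₁]

/-- The ray in the telescope given by the vertices for `s`. -/
noncomputable def ray (s : S) (r : ℝ) : (telescope G S).carrier :=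
  shrink s 1 (vertex G s ⌊r⌋₊) (Set.projIcc 0 1 zero_le_one (r - ⌊r⌋₊))

theorem ray_eq (s : S) (n : ℕ) {r : ℝ} (h : n ≤ r) (h' : r ≤ n + 1) :
    ray (G := G) s r = shrink s 1 (vertex G s n) (r - n) := by
  rcases h'.lt_or_eq with h' | rfl
  · have : ⌊r⌋₊ = n := (Nat.floor_eq_iff (n.cast_nonneg.trans h)).2 ⟨h, h'⟩
    rw [ray, this, Set.projIcc_of_mem _ ⟨by linarith, by linarith⟩]
  · have : ⌊(n : ℝ) + 1⌋₊ = n + 1 := by exact_mod_cast Nat.floor_natCast (R := ℝ) (n + 1)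
    rw [ray, this]
    have e : (n : ℝ) + 1 - (n + 1 : ℕ) = 0 := by push_cast; ring
    rw [e, Set.projIcc_left, add_sub_cancel_left, shrink_glue]
    change _ = shrink s 1 _ ((0 : ℝ))
    rw [shrink_one s ((shift G S).toFun _)]
    change shrink s 1 (vertex G s (n + 1)) 0 = shrink s 1 (vertex G s ((vertex G s n).1.down + 1)) 0
    rw [vertex_fst]

theorem continuous_ray (s : S) : Continuous (ray (G := G) s) := by
  have hn (n : ℕ) : Continuous fun r : ℝ => shrink s 1 (vertex G s n) (r - n) :=
    (continuous_shrink s).comp (by fun_prop :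
      Continuous fun r : ℝ => ((1 : unitInterval), vertex G s n, r - n))
  have key (n : ℕ) : ContinuousOn (ray (G := G) s) (Set.Iic n) := by
    induction n with
    | zero =>
      refine (continuousOn_const (c := shrink s 1 (vertex G s 0) 0)).congr fun r hr => ?_
      have hr : r ≤ 0 := by simpa using hr
      rw [ray, Nat.floor_of_nonpos hr, Set.projIcc_of_le_left _ (by simpa using hr)]
    | succ n ih =>
      have : Set.Iic ((n + 1 : ℕ) : ℝ) = Set.Iic (n : ℝ) ∪ Set.Icc (n : ℝ) (n + 1) := by
        push_cast
        exact (Set.Iic_union_Icc_eq_Iic (by linarith)).symm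
      rw [this]
      refine ih.union_of_isClosed ?_ isClosed_Iic isClosed_Icc
      exact (hn n).continuousOn.congr fun r hr => ray_eq s n hr.1 hr.2
  refine continuous_iff_continuousAt.2 fun r => ?_
  obtain ⟨n, hn⟩ := exists_nat_gt r
  exact (key n).continuousAt (Iic_mem_nhds hn)

theorem smul_ray {k : G} {s : S} (hk : k • s = s) (r : ℝ) : k • ray (G := G) s r = ray s r := by
  rw [ray, ← smul_shrink hk, smul_vertex, hk]

/-- The level of a point of the telescope. -/
noncomputable def level : (telescope G S).carrier → ℝ := lift fun a t => a.1.down + t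

theorem level_glue (a : (allJoins G S).carrier) :
    (a.1.down + 1 : ℝ) = ((shift G S).toFun a).1.down + 0 := by
  change (a.1.down + 1 : ℝ) = ((a.1.down + 1 : ℕ) : ℝ) + 0
  push_cast
  ring

theorem level_seg (a : (allJoins G S).carrier) (t : unitInterval) :
    level (seg a t) = a.1.down + t :=
  lift_seg (φ := fun a t => (a.1.down + t : ℝ)) level_glue a t

theorem continuous_level : Continuous (level : (telescope G S).carrier → ℝ) :=
  have hl : Continuous fun a : (allJoins G S).carrier => (a.1.down : ℝ) :=
    continuous_sigma fun k =>
      (continuous_const : Continuous fun _ : (iterJoin G S k.down).carrier => (k.down : ℝ))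
  (continuous_lift_prod (J := Unit) (φ := fun _ (a : (allJoins G S).carrier) t => (a.1.down + t : ℝ))
    (fun _ => level_glue) (Continuous.add (hl.comp (continuous_fst.comp continuous_snd))
      (continuous_snd.comp continuous_snd))).comp
    ((continuous_const (y := ())).prodMk continuous_id)

theorem level_smul (k : G) (q : (telescope G S).carrier) : level (k • q) = level q := by
  obtain ⟨a, t, rfl⟩ := eq_seg q
  rw [smul_seg, level_seg, level_seg]
  rfl

theorem lift_shrink_one (s : S) (q : (telescope G S).carrier) :
    lift (shrink s 1) q = ray s (level q) := by
  obtain ⟨a, t, rfl⟩ := eq_seg q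
  rw [lift_seg (shrink_glue s 1), level_seg, ray_eq s a.1.down (by linarith [t.2.1])
    (by linarith [t.2.2]), add_sub_cancel_left]
  exact shrink_one s a t

end Telescope

/-- An equivariant homotopy of self-maps restricts to the fixed point sets. -/
theorem homotopic_fixedPoints {U : Type*} [Group U] {Y : Type*} [TopologicalSpace Y]
    [MulAction U Y] {H : unitInterval × Y → Y} (hH : Continuous H)
    (h : ∀ t (k : U) q, H (t, k • q) = k • H (t, q))
    (φ ψ : C(MulAction.fixedPoints U Y, MulAction.fixedPoints U Y)) (h₀ : ∀ q, H (0, q.1) = φ q)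
    (h₁ : ∀ q, H (1, q.1) = ψ q) : φ.Homotopic ψ :=
  ⟨{ toFun := fun q => ⟨H (q.1, q.2.1), fun k => by rw [← h, q.2.2 k]⟩
     continuous_toFun := by fun_prop
     map_zero_left := fun q => Subtype.ext (h₀ q)
     map_one_left := fun q => Subtype.ext (h₁ q) }⟩

namespace Telescope

variable {G : Type u} [Group G] {S : Type u} [MulAction G S]

/-- If `U` fixes some `s ∈ S`, then the fixed point set of `U` on the telescope is contractible. -/
theorem contractibleSpace_fixedPoints {U : Subgroup G} {s : S} (hs : ∀ k ∈ U, k • s = s) :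
    ContractibleSpace (MulAction.fixedPoints U (telescope G S).carrier) := by
  let Y := MulAction.fixedPoints U (telescope G S).carrier
  have hpush : Continuous fun q : unitInterval × (telescope G S).carrier => lift (push q.1) q.2 :=
    continuous_lift_prod push_glue continuous_push
  have hshrink : Continuous
      fun q : unitInterval × (telescope G S).carrier => lift (shrink s q.1) q.2 :=
    continuous_lift_prod (shrink_glue s) (continuous_shrink s)
  have hpush' (t : unitInterval) (k : U) (q : (telescope G S).carrier) :
      lift (push t) (k • q) = k • lift (push t) q :=
    lift_smul (push_glue t) (smul_push k.1 t) q
  have hshrink' (t : unitInterval) (k : U) (q : (telescope G S).carrier) :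
      lift (shrink s t) (k • q) = k • lift (shrink s t) q :=
    lift_smul (shrink_glue s t) (smul_shrink (hs k k.2) t) q
  have hY (q : Y) (k : U) : k • q.1 = q.1 := q.2 k
  let φ : C(Y, Y) :=
    ⟨fun q => ⟨lift (push 1) q.1, fun k => by rw [← hpush', hY]⟩, (hpush.comp
      (continuous_const.prodMk continuous_subtype_val)).subtype_mk _⟩
  let ψ : C(Y, Y) :=
    ⟨fun q => ⟨lift (shrink s 1) q.1, fun k => by rw [← hshrink', hY]⟩, (hshrink.comp
      (continuous_const.prodMk continuous_subtype_val)).subtype_mk _⟩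
  have h₁ : (ContinuousMap.id Y).Homotopic φ := by
    refine homotopic_fixedPoints hpush hpush' _ φ (fun q => ?_) fun q => rfl
    obtain ⟨a, t, h⟩ := eq_seg q.1
    change lift (push 0) q.1 = q.1
    rw [h, lift_seg (push_glue 0), push_zero]
  have h₂ : φ.Homotopic ψ := by
    refine homotopic_fixedPoints hshrink hshrink' φ ψ (fun q => ?_) fun q => rfl
    obtain ⟨a, t, h⟩ := eq_seg q.1
    change lift (shrink s 0) q.1 = lift (push 1) q.1
    rw [h, lift_seg (shrink_glue s 0), lift_seg (push_glue 1), shrink_zero, push_one]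
  let y : Y := ⟨ray s 0, fun k => smul_ray (hs k.1 k.2) 0⟩
  have h₃ : ψ.Homotopic (.const Y y) := by
    refine homotopic_fixedPoints
      (H := fun q : unitInterval × (telescope G S).carrier =>
        ray s ((1 - (q.1 : ℝ)) * level q.2)) ((continuous_ray s).comp
        (((continuous_const.sub (continuous_subtype_val.comp continuous_fst))).mul
          (continuous_level.comp continuous_snd))) (fun t k q => ?_) ψ _ (fun q => ?_) fun q => ?_
    · change ray (G := G) s ((1 - (t : ℝ)) * level (k.1 • q)) =
        k.1 • ray (G := G) s ((1 - (t : ℝ)) * level q)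
      rw [level_smul, smul_ray (hs k k.2)]
    · change _ = lift (shrink s 1) q.1
      rw [lift_shrink_one]
      simp
    · change ray s ((1 - ((1 : unitInterval) : ℝ)) * level q.1) = ray s 0
      simp
  exact contractible_iff_id_nullhomotopic _ |>.2 ⟨_, (h₁.trans h₂).trans h₃⟩

end Telescope

theorem Hocoeq.stabilizer_le {G : Type u} [Group G] {A B : GCWComplex G} {f g : CellularMap A B}
    (q : Hocoeq f g) : (∃ b : B.carrier, MulAction.stabilizer G q ≤ MulAction.stabilizer G b) ∨
      ∃ a : A.carrier, MulAction.stabilizer G q ≤ MulAction.stabilizer G a := by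
  rcases q with b | ⟨a, t⟩
  · exact .inl ⟨b, fun k hk => Sum.inl_injective hk⟩
  · exact .inr ⟨a, fun k hk => congrArg Prod.fst (Sum.inr_injective hk)⟩

namespace GCWComplex

variable {G : Type u} [Group G] {S : Type u} [MulAction G S]

theorem exists_stabilizer_le_join {X : GCWComplex G}
    (hX : ∀ p : X.carrier, ∃ s : S, MulAction.stabilizer G p ≤ MulAction.stabilizer G s)
    (q : (join S X).carrier) :
    ∃ s : S, MulAction.stabilizer G q ≤ MulAction.stabilizer G s := by
  rcases Hocoeq.stabilizer_le (f := joinLeft S X) (g := joinRight S X) q with ⟨b, hb⟩ | ⟨a, ha⟩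
  · revert hb
    refine sum_cases (P := fun b => MulAction.stabilizer G q ≤ MulAction.stabilizer G b → _)
      (fun p hp => ?_) (fun s hs => ?_) b
    · obtain ⟨s, hs⟩ := hX p
      refine ⟨s, fun k hk => hs ?_⟩
      exact eq_of_heq (Sigma.mk.inj (hp hk)).2
    · refine ⟨s, fun k hk => ?_⟩
      exact eq_of_heq (Sigma.mk.inj (hs hk)).2
  · exact ⟨a.1, fun k hk => congrArg Prod.fst (ha hk)⟩

theorem exists_stabilizer_le_iterJoin : ∀ (k : ℕ) (p : (iterJoin G S k).carrier),
    ∃ s : S, MulAction.stabilizer G p ≤ MulAction.stabilizer G s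
  | 0, p => ⟨p, le_rfl⟩
  | k + 1, p => exists_stabilizer_le_join (exists_stabilizer_le_iterJoin k) p

/-- The isotropy groups of the telescope are contained in isotropy groups of `S`. -/
theorem exists_stabilizer_le_telescope (q : (telescope G S).carrier) :
    ∃ s : S, MulAction.stabilizer G q ≤ MulAction.stabilizer G s := by
  have h (a : (allJoins G S).carrier) :
      ∃ s : S, MulAction.stabilizer G a ≤ MulAction.stabilizer G s := by
    obtain ⟨s, hs⟩ := exists_stabilizer_le_iterJoin a.1.down a.2
    exact ⟨s, fun k hk => hs (eq_of_heq (Sigma.mk.inj hk).2)⟩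
  rcases Hocoeq.stabilizer_le (f := CellularMap.id (allJoins G S)) (g := shift G S) q with
    ⟨a, ha⟩ | ⟨a, ha⟩
  · exact (h a).imp fun s hs => ha.trans hs
  · exact (h a).imp fun s hs => ha.trans hs

end GCWComplex

/-- If a transformation of homology theories is an isomorphism on discrete `G`-sets, then it is one
on the telescope of the iterated joins of `S`. -/
theorem GHomologyTheory.Trans.IsIso.telescope {G : Type u} [Group G] {Λ : Type w} [Ring Λ]
    {h : GHomologyTheory.{u, w, x} G Λ} {k : GHomologyTheory.{u, w, y} G Λ} {τ : h.Trans k}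
    (hτ : ∀ (S : Type u) [MulAction G S], τ.IsIso (GCWComplex.discrete G S).toPair)
    (S : Type u) [MulAction G S] : τ.IsIso (GCWComplex.telescope G S).toPair := by
  have hjoin : ∀ n, τ.IsStableIso (iterJoin G S n) := by
    intro n
    induction n with
    | zero => exact .discrete hτ S
    | succ n ih => exact .hocoeq _ _ (ih.prodSet S) (ih.sum (.discrete hτ S))
  have hall : τ.IsIso (allJoins G S).toPair := IsIso.coprod _ fun n => (hjoin n.down).isIso
  exact .hocoeq _ _ hall hall

/-! ### Extension of equivariant maps -/

/-- A map from the boundary sphere of a disk to a contractible space extends to the disk. -/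
theorem exists_disk_extension {Z : Type*} [TopologicalSpace Z] [ContractibleSpace Z] {n : ℕ}
    (v : Disk n → Z) (hv : ContinuousOn v {p | ‖p.1‖ = 1}) :
    ∃ v' : Disk n → Z, Continuous v' ∧ ∀ p : Disk n, ‖p.1‖ = 1 → v' p = v p := by
  obtain ⟨z, ⟨H⟩⟩ := id_nullhomotopic Z
  let ρ : Disk n → Disk n := fun p => ⟨‖p.1‖⁻¹ • p.1, by
    rw [mem_closedBall_zero_iff, norm_smul, norm_inv, norm_norm]
    exact inv_mul_le_one⟩
  have hρ : ContinuousOn ρ {p | 1 / 2 ≤ ‖p.1‖} := by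
    refine Topology.IsInducing.subtypeVal.continuousOn_iff.2 ?_
    refine ContinuousOn.smul (f := fun p : Disk n => ‖p.1‖⁻¹) (g := fun p : Disk n => p.1)
      (ContinuousOn.inv₀ (by fun_prop) fun p hp => ?_) (by fun_prop)
    have hp : 1 / 2 ≤ ‖p.1‖ := hp
    exact (lt_of_lt_of_le (by norm_num) hp).ne'
  refine ⟨fun p => if ‖p.1‖ ≤ 1 / 2 then z else
    H (Set.projIcc 0 1 zero_le_one (2 * (1 - ‖p.1‖)), v (ρ p)), ?_, fun p hp => ?_⟩
  · refine continuous_if_le (by fun_prop) continuous_const continuousOn_const ?_ fun p hp => ?_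
    · refine H.continuous.comp_continuousOn (ContinuousOn.prodMk (Continuous.continuousOn
        (continuous_projIcc.comp (by fun_prop))) (hv.comp hρ fun p hp => ?_))
      have hp : 1 / 2 ≤ ‖p.1‖ := hp
      change ‖‖p.1‖⁻¹ • p.1‖ = 1
      rw [norm_smul, norm_inv, norm_norm, inv_mul_cancel₀ (lt_of_lt_of_le (by norm_num) hp).ne']
    · rw [hp, Set.projIcc_of_right_le _ (by norm_num)]
      exact (H.map_one_left _).symm
  · have e : ρ p = p := Subtype.ext (by simp [ρ, hp])
    dsimp only
    rw [if_neg (by rw [hp]; norm_num), e, hp, Set.projIcc_of_le_left _ (by norm_num)]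
    exact H.map_zero_left _

/-- The equivariant version, for a `G`-set `C` of disks: it suffices that the fixed point sets of
the isotropy groups of `C` are contractible. -/
theorem exists_equivariant_disk_extension {G : Type*} [Group G] {C Y : Type*} [MulAction G C]
    [TopologicalSpace Y] [MulAction G Y] [ContinuousConstSMul G Y]
    (hY : ∀ e : C, ContractibleSpace (MulAction.fixedPoints (MulAction.stabilizer G e) Y)) {n : ℕ}
    (v : C → Disk n → Y) (hv : ∀ e, ContinuousOn (v e) {p | ‖p.1‖ = 1})
    (hv' : ∀ (g : G) e (p : Disk n), ‖p.1‖ = 1 → v (g • e) p = g • v e p) :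
    ∃ v' : C → Disk n → Y, (∀ e, Continuous (v' e)) ∧
      (∀ e (p : Disk n), ‖p.1‖ = 1 → v' e p = v e p) ∧
      ∀ (g : G) e p, v' (g • e) p = g • v' e p := by
  classical
  have h (e : C) : ∃ v' : Disk n → MulAction.fixedPoints (MulAction.stabilizer G e) Y,
      Continuous v' ∧ ∀ p : Disk n, ‖p.1‖ = 1 → (v' p : Y) = v e p := by
    have := hY e
    have hfix (p : Disk n) (hp : ‖p.1‖ = 1) :
        v e p ∈ MulAction.fixedPoints (MulAction.stabilizer G e) Y := fun k => by
      have := hv' k.1 e p hp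
      rw [k.2] at this
      exact this.symm
    let z : MulAction.fixedPoints (MulAction.stabilizer G e) Y := Classical.arbitrary _
    obtain ⟨v', hc, h⟩ := exists_disk_extension
      (fun p : Disk n => if hp : ‖p.1‖ = 1 then
        (⟨v e p, hfix p hp⟩ : MulAction.fixedPoints (MulAction.stabilizer G e) Y) else z)
      (Topology.IsInducing.subtypeVal.continuousOn_iff.2 ((hv e).congr fun p hp => by
        have hp : ‖p.1‖ = 1 := hp
        simp [hp]))
    refine ⟨v', hc, fun p hp => ?_⟩
    rw [h p hp, dif_pos hp]
  choose w hw hw' using h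
  -- a representative of each orbit, and an element moving it to a given point of the orbit
  let r : C → C := fun e => (Quotient.mk (MulAction.orbitRel G C) e).out
  have hr (e : C) : ∃ g : G, g • r e = e := by
    have h : e ∈ MulAction.orbit G (r e) :=
      MulAction.orbitRel_apply.1 ((MulAction.orbitRel G C).symm (@Quotient.mk_out _ (MulAction.orbitRel G C) e))
    exact h
  have hrg (g : G) (e : C) : r (g • e) = r e :=
    congrArg Quotient.out (Quotient.sound (s := MulAction.orbitRel G C)
      (MulAction.orbitRel_apply.2 ⟨g, rfl⟩))
  choose γ hγ using hr
  refine ⟨fun e p => γ e • (w (r e) p : Y), fun e => ?_, fun e p hp => ?_, fun g e p => ?_⟩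
  · exact (continuous_subtype_val.comp (hw (r e))).const_smul (γ e)
  · dsimp only
    rw [hw' _ _ hp, ← hv' _ _ _ hp, hγ]
  · dsimp only
    rw [hrg]
    have hk : (γ e)⁻¹ * g⁻¹ * γ (g • e) ∈ MulAction.stabilizer G (r e) := by
      rw [MulAction.mem_stabilizer_iff, mul_smul]
      have := hγ (g • e)
      rw [hrg] at this
      rw [this, mul_smul, inv_smul_smul, inv_smul_eq_iff, hγ]
    have := (w (r e) p).2 ⟨_, hk⟩
    have this : ((γ e)⁻¹ * g⁻¹ * γ (g • e)) • (w (r e) p : Y) = w (r e) p := this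
    rw [mul_smul, mul_smul, inv_smul_eq_iff, inv_smul_eq_iff] at this
    exact this

namespace GCWStructure

variable {G : Type u} [Group G] {X : Type u} [TopologicalSpace X] [MulAction G X]
  (S : GCWStructure G X)

theorem continuousOn_skel {Z : Type*} [TopologicalSpace Z] {φ : X → Z} {k : ℕ}
    (h : ∀ n < k, ∀ e, Continuous fun p => φ (S.charMap n e p)) : ContinuousOn φ (S.skel k) := by
  rw [continuousOn_iff_continuous_domRestrict]
  refine (S.restrictSub _ (S.isSubcomplex_skel k)).continuous_of_cells fun n e => ?_
  exact h n (S.lt_of_charMap_mem_skel (p := ⟨0, by simp⟩) (by simp) (e.2 _)) e.1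

theorem stabilizer_cell {n : ℕ} (e : S.cell n) {p : Disk n} (hp : ‖p.1‖ < 1) :
    MulAction.stabilizer G (S.charMap n e p) = MulAction.stabilizer G e := by
  ext g
  rw [MulAction.mem_stabilizer_iff, MulAction.mem_stabilizer_iff, ← S.charMap_smul]
  exact ⟨fun h => (S.charMap_injective n _ _ p p hp hp h).1, fun h => by rw [h]⟩

open Classical in
/-- An equivariant map on a subcomplex and on the `n`-skeleton extends to the next skeleton if the
fixed point sets in the target of all isotropy groups are contractible. -/
theorem exists_extension_step {Y : Type*} [TopologicalSpace Y] [MulAction G Y]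
    [ContinuousConstSMul G Y]
    (hY : ∀ p : X, ContractibleSpace (MulAction.fixedPoints (MulAction.stabilizer G p) Y))
    {A : SubMulAction G X} (hA : S.IsSubcomplex A) {φ : X → Y} (hφA : ContinuousOn φ A)
    (hφA' : ∀ (g : G), ∀ p ∈ A, φ (g • p) = g • φ p) {n : ℕ}
    (hφ : ∀ m < n, ∀ e, Continuous fun p => φ (S.charMap m e p))
    (hφ' : ∀ (g : G), ∀ p ∈ S.skel n, φ (g • p) = g • φ p) :
    ∃ φ' : X → Y, (∀ p ∈ A, φ' p = φ p) ∧ (∀ p ∈ S.skel n, φ' p = φ p) ∧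
      (∀ m < n + 1, ∀ e, Continuous fun p => φ' (S.charMap m e p)) ∧
      ∀ (g : G), ∀ p ∈ S.skel (n + 1), φ' (g • p) = g • φ' p := by
  obtain ⟨v, hv, hv', hvg⟩ := exists_equivariant_disk_extension (C := S.cell n)
    (fun e => S.stabilizer_cell e (p := ⟨0, by simp⟩) (by simp) ▸ hY _)
    (fun e p => φ (S.charMap n e p))
    (fun e => (S.continuousOn_skel hφ).comp (S.continuous_charMap n e).continuousOn
      (S.charMap_boundary n e))
    (fun g e p hp => by
      rw [S.charMap_smul, hφ' _ _ (S.charMap_boundary n e p hp)])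
  let φ' : X → Y := fun q => if q ∈ S.skel n ∨ q ∈ A then φ q else
    if h : ∃ e, ∃ p : Disk n, ‖p.1‖ < 1 ∧ S.charMap n e p = q then v h.choose h.choose_spec.choose
    else φ q
  have h₁ (q : X) (hq : q ∈ A) : φ' q = φ q := if_pos (.inr hq)
  have h₂ (q : X) (hq : q ∈ S.skel n) : φ' q = φ q := if_pos (.inl hq)
  have h₃ (e : S.cell n) (p : Disk n) (hp : ‖p.1‖ < 1) (h : S.charMap n e p ∉ A) :
      φ' (S.charMap n e p) = v e p := by
    have hex : ∃ e', ∃ p' : Disk n, ‖p'.1‖ < 1 ∧ S.charMap n e' p' = S.charMap n e p :=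
      ⟨e, p, hp, rfl⟩
    have e₁ : φ' (S.charMap n e p) = v hex.choose hex.choose_spec.choose :=
      (if_neg (not_or.2 ⟨S.charMap_interior n e p hp, h⟩)).trans (dif_pos hex)
    obtain ⟨h, h'⟩ := hex.choose_spec.choose_spec
    obtain ⟨he, hp'⟩ := S.charMap_injective n _ _ _ _ h hp h'
    exact e₁.trans (congrArg₂ v he hp')
  refine ⟨φ', h₁, h₂, fun m hm e => ?_, fun g q hq => ?_⟩
  · rcases (Nat.lt_succ_iff.1 hm).lt_or_eq with hm | rfl
    · refine (hφ m hm e).congr fun p => (h₂ _ ?_).symm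
      exact S.skel_mono hm (S.charMap_mem m e p)
    · by_cases he : ∃ p : Disk m, ‖p.1‖ < 1 ∧ S.charMap m e p ∈ A
      · obtain ⟨p, hp, h⟩ := he
        have hmem := fun q => hA.charMap_mem m e p q hp h
        exact (hφA.comp_continuous (S.continuous_charMap m e) hmem).congr
          fun q => (h₁ _ (hmem q)).symm
      · refine (hv e).congr fun p => ?_
        rcases (norm_le_one p).lt_or_eq with hp | hp
        · exact (h₃ e p hp fun h => he ⟨p, hp, h⟩).symm
        · exact (hv' e p hp).trans (h₂ _ (S.charMap_boundary m e p hp)).symm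
  · by_cases hqA : q ∈ A
    · rw [h₁ _ hqA, h₁ _ (A.smul_mem g hqA), hφA' g q hqA]
    by_cases hqn : q ∈ S.skel n
    · rw [h₂ _ hqn, h₂ _ (S.smul_mem_skel n g q hqn), hφ' g q hqn]
    obtain ⟨e, p, hp, rfl⟩ := S.exists_charMap n q hq hqn
    have hg : S.charMap n (g • e) p ∉ A := by
      rw [S.charMap_smul]
      exact fun h => hqA (by simpa using A.smul_mem g⁻¹ h)
    rw [← S.charMap_smul, h₃ _ _ hp hqA, h₃ _ _ hp hg, hvg]

open Classical in
/-- An equivariant map on a subcomplex of `X` extends to `X` if the fixed point sets in the target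
of all isotropy groups of `X` are contractible. -/
theorem exists_extension {Y : Type*} [TopologicalSpace Y] [MulAction G Y]
    [ContinuousConstSMul G Y]
    (hY : ∀ p : X, ContractibleSpace (MulAction.fixedPoints (MulAction.stabilizer G p) Y))
    {A : SubMulAction G X} (hA : S.IsSubcomplex A) {φ : X → Y} (hφA : ContinuousOn φ A)
    (hφA' : ∀ (g : G), ∀ p ∈ A, φ (g • p) = g • φ p) :
    ∃ φ' : X → Y, Continuous φ' ∧ (∀ (g : G) p, φ' (g • p) = g • φ' p) ∧
      ∀ p ∈ A, φ' p = φ p := by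
  let Inv (n : ℕ) (ψ : X → Y) : Prop := (∀ p ∈ A, ψ p = φ p) ∧
    (∀ m < n, ∀ e, Continuous fun p => ψ (S.charMap m e p)) ∧
    ∀ (g : G), ∀ p ∈ S.skel n, ψ (g • p) = g • ψ p
  have step (n : ℕ) (ψ : {ψ // Inv n ψ}) :
      ∃ ψ' : {ψ // Inv (n + 1) ψ}, ∀ p ∈ S.skel n, ψ'.1 p = ψ.1 p := by
    obtain ⟨h₁, h₂, h₃⟩ := ψ.2
    obtain ⟨ψ', h₁', h₂', h₃', h₄'⟩ := S.exists_extension_step hY hA (φ := ψ.1)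
      (hφA.congr h₁) (fun g p hp => by
        rw [h₁ _ hp, h₁ _ (A.smul_mem g hp), hφA' g p hp]) h₂ h₃
    exact ⟨⟨ψ', fun p hp => (h₁' p hp).trans (h₁ p hp), h₃', h₄'⟩, h₂'⟩
  choose next hnext using step
  let ψ (n : ℕ) : {ψ // Inv n ψ} := Nat.rec
    ⟨φ, fun _ _ => rfl, fun m hm => absurd hm m.not_lt_zero,
      fun g p hp => absurd hp (S.skel_zero ▸ Set.notMem_empty p)⟩ next n
  have hψ (n m : ℕ) (hnm : n ≤ m) (p : X) (hp : p ∈ S.skel n) : (ψ m).1 p = (ψ n).1 p := by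
    induction m, hnm using Nat.le_induction with
    | base => rfl
    | succ m hnm ih => exact (hnext m (ψ m) p (S.skel_mono hnm hp)).trans ih
  have hlim (n : ℕ) (p : X) (hp : p ∈ S.skel n) :
      (ψ (Nat.find (S.exists_mem_skel p))).1 p = (ψ n).1 p :=
    (hψ _ n (Nat.find_min' _ hp) p (Nat.find_spec (S.exists_mem_skel p))).symm
  refine ⟨fun p => (ψ (Nat.find (S.exists_mem_skel p))).1 p, S.continuous_of_cells fun n e => ?_,
    fun g p => ?_, fun p hp => (ψ _).2.1 p hp⟩
  · exact ((ψ (n + 1)).2.2.1 n n.lt_succ_self e).congr fun p =>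
      (hlim _ _ (S.charMap_mem n e p)).symm
  · obtain ⟨n, hn⟩ := S.exists_mem_skel p
    dsimp only
    rw [hlim n _ hn, hlim n _ (S.smul_mem_skel n g p hn), (ψ n).2.2.2 g p hn]

end GCWStructure

/-! ### Classifying spaces of families -/

namespace SubgroupFamily

variable {G : Type u} [Group G] (F : SubgroupFamily G)

/-- The disjoint union of the `G`-sets `G/U`, for `U` in the family. -/
abbrev Orbits : Type u := Σ U : F.carrier, G ⧸ U.1

theorem stabilizer_orbits_mem (s : F.Orbits) : MulAction.stabilizer G s ∈ F.carrier := by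
  obtain ⟨U, q⟩ := s
  obtain ⟨g, rfl⟩ := QuotientGroup.mk_surjective q
  refine F.mem_of_le _ (F.conj_mem U.1 U.2 g) _ fun k hk => ?_
  have hk : k ∈ MulAction.stabilizer G (g • ((1 : G) : G ⧸ U.1)) := by
    rw [MulAction.mem_stabilizer_iff, MulAction.Quotient.smul_coe, smul_eq_mul, mul_one]
    exact eq_of_heq (Sigma.mk.inj hk).2
  rwa [MulAction.stabilizer_smul_eq_stabilizer_map_conj, MulAction.stabilizer_quotient] at hk

theorem comap_comap {H K : Type u} [Group H] [Group K] (α : H →* K) (β : K →* G) :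
    (F.comap β).comap α = F.comap (β.comp α) := by
  simp [comap, Subgroup.map_map]

end SubgroupFamily

namespace IsClassifyingSpace

variable {G : Type u} [Group G] {F : SubgroupFamily G} {E : GCWComplex G}

theorem stabilizer_mem (hE : IsClassifyingSpace F E) (p : E.carrier) :
    MulAction.stabilizer G p ∈ F.carrier := by
  by_contra h
  have hp : p ∈ MulAction.fixedPoints (MulAction.stabilizer G p) E.carrier := fun k => k.2
  rw [hE.empty _ h] at hp
  exact hp

theorem contractibleSpace_telescope {U : Subgroup G} (hU : U ∈ F.carrier) :
    ContractibleSpace (MulAction.fixedPoints U (telescope G F.Orbits).carrier) := by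
  refine Telescope.contractibleSpace_fixedPoints (s := ⟨⟨U, hU⟩, ((1 : G) : G ⧸ U)⟩) fun k hk => ?_
  refine Sigma.ext rfl (heq_of_eq ?_)
  change k • ((1 : G) : G ⧸ U) = (1 : G)
  rw [← MulAction.mem_stabilizer_iff, MulAction.stabilizer_quotient]
  exact hk

/-- An equivariant self-map of a classifying space is homotopic to the identity. -/
theorem exists_homotopy (hE : IsClassifyingSpace F E) {ψ : E.carrier → E.carrier}
    (hψ : Continuous ψ) (hψ' : ∀ (g : G) p, ψ (g • p) = g • ψ p) :
    ∃ H : unitInterval × E.carrier → E.carrier, Continuous H ∧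
      (∀ t (g : G) p, H (t, g • p) = g • H (t, p)) ∧ (∀ p, H (0, p) = p) ∧
      ∀ p, H (1, p) = ψ p := by
  let φ : Hocoeq (sumInl E E) (sumInr E E) → E.carrier :=
    Hocoeq.lift (sumElim (fun p => p) ψ) fun p _ => p
  have hbase (b) : φ (Hocoeq.base _ _ b) = sumElim (fun p => p) ψ b := rfl
  have hφ : ContinuousOn φ (Set.range (Hocoeq.base (sumInl E E) (sumInr E E))) := by
    let e := (Hocoeq.isClosedEmbedding_base (sumInl E E) (sumInr E E)).isEmbedding.toHomeomorph
    rw [continuousOn_iff_continuous_domRestrict, ← e.comp_continuous_iff']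
    exact continuous_sum_iff.2 ⟨continuous_id, hψ⟩
  have hφ' (g : G) (q) (hq : q ∈ Set.range (Hocoeq.base (sumInl E E) (sumInr E E))) :
      φ (g • q) = g • φ q := by
    obtain ⟨b, rfl⟩ := hq
    exact sumElim_smul (fun _ _ => rfl) hψ' g b
  have hY (q : (cylinder E).carrier) :
      ContractibleSpace (MulAction.fixedPoints (MulAction.stabilizer G q) E.carrier) := by
    refine hE.contractible _ ?_
    rcases Hocoeq.stabilizer_le (f := sumInl E E) (g := sumInr E E) q with ⟨b, hb⟩ | ⟨p, hp⟩
    · revert hb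
      refine sum_cases (P := fun b => MulAction.stabilizer G q ≤ MulAction.stabilizer G b →
        MulAction.stabilizer G q ∈ F.carrier) (fun p hp => ?_) (fun p hp => ?_) b
      · exact F.mem_of_le _ (hE.stabilizer_mem p) _
          fun k hk => eq_of_heq (Sigma.mk.inj (hp hk)).2
      · exact F.mem_of_le _ (hE.stabilizer_mem p) _
          fun k hk => eq_of_heq (Sigma.mk.inj (hp hk)).2
    · exact F.mem_of_le _ (hE.stabilizer_mem p) _ hp
  obtain ⟨Φ, hΦ, hΦ', h⟩ := (cylinder E).cw.exists_extension hY
    (Hocoeq.basePair (sumInl E E) (sumInr E E)).isSubcomplex hφ hφ'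
  refine ⟨fun q => Φ (Hocoeq.cyl _ _ q.2 q.1), hΦ.comp ((Hocoeq.continuous_cyl _ _).comp
    continuous_swap), fun t g p => ?_, fun p => ?_, fun p => ?_⟩
  · exact (congrArg Φ (Hocoeq.smul_cyl g p t).symm).trans (hΦ' g _)
  · exact (congrArg Φ (Hocoeq.cyl_zero _ _ p)).trans (h _ ⟨_, rfl⟩)
  · exact (congrArg Φ (Hocoeq.cyl_one _ _ p)).trans (h _ ⟨_, rfl⟩)

/-- If a transformation of homology theories is an isomorphism on discrete `G`-sets, then it is one
on every classifying space of a family, because the latter is dominated by a telescope. -/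
theorem isIso {Λ : Type w} [Ring Λ] {h : GHomologyTheory.{u, w, x} G Λ}
    {k : GHomologyTheory.{u, w, y} G Λ} {τ : h.Trans k} (hE : IsClassifyingSpace F E)
    (hτ : ∀ (S : Type u) [MulAction G S], τ.IsIso (discrete G S).toPair) : τ.IsIso E.toPair := by
  have hbot (X : GCWComplex G) : X.cw.IsSubcomplex ⊥ := X.toPair.isSubcomplex
  have hf : ∃ f : E.carrier → (telescope G F.Orbits).carrier, Continuous f ∧
      ∀ (g : G) p, f (g • p) = g • f p := by
    have hY (p : E.carrier) := contractibleSpace_telescope (hE.stabilizer_mem p)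
    let φ : E.carrier → (telescope G F.Orbits).carrier := fun p =>
      have := hY p
      (Classical.arbitrary (MulAction.fixedPoints (MulAction.stabilizer G p)
        (telescope G F.Orbits).carrier)).1
    obtain ⟨f, h₁, h₂, -⟩ := E.cw.exists_extension hY (hbot E) (φ := φ) (continuousOn_empty φ)
      fun _ _ h => h.elim
    exact ⟨f, h₁, h₂⟩
  have hr : ∃ r : (telescope G F.Orbits).carrier → E.carrier, Continuous r ∧
      ∀ (g : G) p, r (g • p) = g • r p := by
    have hY (p : (telescope G F.Orbits).carrier) :
        ContractibleSpace (MulAction.fixedPoints (MulAction.stabilizer G p) E.carrier) := by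
      obtain ⟨s, hs⟩ := exists_stabilizer_le_telescope p
      exact hE.contractible _ (F.mem_of_le _ (F.stabilizer_orbits_mem s) _ hs)
    let φ : (telescope G F.Orbits).carrier → E.carrier := fun p =>
      have := hY p
      (Classical.arbitrary (MulAction.fixedPoints (MulAction.stabilizer G p) E.carrier)).1
    obtain ⟨f, h₁, h₂, -⟩ := (telescope G F.Orbits).cw.exists_extension hY (hbot _) (φ := φ)
      (continuousOn_empty φ) fun _ _ h => h.elim
    exact ⟨f, h₁, h₂⟩
  obtain ⟨f, hf, hf'⟩ := hf
  obtain ⟨r, hr, hr'⟩ := hr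
  obtain ⟨H, hH, hH', H0, H1⟩ := hE.exists_homotopy (ψ := r ∘ f) (hr.comp hf) fun g p => by
    rw [Function.comp_apply, hf', hr']
    rfl
  exact (GHomologyTheory.Trans.IsIso.telescope hτ F.Orbits).of_domination f hf hf' r hr hr' H hH
    hH' H0 H1

theorem res {H : Type u} [Group H] (hE : IsClassifyingSpace F E) (α : H →* G) :
    IsClassifyingSpace (F.comap α) (E.res α) := by
  have h (U : Subgroup H) : MulAction.fixedPoints U (E.res α).carrier =
      MulAction.fixedPoints (U.map α) E.carrier := by
    ext p
    refine ⟨?_, fun hp k => hp ⟨α k, k, k.2, rfl⟩⟩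
    rintro hp ⟨_, k, hk, rfl⟩
    exact hp ⟨k, hk⟩
  refine ⟨fun U hU => ?_, fun U hU => (h U).trans (hE.empty _ hU)⟩
  rw [h U]
  exact hE.contractible _ hU

end IsClassifyingSpace

/-! ### The Isomorphism Conjecture for a directed colimit -/

theorem mainTheorem7 {Γ : Type v} [Group Γ] {Λ : Type w} [Ring Λ]
    (𝓗 : EquivariantHomologyTheory.{u, v, w, x} Γ Λ) (h𝓗 : 𝓗.StronglyContinuous)
    {G : Type u} [Group G] (ξ : G →* Γ) (F : SubgroupFamily G)
    {I : Type u} [Preorder I] [IsDirectedOrder I] [Nonempty I] (D : DirectedColimit I G)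
    (hD : ∀ i, 𝓗.FiberedIsomorphismConjecture (ξ.comp (D.ψ i)) (F.comap (D.ψ i))) :
    𝓗.FiberedIsomorphismConjecture ξ F := by
  classical
  intro K _ φ E hE n
  have hdisc (S : Type u) [MulAction K S] :
      (𝓗.tTrans (ξ.comp φ) (D.pullback φ)).IsIso (discrete K S).toPair :=
    .discrete fun s m => EquivariantHomologyTheory.StronglyContinuous.t_transitive_bijective 𝓗 (ξ.comp φ)
      (D.pullback φ) m h𝓗
      (⟨s, MulAction.mem_orbit_self s⟩ : MulAction.orbit K s)
  have hsource : Function.Bijective (𝓗.colimMap (ξ.comp φ) (D.pullback φ) n E.toPoint) := by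
    refine Module.DirectLimit.map_bijective _
      (𝓗.map_comp_systemMap (ξ.comp φ) (D.pullback φ) n E.toPoint) fun i => ?_
    have hi := hD i _ (D.pullbackSnd φ i)
    rw [SubgroupFamily.comap_comap, MonoidHom.comp_assoc, D.ψ_comp_pullbackSnd,
      ← SubgroupFamily.comap_comap, ← MonoidHom.comp_assoc] at hi
    exact hi _ (hE.res _) n
  have e := funext ((𝓗.tTrans (ξ.comp φ) (D.pullback φ)).naturality n E.toPoint)
  refine (Function.Bijective.of_comp_iff _ (hE.isIso hdisc n)).1 ?_
  exact (congrArg Function.Bijective e).mp ((h𝓗 K (ξ.comp φ) I (D.pullback φ) n).comp hsource)
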